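/- Conventions. A simple hypergraph $\mathcal H$ has a finite vertex set $V(\mathcal H)$ and a set $\mathcal E(\mathcal H)$ of non-empty subsets of $V(\mathcal H)$, called edges, none of which contains another. Its independence complex $\Delta_{\mathcal H}$ consists of the subsets of $V(\mathcal H)$ that contain no edge. A simplicial complex $\Delta$ on a finite vertex set $V$ (elements of $V$ need not be faces) is vertex decomposable if its only facet is $V$, or $\Delta=\emptyset$, or there is $x\in V$ such that the deletion $\{F\in\Delta: x\notin F\}$ and the link $\{F: x\notin F,\ F\cup\{x\}\in\Delta\}$, as complexes on $V\setminus\{x\}$, are vertex decomposable and every facet of the deletion is a facet of $\Delta$; $\mathcal H$ is vertex decomposable if $\Delta_{\mathcal H}$ is. For $n\ge 2$, $\mathcal H$ is $C_n$-free if there are no distinct vertices $x_1,\dots,x_n$ and distinct edges $E_1,\dots,E_n$ with $x_i,x_{i+1}\in E_i$ for $1\le i<n$ and $x_n,x_1\in E_n$; it is $(C_2,C_5)$-free if it is $C_2$-free and $C_5$-free. A set $\{E_1,\dots,E_k\}$ ($k\ge 0$) of distinct edges is a matching if the $E_\ell$ are pairwise disjoint, a semi induced matching if $E_1,\dots,E_k$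 are the only edges contained in $\bigcup_\ell E_\ell$, and an induced matching if it is both. Let $m_{\mathcal H}$, $c'_{\mathcal H}$, $c_{\mathcal H}$ be the maximum of $|\bigcup_{\ell=1}^k E_\ell|-k$ over all matchings, semi induced matchings, and induced matchings, respectively. Let $K$ be a field, $R=K[x_v : v\in V(\mathcal H)]$ with the standard grading, and $I_{\Delta_{\mathcal H}}$ the Stanley–Reisner ideal, generated by the monomials $\prod_{v\in F}x_v$ with $F\subseteq V(\mathcal H)$, $F\notin\Delta_{\mathcal H}$. For a non-zero finitely generated graded $R$-module $M$, $\operatorname{reg}(M)=\max\{j-i : \beta_{i,j}(M)\ne 0\}$, where $\beta_{i,j}(M)$ is the number of generators of degree $j$ in the $i$-th module of the minimal graded free resolution of $M$. A simple graph is regarded as the hypergraph whose edges are its pairs of adjacent vertices. Corollary. (i) If $\mathcal H$ is a $(C_2,C_5)$-free vertex decomposable simple hypergraph with $c_{\mathcal H}=\dim\Delta_{\mathcal H}+1$, then $\operatorname{reg}(R/I_{\Delta_{\mathcal H}})=c_{\mathcal H}=c'_{\mathcal H}=\dim\Delta_{\mathcal H}+1$. (ii) If $\mathcal H$ is a $(C_2,C_5)$-free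 vertex decomposable simple hypergraph with $c_{\mathcal H}=c'_{\mathcal H}$, then $\operatorname{reg}(R/I_{\Delta_{\mathcal H}})=c_{\mathcal H}$. (iii) In particular, if $G$ is a finite simple $C_5$-free vertex decomposable graph, then $\operatorname{reg}(R/I_{\Delta_G})=c_G$. (iv) If $\mathcal H$ is a $d$-uniform simple hypergraph (all edges have cardinality $d$) such that $c_{\mathcal H}=m_{\mathcal H}$ and, for all distinct edges $E,E'$, $E\cap E'\ne\emptyset$ implies $|E\cap E'|=d-1$, then $\operatorname{reg}(R/I_{\Delta_{\mathcal H}})=c_{\mathcal H}=c'_{\mathcal H}=m_{\mathcal H}$. -/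

import Mathlib

/-! ### Hypergraphs and matching invariants -/

namespace Hypergraph

variable {α : Type*}

/-- A hypergraph is simple if its edges are non-empty and no edge contains another one. -/
def IsSimple (H : Hypergraph α) : Prop :=
  (∀ e ∈ H.edgeSet, e.Nonempty) ∧ IsAntichain (· ⊆ ·) H.edgeSet

/-- `H` contains an `n`-cycle: distinct vertices `x₁, …, xₙ` and distinct edges `E₁, …, Eₙ` with
`xᵢ, xᵢ₊₁ ∈ Eᵢ` for `i < n` and `xₙ, x₁ ∈ Eₙ`. Here `finRotate n` is the cyclic successor. -/
def HasCycle (H : Hypergraph α) (n : ℕ) : Prop :=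
  ∃ (x : Fin n → α) (E : Fin n → Set α), Function.Injective x ∧ Function.Injective E ∧
    ∀ i, E i ∈ H.edgeSet ∧ x i ∈ E i ∧ x (finRotate n i) ∈ E i

/-- `H` is `Cₙ`-free. -/
def CycleFree (H : Hypergraph α) (n : ℕ) : Prop :=
  ¬ H.HasCycle n

/-- A set of pairwise disjoint edges. -/
def IsEdgeMatching (H : Hypergraph α) (M : Set (Set α)) : Prop :=
  M ⊆ H.edgeSet ∧ M.PairwiseDisjoint id

/-- A set `M` of edges such that the only edges contained in the union of `M` are those in `M`. -/
def IsSemiInducedMatching (H : Hypergraph α) (M : Set (Set α)) : Prop :=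
  M ⊆ H.edgeSet ∧ ∀ e ∈ H.edgeSet, e ⊆ ⋃₀ M → e ∈ M

/-- A semi induced matching whose elements are pairwise disjoint. -/
def IsInducedEdgeMatching (H : Hypergraph α) (M : Set (Set α)) : Prop :=
  H.IsSemiInducedMatching M ∧ M.PairwiseDisjoint id

/-- The number `|E₁ ∪ ⋯ ∪ Eₖ| - k` for `M = {E₁, …, Eₖ}`. -/
noncomputable def matchingValue (M : Set (Set α)) : ℤ :=
  ((⋃₀ M).ncard : ℤ) - (M.ncard : ℤ)

/-- The induced matching number `c_H` (the empty matching is allowed). -/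
noncomputable def inducedMatchingNumber (H : Hypergraph α) : ℤ :=
  sSup {z | ∃ M, H.IsInducedEdgeMatching M ∧ z = matchingValue M}

/-- The semi induced matching number `c'_H`. -/
noncomputable def semiInducedMatchingNumber (H : Hypergraph α) : ℤ :=
  sSup {z | ∃ M, H.IsSemiInducedMatching M ∧ z = matchingValue M}

/-- The matching number `m_H`. -/
noncomputable def weightedMatchingNumber (H : Hypergraph α) : ℤ :=
  sSup {z | ∃ M, H.IsEdgeMatching M ∧ z = matchingValue M}

/-- Every edge of `H` has cardinality `d`. -/
def UniformOfCard (H : Hypergraph α) (d : ℕ) : Prop :=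
  ∀ e ∈ H.edgeSet, e.encard = d

end Hypergraph

/-- A simple graph, viewed as a hypergraph whose edges are the pairs of adjacent vertices. -/
def SimpleGraph.asHypergraph {α : Type*} (G : SimpleGraph α) : Hypergraph α where
  vertexSet := Set.univ
  edgeSet := {e | ∃ a b, G.Adj a b ∧ e = {a, b}}
  subset_vertexSet_of_mem_edgeSet' := fun _ _ => Set.subset_univ _

/-! ### Simplicial complexes -/

/-- A simplicial complex with a specified vertex set. The empty set may or may not be a face (so
the void complex and the complex `{∅}` are different), and a vertex need not be a face. -/
structure VertexedComplex (α : Type*) where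
  vertices : Set α
  faces : Set (Finset α)
  subset_vertices : ∀ F ∈ faces, (F : Set α) ⊆ vertices
  down_closed : IsLowerSet faces

namespace VertexedComplex

variable {α : Type*}

/-- A facet is an inclusion-maximal face. -/
def IsFacet (D : VertexedComplex α) (F : Finset α) : Prop :=
  Maximal (· ∈ D.faces) F

/-- The deletion of a vertex. -/
def deletion (D : VertexedComplex α) (x : α) : VertexedComplex α where
  vertices := D.vertices \ {x}
  faces := {F | F ∈ D.faces ∧ x ∉ F}
  subset_vertices := fun F hF y hy =>
    ⟨D.subset_vertices F hF.1 hy, fun h => hF.2 (by rw [← Set.mem_singleton_iff.mp h]; exact hy)⟩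
  down_closed := fun _ _ hGF hF => ⟨D.down_closed hGF hF.1, fun h => hF.2 (hGF h)⟩

/-- The link of a vertex: the faces are the `F` with `x ∉ F` and `F ∪ {x}` a face. -/
def link (D : VertexedComplex α) (x : α) : VertexedComplex α where
  vertices := D.vertices \ {x}
  faces := {F | ∃ h : x ∉ F, F.cons x h ∈ D.faces}
  subset_vertices := by
    rintro F ⟨hx, hF⟩ y hy
    exact ⟨D.subset_vertices _ hF (by simp [Finset.mem_coe.mp hy]),
      fun h => hx (by rw [← Set.mem_singleton_iff.mp h]; exact hy)⟩
  down_closed := by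
    rintro F G hGF ⟨hx, hF⟩
    exact ⟨fun h => hx (hGF h), D.down_closed (Finset.cons_subset_cons.mpr hGF) hF⟩

/-- Vertex decomposability: the only facet is the whole vertex set, or there are no faces at all,
or there is a shedding vertex with vertex decomposable deletion and link. -/
inductive IsVertexDecomposable : VertexedComplex α → Prop
  | simplex (D : VertexedComplex α) (V : Finset α) (hV : (V : Set α) = D.vertices)
      (h : ∀ F, D.IsFacet F ↔ F = V) : IsVertexDecomposable D
  | void (D : VertexedComplex α) (h : D.faces = ∅) : IsVertexDecomposable D
  | shed (D : VertexedComplex α) (x : α) (hx : x ∈ D.vertices)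
      (hdel : IsVertexDecomposable (D.deletion x)) (hlink : IsVertexDecomposable (D.link x))
      (hshed : ∀ F, (D.deletion x).IsFacet F → D.IsFacet F) : IsVertexDecomposable D

/-- The dimension: the maximum of `|F| - 1` over all faces `F`. -/
noncomputable def dim (D : VertexedComplex α) : ℤ :=
  sSup {z | ∃ F ∈ D.faces, z = (F.card : ℤ) - 1}

/-- The Stanley-Reisner ideal, generated by the monomials `∏_{v ∈ F} x_v` over the non-faces `F`,
in the polynomial ring whose variables are the vertices. -/
noncomputable def stanleyReisnerIdeal (D : VertexedComplex α) (K : Type*) [Field K] :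
    Ideal (MvPolynomial D.vertices K) :=
  Ideal.span {p | ∃ F : Finset D.vertices,
    F.map (Function.Embedding.subtype _) ∉ D.faces ∧ p = ∏ v ∈ F, MvPolynomial.X v}

end VertexedComplex

/-- The independence complex: its faces are the finite sets of vertices that contain no edge. -/
def Hypergraph.independenceComplex {α : Type*} (H : Hypergraph α) : VertexedComplex α where
  vertices := H.vertexSet
  faces := {F | (F : Set α) ⊆ H.vertexSet ∧ ∀ e ∈ H.edgeSet, ¬ e ⊆ (F : Set α)}
  subset_vertices := fun _ hF => hF.1
  down_closed := fun _ _ hGF hF =>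
    ⟨(Finset.coe_subset.mpr hGF).trans hF.1,
      fun e he h => hF.2 e he (h.trans (Finset.coe_subset.mpr hGF))⟩

/-- A hypergraph is vertex decomposable if its independence complex is. -/
def Hypergraph.IsVertexDecomposable {α : Type*} (H : Hypergraph α) : Prop :=
  H.independenceComplex.IsVertexDecomposable

/-! ### Graded Betti numbers and Castelnuovo-Mumford regularity -/

section Regularity

variable {σ K : Type*} [Field K]

/-- A minimal graded free resolution
`⋯ → F₂ → F₁ → F₀ → M → 0`
of a module `M` with graded pieces `ℳ j` over the standard graded polynomial ring `K[x_v : v ∈ σ]`.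
The module `Fᵢ` is free on `rank i` generators, the generator `b` having degree `deg i b`; all maps
are homogeneous of degree `0`, and minimality says that the entries of the matrices of the
differentials lie in the ideal generated by the variables. -/
structure MinimalGradedFreeResolution {M : Type*} [AddCommGroup M] [Module (MvPolynomial σ K) M]
    [Module K M] (ℳ : ℤ → Submodule K M) where
  rank : ℕ → ℕ
  deg : ∀ i, Fin (rank i) → ℤ
  d : ∀ i, (Fin (rank (i + 1)) → MvPolynomial σ K) →ₗ[MvPolynomial σ K]
    (Fin (rank i) → MvPolynomial σ K)
  aug : (Fin (rank 0) → MvPolynomial σ K) →ₗ[MvPolynomial σ K] M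
  aug_homogeneous : ∀ b, aug (Pi.single b 1) ∈ ℳ (deg 0 b)
  d_homogeneous : ∀ i b a, MvPolynomial.IsWeightedHomogeneous (fun _ : σ => (1 : ℤ))
    (d i (Pi.single b 1) a) (deg (i + 1) b - deg i a)
  aug_surjective : Function.Surjective aug
  exact_aug : Function.Exact (d 0) aug
  exact_d : ∀ i, Function.Exact (d (i + 1)) (d i)
  minimal : ∀ i b a, d i (Pi.single b 1) a ∈
    Ideal.span (Set.range (MvPolynomial.X : σ → MvPolynomial σ K))

open Classical in
/-- The graded Betti number `β_{i,j}(M)`: the number of generators of degree `j` in the `i`-th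
module of the minimal graded free resolution of `M` (which is unique up to isomorphism). -/
noncomputable def gradedBetti {M : Type*} [AddCommGroup M] [Module (MvPolynomial σ K) M]
    [Module K M] (ℳ : ℤ → Submodule K M) (i : ℕ) (j : ℤ) : ℕ :=
  if h : Nonempty (MinimalGradedFreeResolution (σ := σ) ℳ) then
    Nat.card {b : Fin (h.some.rank i) // h.some.deg i b = j}
  else 0

/-- `reg M = r`, that is, `r` is the maximum of the `j - i` with `β_{i,j}(M) ≠ 0`. -/
def HasRegularity (σ : Type*) {K : Type*} [Field K] {M : Type*} [AddCommGroup M]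
    [Module (MvPolynomial σ K) M] [Module K M] (ℳ : ℤ → Submodule K M) (r : ℤ) : Prop :=
  IsGreatest {s : ℤ | ∃ (i : ℕ) (j : ℤ), gradedBetti (σ := σ) ℳ i j ≠ 0 ∧ s = j - i} r

/-- The standard grading on `K[x_v : v ∈ σ] / I`: the images of the homogeneous polynomials. -/
noncomputable def quotientGrading (I : Ideal (MvPolynomial σ K)) (j : ℤ) :
    Submodule K (MvPolynomial σ K ⧸ I) :=
  (MvPolynomial.weightedHomogeneousSubmodule K (fun _ : σ => (1 : ℤ)) j).map
    (Ideal.Quotient.mkₐ K I).toLinearMap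

end Regularity

/-- `reg (R / I_{Δ_H}) = r`, where `R` is the polynomial ring over `K` on the vertices of `H`. -/
def Hypergraph.HasRegularity {α : Type*} (H : Hypergraph α) (K : Type*) [Field K] (r : ℤ) : Prop :=
  _root_.HasRegularity H.independenceComplex.vertices
    (quotientGrading (H.independenceComplex.stanleyReisnerIdeal K)) r

/-!
All bounds on the regularity are obtained from Koszul homology. For a graded module `M` over the
polynomial ring `R`, the `i`-th Koszul homology in total degree `j` is `Torᵢ(M, K)_j`, and its
dimension is the graded Betti number `β_{i,j}(M)`. Since the Betti numbers are read off from one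
chosen minimal resolution, this comes down to two facts: a minimal resolution exists
(`nonempty_minimalGradedFreeResolution`, where a minimal number of homogeneous generators is taken
in each step), and the degrees of its generators are determined by the Koszul homology of `M`
(`MinimalGradedFreeResolution.koszulVanishes_iff`, by dimension shifting along the resolution, the
Koszul complex of a free module being acyclic). So `reg (R / I) = r` holds as soon as the Koszul
homology in homological degree `i` and total degree `s + i` vanishes for all `s > r` and all `i`,
and does not vanish for `s = r` and some `i` (`hasRegularity_of_koszul`).

*Lower bound.* Let `M` be an induced matching with union `W`. The independence complex restricted
to `W` is the join of the boundaries of the simplices on the edges in `M`, which is a sphere. Its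
fundamental class corresponds to the Koszul cycle `x^{W \ T} e_T`, where `T` contains one vertex
from each edge in `M`. It is not a boundary since the alternating sum, over all such `T`, of the
coefficients at `x^{W \ T} e_T` vanishes on boundaries, by a sign reversing involution
(`not_koszulVanishes_of_matching`). Thus `reg ≥ c`, and a matching upper bound suffices
(`Hypergraph.hasRegularity_of_regularityLE`).

*Upper bounds.* Let `x^E` be the square-free monomial with support `E`. The exact sequence
`0 → R / (I : x^E) (-|E|) → R / I → R / (I + (x^E)) → 0` gives
`reg (R / I) ≤ max (reg (R / (I : x^E)) + |E|) (reg (R / (I + (x^E))))` and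
`reg (R / (I + (x^E))) ≤ max (reg (R / I)) (reg (R / (I : x^E)) + |E| - 1)`.

* With `E` a single vertex `x`, the two outer terms are given by the link and the deletion of `x`.
  Induction over all vertices yields `reg ≤ dim + 1`
  (`VertexedComplex.RegularityBound.of_card_le`).
* If `x` is a shedding vertex with non-void link and there are no 2-cycles and 5-cycles, then the
  semi induced matching number of the link is less than the one of the complex
  (`VertexedComplex.SemiInducedBound.link`, with `VertexedComplex.exists_mem_extension` as the
  crucial step). Induction over the vertex decomposition yields `reg ≤ c'`
  (`VertexedComplex.IsVertexDecomposable.regularityBound`).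
* If the hypergraph is `d`-uniform and intersecting edges meet in `d - 1` vertices, take for `I` the
  ideal of all edges but one, `E`. The colon ideal `I : x^E` is generated by variables and the edges
  disjoint from `E`, and a matching of such edges extends by `E`. Induction on the number of edges
  yields `reg ≤ m` (`regularityLE_of_uniform`).

*Comparisons.* Clearly `c ≤ c'`. Removing one vertex from each edge of a semi induced matching
leaves a face, so that `c' ≤ dim + 1`. For graphs `c' ≤ c`, as a semi induced matching with `k`
edges and `w` vertices has at least `w - k` components, and one edge from each of them gives an
induced matching. In the uniform case `c' ≤ m`, as the edges outside of a maximal matching add at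
most one vertex each. Together with the hypothesis on `c`, this determines all the invariants.
-/

open MvPolynomial Finset

/-! ### Koszul complexes of graded modules -/

section Koszul

variable {σ K : Type*} [Field K]
variable {M : Type*} [AddCommGroup M] [Module (MvPolynomial σ K) M]

/-- The coefficient `± x_v` of the basis vector `e_T` in the Koszul differential of
`e_{T ∪ {v}}`. The sign counts the elements of `T` before `v` in the order given by `ρ`. -/
noncomputable def koszulCoeff (K : Type*) [Field K] (ρ : σ ↪ ℕ) (v : σ) (T : Finset σ) :
    MvPolynomial σ K :=
  (-1) ^ #{t ∈ T | ρ t < ρ v} * X v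

lemma koszulCoeff_mul_insert [DecidableEq σ] (ρ : σ ↪ ℕ) {v w : σ} {T : Finset σ}
    (hv : v ∉ T) (hw : w ∉ T) (hvw : v ≠ w) :
    koszulCoeff K ρ v T * koszulCoeff K ρ w (insert v T) =
      - (koszulCoeff K ρ w T * koszulCoeff K ρ v (insert w T)) := by
  have h1 : ρ v ≠ ρ w := fun h => hvw (ρ.injective h)
  unfold koszulCoeff
  rw [filter_insert, filter_insert]
  rcases lt_or_gt_of_ne h1 with h | h
  · rw [if_pos h, if_neg (not_lt.mpr h.le), card_insert_of_notMem (by simp [hv])]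
    ring
  · rw [if_pos h, if_neg (not_lt.mpr h.le), card_insert_of_notMem (by simp [hw])]
    ring

variable [Fintype σ] [DecidableEq σ]

/-- The Koszul differential of `M ⊗ Λ(K^σ)`. An element of this module is written as a function `c`
with `c S` the coefficient of the basis vector `e_S`. -/
noncomputable def koszulD (ρ : σ ↪ ℕ) :
    (Finset σ → M) →ₗ[MvPolynomial σ K] (Finset σ → M) :=
  LinearMap.pi fun T => ∑ v ∈ Tᶜ, koszulCoeff K ρ v T • LinearMap.proj (insert v T)

lemma koszulD_apply (ρ : σ ↪ ℕ) (c : Finset σ → M) (T : Finset σ) :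
    koszulD (K := K) ρ c T = ∑ v ∈ Tᶜ, koszulCoeff K ρ v T • c (insert v T) := by
  simp [koszulD]

lemma koszulD_koszulD (ρ : σ ↪ ℕ) (c : Finset σ → M) :
    koszulD (K := K) ρ (koszulD (K := K) ρ c) = 0 := by
  funext T
  simp only [koszulD_apply, smul_sum, smul_smul, Pi.zero_apply]
  rw [Finset.sum_sigma']
  refine Finset.sum_involution (fun p _ => ⟨p.2, p.1⟩) ?_ ?_ ?_ ?_
  · rintro ⟨v, w⟩ h
    simp only [mem_sigma, mem_compl, mem_insert, not_or] at h
    rw [koszulCoeff_mul_insert ρ h.1 h.2.2 (Ne.symm h.2.1), neg_smul, Finset.insert_comm]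
    simp
  · rintro ⟨v, w⟩ h _ h'
    simp only [mem_sigma, mem_compl, mem_insert, not_or] at h
    simp only [Sigma.mk.injEq] at h'
    exact h.2.1 h'.1
  · rintro ⟨v, w⟩ h
    simp only [mem_sigma, mem_compl, mem_insert, not_or] at h ⊢
    exact ⟨h.2.2, Ne.symm h.2.1, h.1⟩
  · rintro ⟨v, w⟩ _
    rfl

lemma map_koszulD {N : Type*} [AddCommGroup N] [Module (MvPolynomial σ K) N] (ρ : σ ↪ ℕ)
    (f : M →ₗ[MvPolynomial σ K] N) (c : Finset σ → M) :
    (fun S => f (koszulD (K := K) ρ c S)) = koszulD (K := K) ρ (fun S => f (c S)) := by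
  funext S
  simp [koszulD_apply]

/-- The family `𝒢` is compatible with the standard grading of the polynomial ring. -/
def IsGradedFamily (σ K : Type*) [Field K] [Module (MvPolynomial σ K) M]
    (𝒢 : ℤ → AddSubgroup M) : Prop :=
  ∀ (v : σ) (s : ℤ) (m : M), m ∈ 𝒢 s → (X v : MvPolynomial σ K) • m ∈ 𝒢 (s + 1)

/-- The part of `M ⊗ Λⁱ(K^σ)` with coefficients in the graded piece `𝒢 s`. Its total degree is
`s + i`. -/
def koszulChains (σ : Type*) (𝒢 : ℤ → AddSubgroup M) (i : ℕ) (s : ℤ) :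
    AddSubgroup (Finset σ → M) where
  carrier := {c | ∀ S, c S ∈ 𝒢 s ∧ (S.card ≠ i → c S = 0)}
  zero_mem' := fun S => ⟨zero_mem _, fun _ => rfl⟩
  add_mem' := fun ha hb S => ⟨add_mem (ha S).1 (hb S).1, fun h => by
    simp [(ha S).2 h, (hb S).2 h]⟩
  neg_mem' := fun ha S => ⟨neg_mem (ha S).1, fun h => by simp [(ha S).2 h]⟩

lemma koszulD_mem_koszulChains (ρ : σ ↪ ℕ) {𝒢 : ℤ → AddSubgroup M} (h𝒢 : IsGradedFamily σ K 𝒢)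
    {i : ℕ} {s : ℤ} {c : Finset σ → M} (hc : c ∈ koszulChains σ 𝒢 (i + 1) s) :
    koszulD (K := K) ρ c ∈ koszulChains σ 𝒢 i (s + 1) := by
  refine fun T => ⟨?_, fun hT => ?_⟩
  · rw [koszulD_apply]
    refine sum_mem fun v _ => ?_
    rw [koszulCoeff, mul_smul]
    rcases neg_one_pow_eq_or (MvPolynomial σ K) #{t ∈ T | ρ t < ρ v} with h | h
    · rw [h, one_smul]; exact h𝒢 _ _ _ (hc _).1
    · rw [h, neg_smul, one_smul]; exact neg_mem (h𝒢 _ _ _ (hc _).1)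
  · rw [koszulD_apply]
    refine Finset.sum_eq_zero fun v hv => ?_
    rw [(hc _).2, smul_zero]
    rw [card_insert_of_notMem (by simpa using hv)]
    omega

/-- The Koszul homology of `M` vanishes in homological degree `i` and total degree `s + i`, that
is, `Torᵢ(M, K)_{s + i} = 0`. -/
def KoszulVanishes (K : Type*) [Field K] [Module (MvPolynomial σ K) M] (ρ : σ ↪ ℕ)
    (𝒢 : ℤ → AddSubgroup M) (i : ℕ) (s : ℤ) : Prop :=
  ∀ c ∈ koszulChains σ 𝒢 i s, koszulD (K := K) ρ c = 0 →
    ∃ b ∈ koszulChains σ 𝒢 (i + 1) (s - 1), koszulD (K := K) ρ b = c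

end Koszul

/-! ### Short exact sequences and Koszul homology -/

section ShortExact

variable {σ K : Type*} [Field K]
variable {A B C : Type*} [AddCommGroup A] [Module (MvPolynomial σ K) A]
  [AddCommGroup B] [Module (MvPolynomial σ K) B] [AddCommGroup C] [Module (MvPolynomial σ K) C]

/-- The sequence `0 → A → B → C → 0` of graded modules is exact in each degree. -/
structure GradedShortExact (𝒜 : ℤ → AddSubgroup A) (ℬ : ℤ → AddSubgroup B)
    (𝒞 : ℤ → AddSubgroup C) (f : A →ₗ[MvPolynomial σ K] B) (g : B →ₗ[MvPolynomial σ K] C) :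
    Prop where
  injective : Function.Injective f
  comp_eq_zero : ∀ a, g (f a) = 0
  map_left : ∀ s, ∀ a ∈ 𝒜 s, f a ∈ ℬ s
  map_right : ∀ s, ∀ b ∈ ℬ s, g b ∈ 𝒞 s
  exists_left : ∀ s, ∀ b ∈ ℬ s, g b = 0 → ∃ a ∈ 𝒜 s, f a = b
  exists_right : ∀ s, ∀ c ∈ 𝒞 s, ∃ b ∈ ℬ s, g b = c

variable {𝒜 : ℤ → AddSubgroup A} {ℬ : ℤ → AddSubgroup B} {𝒞 : ℤ → AddSubgroup C}
  {f : A →ₗ[MvPolynomial σ K] B} {g : B →ₗ[MvPolynomial σ K] C}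

namespace GradedShortExact

lemma chain_map_left (h : GradedShortExact 𝒜 ℬ 𝒞 f g) {i : ℕ} {s : ℤ} {a : Finset σ → A}
    (ha : a ∈ koszulChains σ 𝒜 i s) : (fun S => f (a S)) ∈ koszulChains σ ℬ i s :=
  fun S => ⟨h.map_left _ _ (ha S).1, fun hS => by simp [(ha S).2 hS]⟩

lemma chain_map_right (h : GradedShortExact 𝒜 ℬ 𝒞 f g) {i : ℕ} {s : ℤ} {b : Finset σ → B}
    (hb : b ∈ koszulChains σ ℬ i s) : (fun S => g (b S)) ∈ koszulChains σ 𝒞 i s :=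
  fun S => ⟨h.map_right _ _ (hb S).1, fun hS => by simp [(hb S).2 hS]⟩

lemma chain_exists_left (h : GradedShortExact 𝒜 ℬ 𝒞 f g) {i : ℕ} {s : ℤ} {b : Finset σ → B}
    (hb : b ∈ koszulChains σ ℬ i s) (h0 : ∀ S, g (b S) = 0) :
    ∃ a ∈ koszulChains σ 𝒜 i s, (fun S => f (a S)) = b := by
  choose a ha1 ha2 using fun S => h.exists_left s (b S) (hb S).1 (h0 S)
  refine ⟨a, fun S => ⟨ha1 S, fun hS => h.injective ?_⟩, funext ha2⟩
  rw [ha2, (hb S).2 hS, map_zero]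

lemma chain_exists_right (h : GradedShortExact 𝒜 ℬ 𝒞 f g) {i : ℕ} {s : ℤ} {c : Finset σ → C}
    (hc : c ∈ koszulChains σ 𝒞 i s) :
    ∃ b ∈ koszulChains σ ℬ i s, (fun S => g (b S)) = c := by
  choose b hb1 hb2 using fun S => h.exists_right s (c S) (hc S).1
  refine ⟨fun S => if S.card = i then b S else 0, fun S => ⟨?_, fun hS => if_neg hS⟩,
    funext fun S => ?_⟩
  · dsimp only
    split_ifs
    exacts [hb1 S, zero_mem _]
  · dsimp only
    split_ifs with hS
    exacts [hb2 S, by rw [(hc S).2 hS, map_zero]]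

variable [Fintype σ] [DecidableEq σ] {ρ : σ ↪ ℕ} {i : ℕ} {s : ℤ}

/-- Exactness of Koszul homology at the middle term. -/
lemma vanishes_middle (h : GradedShortExact 𝒜 ℬ 𝒞 f g) (hℬ : IsGradedFamily σ K ℬ)
    (hA : KoszulVanishes K ρ 𝒜 i s) (hC : KoszulVanishes K ρ 𝒞 i s) :
    KoszulVanishes K ρ ℬ i s := by
  intro b hb hdb
  obtain ⟨c, hc, hdc⟩ := hC _ (h.chain_map_right hb) (by
    rw [← map_koszulD, hdb]; funext S; simp)
  obtain ⟨e, he, rfl⟩ := h.chain_exists_right hc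
  have hde := koszulD_mem_koszulChains (K := K) ρ hℬ he
  rw [sub_add_cancel] at hde
  obtain ⟨a, ha, hab⟩ := h.chain_exists_left (sub_mem hb hde) (fun S => by
    have := congrFun hdc S
    rw [← map_koszulD] at this
    simp [this])
  obtain ⟨a', ha', hda'⟩ := hA a ha (by
    funext S
    apply h.injective
    have := congrFun (map_koszulD (K := K) ρ f a) S
    rw [this, hab, map_sub, hdb, koszulD_koszulD]
    simp)
  refine ⟨(fun S => f (a' S)) + e, add_mem (h.chain_map_left ha') he, ?_⟩
  rw [map_add, ← map_koszulD, hda', hab, sub_add_cancel]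

/-- Exactness of Koszul homology at the right term. -/
lemma vanishes_right (h : GradedShortExact 𝒜 ℬ 𝒞 f g) (hℬ : IsGradedFamily σ K ℬ)
    (hA : KoszulVanishes K ρ 𝒜 i (s + 1)) (hB : KoszulVanishes K ρ ℬ (i + 1) s) :
    KoszulVanishes K ρ 𝒞 (i + 1) s := by
  intro c hc hdc
  obtain ⟨b, hb, rfl⟩ := h.chain_exists_right hc
  obtain ⟨a, ha, hab⟩ := h.chain_exists_left (koszulD_mem_koszulChains (K := K) ρ hℬ hb)
    (fun S => by
      rw [← map_koszulD] at hdc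
      exact congrFun hdc S)
  obtain ⟨a', ha', hda'⟩ := hA a ha (by
    funext S
    apply h.injective
    have := congrFun (map_koszulD (K := K) ρ f a) S
    rw [this, hab, koszulD_koszulD]
    simp)
  rw [add_sub_cancel_right] at ha'
  obtain ⟨e, he, hde⟩ := hB (b - fun S => f (a' S)) (sub_mem hb (h.chain_map_left ha')) (by
    rw [map_sub, ← map_koszulD, hda', hab, sub_self])
  refine ⟨fun S => g (e S), h.chain_map_right he, ?_⟩
  rw [← map_koszulD, hde]
  funext S
  simp [h.comp_eq_zero]

/-- Koszul homology in homological degree `0` is right exact. -/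
lemma vanishes_right_zero (h : GradedShortExact 𝒜 ℬ 𝒞 f g)
    (hB : KoszulVanishes K ρ ℬ 0 s) : KoszulVanishes K ρ 𝒞 0 s := by
  intro c hc _
  obtain ⟨b, hb, rfl⟩ := h.chain_exists_right hc
  obtain ⟨e, he, hde⟩ := hB b hb (by
    funext T
    rw [koszulD_apply]
    refine Finset.sum_eq_zero fun v _ => ?_
    rw [(hb _).2 (by simp), smul_zero])
  refine ⟨fun S => g (e S), h.chain_map_right he, ?_⟩
  rw [← map_koszulD, hde]

/-- The connecting map `H_{i+1}(C) → H_i(A)` is onto those classes that die in `B`. -/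
lemma vanishes_left (h : GradedShortExact 𝒜 ℬ 𝒞 f g) (hℬ : IsGradedFamily σ K ℬ)
    (hB : ∀ a ∈ koszulChains σ 𝒜 i (s + 1), koszulD (K := K) ρ a = 0 →
      ∃ b ∈ koszulChains σ ℬ (i + 1) s, koszulD (K := K) ρ b = fun S => f (a S))
    (hC : KoszulVanishes K ρ 𝒞 (i + 1) s) :
    KoszulVanishes K ρ 𝒜 i (s + 1) := by
  intro a ha hda
  obtain ⟨b, hb, hdb⟩ := hB a ha hda
  obtain ⟨c, hc, hdc⟩ := hC _ (h.chain_map_right hb) (by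
    rw [← map_koszulD, hdb]; funext S; simp [h.comp_eq_zero])
  obtain ⟨e, he, rfl⟩ := h.chain_exists_right hc
  have hde := koszulD_mem_koszulChains (K := K) ρ hℬ he
  rw [sub_add_cancel] at hde
  obtain ⟨a', ha', hab⟩ := h.chain_exists_left (sub_mem hb hde) (fun S => by
    have := congrFun hdc S
    rw [← map_koszulD] at this
    simp [this])
  refine ⟨a', by rwa [add_sub_cancel_right], ?_⟩
  funext S
  apply h.injective
  have := congrFun (map_koszulD (K := K) ρ f a') S
  rw [this, hab, map_sub, hdb, koszulD_koszulD, sub_zero]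

end GradedShortExact

end ShortExact

/-! ### Acyclicity of the Koszul complex of a free module -/

section FreeKoszul

variable {σ K : Type*} [Field K]

/-- The standard grading of the polynomial ring. -/
noncomputable def stdGrading (σ K : Type*) [Field K] (s : ℤ) : AddSubgroup (MvPolynomial σ K) :=
  (weightedHomogeneousSubmodule K (fun _ : σ => (1 : ℤ)) s).toAddSubgroup

lemma mem_stdGrading {s : ℤ} {p : MvPolynomial σ K} :
    p ∈ stdGrading σ K s ↔ ∀ a, coeff a p ≠ 0 → Finsupp.weight (fun _ : σ => (1 : ℤ)) a = s :=
  Iff.rfl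

lemma isGradedFamily_stdGrading : IsGradedFamily σ K (stdGrading σ K) := by
  intro v s p hp
  have h := (isWeightedHomogeneous_X K (fun _ : σ => (1 : ℤ)) v).mul
    (show IsWeightedHomogeneous (fun _ : σ => (1 : ℤ)) p s from hp)
  rw [add_comm] at h
  exact h

lemma constantCoeff_eq_zero_of_mem_span_X {p : MvPolynomial σ K}
    (hp : p ∈ Ideal.span (Set.range (X : σ → MvPolynomial σ K))) : constantCoeff p = 0 := by
  have : Ideal.span (Set.range (X : σ → MvPolynomial σ K)) ≤ RingHom.ker constantCoeff := by
    rw [Ideal.span_le]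
    rintro _ ⟨v, rfl⟩
    simp
  exact this hp

lemma mem_span_X_of_constantCoeff_eq_zero {p : MvPolynomial σ K} (hp : constantCoeff p = 0) :
    p ∈ Ideal.span (Set.range (X : σ → MvPolynomial σ K)) := by
  rw [← Set.image_univ, mem_ideal_span_X_image]
  intro m hm
  by_contra! h
  have : m = 0 := by ext v; simpa using h v
  subst this
  exact (mem_support_iff.mp hm) hp

open Classical in
/-- Divide by `x_v` those monomials of `p` that involve no variable before `v`, and drop the
others together with those not divisible by `x_v`. -/
noncomputable def leadDiv (ρ : σ ↪ ℕ) (v : σ) (p : MvPolynomial σ K) : MvPolynomial σ K :=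
  (∑ a ∈ p.support with ∀ w, ρ w < ρ v → a w = 0, monomial a (coeff a p)).divMonomial
    (Finsupp.single v 1)

open Classical in
lemma coeff_leadDiv (ρ : σ ↪ ℕ) (v : σ) (p : MvPolynomial σ K) (a : σ →₀ ℕ) :
    coeff a (leadDiv ρ v p) =
      if ∀ w, ρ w < ρ v → a w = 0 then coeff (a + Finsupp.single v 1) p else 0 := by
  have hiff : (∀ w, ρ w < ρ v → (Finsupp.single v 1 + a : σ →₀ ℕ) w = 0) ↔
      ∀ w, ρ w < ρ v → a w = 0 := by
    refine forall₂_congr fun w hw => ?_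
    have : v ≠ w := by rintro rfl; exact lt_irrefl _ hw
    simp [this]
  rw [leadDiv, coeff_divMonomial, coeff_sum]
  simp only [coeff_monomial]
  rw [Finset.sum_ite_eq', add_comm a]
  simp only [mem_filter, hiff, mem_support_iff]
  by_cases h : ∀ w, ρ w < ρ v → a w = 0
  · rw [if_pos h]
    split_ifs with h0
    · rfl
    · by_contra hne
      exact h0 ⟨Ne.symm hne, h⟩
  · rw [if_neg h, if_neg (fun h' => h h'.2)]

variable [DecidableEq σ]

open Classical in
/-- The contracting homotopy of the Koszul complex of the polynomial ring: in the multidegree of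
`x^a e_T`, with first variable `u`, it takes `x^a e_T` to `x^a x_u⁻¹ e_{T ∪ {u}}` if `u ∉ T`, and
to zero otherwise. -/
noncomputable def koszulHomotopy (ρ : σ ↪ ℕ) (c : Finset σ → MvPolynomial σ K) (S : Finset σ) :
    MvPolynomial σ K :=
  if h : S.Nonempty then
    leadDiv ρ (S.exists_min_image ρ h).choose (c (S.erase (S.exists_min_image ρ h).choose))
  else 0

lemma koszulHomotopy_of_isLeast (ρ : σ ↪ ℕ) (c : Finset σ → MvPolynomial σ K) {S : Finset σ}
    {u : σ} (hu : u ∈ S) (hmin : ∀ w ∈ S, ρ u ≤ ρ w) :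
    koszulHomotopy ρ c S = leadDiv ρ u (c (S.erase u)) := by
  have h : S.Nonempty := ⟨u, hu⟩
  have hc := (S.exists_min_image ρ h).choose_spec
  have : (S.exists_min_image ρ h).choose = u :=
    ρ.injective (le_antisymm (hc.2 u hu) (hmin _ hc.1))
  rw [koszulHomotopy, dif_pos h]
  congr!

variable [Fintype σ]

lemma coeff_koszulD (ρ : σ ↪ ℕ) (c : Finset σ → MvPolynomial σ K) (T : Finset σ) (a : σ →₀ ℕ) :
    coeff a (koszulD (K := K) ρ c T) = ∑ v ∈ Tᶜ, if a v = 0 then 0 else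
      (-1) ^ #{t ∈ T | ρ t < ρ v} * coeff (a - Finsupp.single v 1) (c (insert v T)) := by
  rw [koszulD_apply, coeff_sum]
  refine Finset.sum_congr rfl fun v _ => ?_
  have : ((-1 : MvPolynomial σ K) ^ #{t ∈ T | ρ t < ρ v}) =
      C ((-1 : K) ^ #{t ∈ T | ρ t < ρ v}) := by simp
  rw [koszulCoeff, smul_eq_mul, mul_assoc, this, coeff_C_mul, coeff_X_mul']
  by_cases h : a v = 0 <;> simp [h]

/-- The homotopy formula, in all multidegrees but `0`. -/
lemma coeff_koszulD_koszulHomotopy (ρ : σ ↪ ℕ) {c : Finset σ → MvPolynomial σ K}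
    (hc : koszulD (K := K) ρ c = 0) (T : Finset σ) (a : σ →₀ ℕ) (hne : T.Nonempty ∨ a ≠ 0) :
    coeff a (koszulD (K := K) ρ (koszulHomotopy ρ c) T) = coeff a (c T) := by
  have hZ : (T ∪ a.support).Nonempty := by
    rcases hne with h | h
    · exact h.mono subset_union_left
    · exact (Finsupp.support_nonempty_iff.mpr h).mono subset_union_right
  obtain ⟨u, huZ, hmin⟩ := (T ∪ a.support).exists_min_image ρ hZ
  have hTmin : ∀ w ∈ T, ρ u ≤ ρ w := fun w hw => hmin w (mem_union_left _ hw)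
  have hamin : ∀ w, ρ w < ρ u → a w = 0 := fun w hw => by
    by_contra h
    exact absurd (hmin w (mem_union_right _ (Finsupp.mem_support_iff.mpr h))) (not_le.mpr hw)
  have hamin' : ∀ v w, ρ w < ρ u → (a - Finsupp.single v 1 : σ →₀ ℕ) w = 0 := fun v w hw => by
    simp [hamin w hw]
  rw [coeff_koszulD]
  by_cases huT : u ∈ T
  · have h0 := congrArg (coeff (a + Finsupp.single u 1)) (congrFun hc (T.erase u))
    rw [coeff_koszulD, compl_erase, Finset.sum_insert (by simpa using huT)] at h0
    have hcard : #{t ∈ T.erase u | ρ t < ρ u} = 0 := by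
      rw [card_eq_zero, filter_eq_empty_iff]
      intro t ht
      exact not_lt.mpr (hTmin t (mem_of_mem_erase ht))
    rw [hcard, insert_erase huT] at h0
    simp only [Finsupp.add_apply, Finsupp.single_eq_same, Nat.add_eq_zero_iff, one_ne_zero,
      and_false, if_false, pow_zero, one_mul, add_tsub_cancel_right, Pi.zero_apply,
      coeff_zero] at h0
    rw [eq_neg_of_add_eq_zero_left h0, ← Finset.sum_neg_distrib]
    refine Finset.sum_congr rfl fun v hv => ?_
    have hvT : v ∉ T := by simpa using hv
    have hvu : u ≠ v := by rintro rfl; exact hvT huT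
    by_cases hav : a v = 0
    · simp [hav, hvu]
    · have hlt : ρ u < ρ v := lt_of_le_of_ne
        (hmin v (mem_union_right _ (Finsupp.mem_support_iff.mpr hav)))
        (fun h => hvu (ρ.injective h))
      rw [koszulHomotopy_of_isLeast ρ c (u := u) (mem_insert_of_mem huT) (by
        intro w hw
        rcases mem_insert.mp hw with rfl | hw
        exacts [hlt.le, hTmin w hw])]
      rw [coeff_leadDiv, if_pos (hamin' v)]
      have e1 : (insert v T).erase u = insert v (T.erase u) := by
        rw [erase_insert_of_ne (Ne.symm hvu)]
      have e2 : a - Finsupp.single v 1 + Finsupp.single u 1 =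
          a + Finsupp.single u 1 - Finsupp.single v 1 := by
        ext w
        by_cases h1 : v = w
        · subst h1; simp [hvu]
        · simp [h1]
      have e3 : #{t ∈ T | ρ t < ρ v} = #{t ∈ T.erase u | ρ t < ρ v} + 1 := by
        rw [← insert_erase huT, filter_insert, if_pos hlt, card_insert_of_notMem (by simp),
          insert_erase huT]
      rw [e1, e2, e3]
      simp only [Finsupp.single_eq_of_ne hvu.symm, hav, false_and, if_false]
      ring
  · have hau : a u ≠ 0 := by
      rcases mem_union.mp huZ with h | h
      exacts [absurd h huT, Finsupp.mem_support_iff.mp h]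
    rw [Finset.sum_eq_single u]
    · have hcard : #{t ∈ T | ρ t < ρ u} = 0 := by
        rw [card_eq_zero, filter_eq_empty_iff]
        intro t ht
        exact not_lt.mpr (hTmin t ht)
      rw [if_neg hau, hcard, pow_zero, one_mul,
        koszulHomotopy_of_isLeast ρ c (u := u) (mem_insert_self _ _) (by
        intro w hw
        rcases mem_insert.mp hw with rfl | hw
        exacts [le_rfl, hTmin w hw]), coeff_leadDiv, if_pos (hamin' u), erase_insert huT]
      congr 1
      ext w
      by_cases h1 : u = w
      · subst h1; simp; omega
      · simp [h1]
    · intro v hv hvu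
      have hvT : v ∉ T := by simpa using hv
      by_cases hav : a v = 0
      · rw [if_pos hav]
      · obtain ⟨m, hm, hmm⟩ := (insert v T).exists_min_image ρ ⟨v, mem_insert_self _ _⟩
        have hmZ : m ∈ T ∪ a.support := by
          rcases mem_insert.mp hm with rfl | h
          exacts [mem_union_right _ (Finsupp.mem_support_iff.mpr hav), mem_union_left _ h]
        have hmu : m ≠ u := by
          rintro rfl
          rcases mem_insert.mp hm with h | h
          exacts [hvu h.symm, huT h]
        have hlt : ρ u < ρ m := lt_of_le_of_ne (hmin m hmZ) fun h => hmu (ρ.injective h).symm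
        rw [koszulHomotopy_of_isLeast ρ c hm hmm, if_neg hav, coeff_leadDiv, if_neg]
        · simp
        · intro h
          have := h u hlt
          simp [Finsupp.single_eq_of_ne (Ne.symm hvu)] at this
          exact hau this
    · intro h
      exact absurd huT (by simpa using h)

/-- Acyclicity of the Koszul complex of the polynomial ring: a homogeneous cycle is a boundary
unless it has homological degree `0` and a non-zero constant term. -/
lemma exists_koszulD_eq_of_stdGrading (ρ : σ ↪ ℕ) {i : ℕ} {s : ℤ}
    {c : Finset σ → MvPolynomial σ K} (hc : c ∈ koszulChains σ (stdGrading σ K) i s)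
    (hdc : koszulD (K := K) ρ c = 0) (h0 : constantCoeff (c ∅) = 0) :
    ∃ b ∈ koszulChains σ (stdGrading σ K) (i + 1) (s - 1), koszulD (K := K) ρ b = c := by
  refine ⟨koszulHomotopy ρ c, fun S => ?_, ?_⟩
  · rcases S.eq_empty_or_nonempty with rfl | hS
    · have : koszulHomotopy ρ c ∅ = 0 := by simp [koszulHomotopy]
      rw [this]
      exact ⟨zero_mem _, fun _ => rfl⟩
    · obtain ⟨u, hu, hmin⟩ := S.exists_min_image ρ hS
      rw [koszulHomotopy_of_isLeast ρ c hu hmin]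
      refine ⟨?_, fun h => ?_⟩
      · rw [mem_stdGrading]
        intro a ha
        rw [coeff_leadDiv] at ha
        split_ifs at ha with h1
        · have := mem_stdGrading.mp (hc _).1 _ ha
          rw [map_add, Finsupp.weight_single, one_smul] at this
          omega
        · exact absurd rfl ha
      · have hcard := card_erase_add_one hu
        rw [(hc _).2 (by omega)]
        ext a
        classical
        rw [coeff_leadDiv]
        simp
  · funext T
    ext a
    by_cases h : T.Nonempty ∨ a ≠ 0
    · exact coeff_koszulD_koszulHomotopy ρ hdc T a h
    · push Not at h
      obtain ⟨rfl, rfl⟩ := h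
      rw [coeff_koszulD]
      simpa [constantCoeff_eq] using h0.symm

variable {n : ℕ}

/-- The grading of the free module of rank `n` whose `a`-th basis vector has degree `deg a`. -/
noncomputable def freeGrading (K : Type*) [Field K] (σ : Type*) {n : ℕ} (deg : Fin n → ℤ) (s : ℤ) :
    AddSubgroup (Fin n → MvPolynomial σ K) :=
  AddSubgroup.pi Set.univ fun a => stdGrading σ K (s - deg a)

lemma mem_freeGrading {σ : Type*} {deg : Fin n → ℤ} {s : ℤ} {f : Fin n → MvPolynomial σ K} :
    f ∈ freeGrading K σ deg s ↔ ∀ a, f a ∈ stdGrading σ K (s - deg a) := by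
  simp [freeGrading, AddSubgroup.mem_pi]

lemma isGradedFamily_freeGrading {σ : Type*} (deg : Fin n → ℤ) :
    IsGradedFamily σ K (freeGrading K σ deg) := by
  intro v s f hf
  rw [mem_freeGrading] at hf ⊢
  intro a
  rw [add_sub_right_comm]
  exact isGradedFamily_stdGrading v _ _ (hf a)

/-- Acyclicity of the Koszul complex of a graded free module. -/
lemma exists_koszulD_eq_of_freeGrading (ρ : σ ↪ ℕ) {i : ℕ} {s : ℤ} {deg : Fin n → ℤ}
    {c : Finset σ → Fin n → MvPolynomial σ K} (hc : c ∈ koszulChains σ (freeGrading K σ deg) i s)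
    (hdc : koszulD (K := K) ρ c = 0) (h0 : ∀ a, constantCoeff (c ∅ a) = 0) :
    ∃ b ∈ koszulChains σ (freeGrading K σ deg) (i + 1) (s - 1), koszulD (K := K) ρ b = c := by
  have key : ∀ a, ∃ b ∈ koszulChains σ (stdGrading σ K) (i + 1) (s - deg a - 1),
      koszulD (K := K) ρ b = fun S => c S a := fun a =>
    exists_koszulD_eq_of_stdGrading ρ
      (fun S => ⟨mem_freeGrading.mp (hc S).1 a, fun h => by simp [(hc S).2 h]⟩)
      ((map_koszulD (K := K) ρ (LinearMap.proj a) c).symm.trans (by rw [hdc]; rfl)) (h0 a)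
  choose b hb hdb using key
  refine ⟨fun S a => b a S, fun S => ⟨mem_freeGrading.mpr fun a => ?_, fun h => ?_⟩, ?_⟩
  · rw [sub_right_comm]
    exact (hb a S).1
  · funext a
    exact (hb a S).2 h
  · funext S a
    have h1 := congrFun (map_koszulD (K := K) ρ (LinearMap.proj a) (fun S a => b a S)) S
    have h2 := congrFun (hdb a) S
    exact h1.trans h2

end FreeKoszul

/-! ### Homogeneous components in graded free modules -/

section FreeModules

variable {σ K : Type*} [Field K] {m n : ℕ}

/-- The homogeneous component of degree `s` of a polynomial, for the standard grading over `ℤ`. -/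
noncomputable abbrev stdComponent (s : ℤ) : MvPolynomial σ K →ₗ[K] MvPolynomial σ K :=
  weightedHomogeneousComponent (fun _ : σ => (1 : ℤ)) s

lemma stdComponent_mem (s : ℤ) (p : MvPolynomial σ K) : stdComponent s p ∈ stdGrading σ K s :=
  weightedHomogeneousComponent_mem _ _ _

lemma stdComponent_mul {u : ℤ} {q : MvPolynomial σ K} (hq : q ∈ stdGrading σ K u) (t : ℤ)
    (p : MvPolynomial σ K) : stdComponent t (p * q) = stdComponent (t - u) p * q := by
  classical
  ext d
  rw [coeff_weightedHomogeneousComponent, coeff_mul, coeff_mul]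
  simp only [coeff_weightedHomogeneousComponent]
  by_cases hd : Finsupp.weight (fun _ : σ => (1 : ℤ)) d = t
  · rw [if_pos hd]
    refine Finset.sum_congr rfl fun x hx => ?_
    by_cases hy : coeff x.2 q = 0
    · simp [hy]
    · rw [if_pos]
      have := mem_stdGrading.mp hq _ hy
      rw [← mem_antidiagonal.mp hx, map_add] at hd
      omega
  · rw [if_neg hd]
    refine (Finset.sum_eq_zero fun x hx => ?_).symm
    by_cases hy : coeff x.2 q = 0
    · simp [hy]
    · rw [if_neg, zero_mul]
      intro h
      have := mem_stdGrading.mp hq _ hy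
      rw [← mem_antidiagonal.mp hx, map_add] at hd
      omega

lemma weight_one_eq_zero {a : σ →₀ ℕ} (h : Finsupp.weight (fun _ : σ => (1 : ℤ)) a = 0) :
    a = 0 := by
  rw [Finsupp.weight_apply, Finsupp.sum] at h
  have h2 := (Finset.sum_eq_zero_iff_of_nonneg (fun v _ => by simp)).mp h
  ext v
  by_contra hv
  exact hv (by simpa using h2 v (Finsupp.mem_support_iff.mpr hv))

lemma eq_C_of_mem_stdGrading_zero {p : MvPolynomial σ K} (hp : p ∈ stdGrading σ K 0) :
    p = C (constantCoeff p) := by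
  classical
  ext a
  rw [coeff_C]
  split_ifs with h
  · subst h; rfl
  · by_contra hne
    exact h (weight_one_eq_zero (mem_stdGrading.mp hp a hne)).symm

lemma constantCoeff_eq_zero_of_mem_stdGrading {s : ℤ} (hs : s ≠ 0) {p : MvPolynomial σ K}
    (hp : p ∈ stdGrading σ K s) : constantCoeff p = 0 := by
  by_contra hne
  exact hs (by simpa using (mem_stdGrading.mp hp 0 hne).symm)

/-- The homogeneous component of degree `s` of an element of a graded free module. -/
noncomputable def freeComponent (deg : Fin n → ℤ) (s : ℤ) (f : Fin n → MvPolynomial σ K) :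
    Fin n → MvPolynomial σ K :=
  fun a => stdComponent (s - deg a) (f a)

lemma freeComponent_mem (deg : Fin n → ℤ) (s : ℤ) (f : Fin n → MvPolynomial σ K) :
    freeComponent deg s f ∈ freeGrading K σ deg s :=
  mem_freeGrading.mpr fun _ => stdComponent_mem _ _

lemma freeComponent_of_mem {deg : Fin n → ℤ} {s : ℤ} {f : Fin n → MvPolynomial σ K}
    (hf : f ∈ freeGrading K σ deg s) : freeComponent deg s f = f :=
  funext fun a => weightedHomogeneousComponent_eq_self (mem_freeGrading.mp hf a)

lemma exists_sum_freeComponent (deg : Fin n → ℤ) (f : Fin n → MvPolynomial σ K) :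
    ∃ J : Finset ℤ, f = ∑ s ∈ J, freeComponent deg s f := by
  classical
  refine ⟨Finset.univ.biUnion fun a => (f a).support.image
    fun d => Finsupp.weight (fun _ : σ => (1 : ℤ)) d + deg a, ?_⟩
  funext a
  ext d
  rw [Finset.sum_apply, coeff_sum]
  simp only [freeComponent, coeff_weightedHomogeneousComponent]
  by_cases hd : coeff d (f a) = 0
  · simp [hd]
  · rw [Finset.sum_eq_single (Finsupp.weight (fun _ : σ => (1 : ℤ)) d + deg a)]
    · rw [if_pos (by omega)]
    · intro s _ hs
      rw [if_neg]
      intro h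
      exact hs (by omega)
    · intro h
      refine absurd ?_ h
      simp only [mem_biUnion, Finset.mem_univ, true_and, mem_image, mem_support_iff]
      exact ⟨a, d, hd, rfl⟩

/-- A homomorphism of graded free modules commutes with taking homogeneous components. -/
lemma map_freeComponent {deg : Fin n → ℤ} {deg' : Fin m → ℤ}
    {φ : (Fin m → MvPolynomial σ K) →ₗ[MvPolynomial σ K] (Fin n → MvPolynomial σ K)}
    (hφ : ∀ b, φ (Pi.single b 1) ∈ freeGrading K σ deg (deg' b)) (s : ℤ)
    (e : Fin m → MvPolynomial σ K) :
    φ (freeComponent deg' s e) = freeComponent deg s (φ e) := by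
  funext a
  have key : ∀ e', φ e' a = ∑ b, e' b * φ (Pi.single b 1) a := by
    intro e'
    conv_lhs => rw [pi_eq_sum_univ' e', map_sum]
    simp
  rw [key, freeComponent, key, map_sum]
  refine Finset.sum_congr rfl fun b _ => ?_
  rw [stdComponent_mul (mem_freeGrading.mp (hφ b) a), freeComponent, sub_sub_sub_cancel_right]

lemma map_mem_freeGrading {deg : Fin n → ℤ} {deg' : Fin m → ℤ}
    {φ : (Fin m → MvPolynomial σ K) →ₗ[MvPolynomial σ K] (Fin n → MvPolynomial σ K)}
    (hφ : ∀ b, φ (Pi.single b 1) ∈ freeGrading K σ deg (deg' b)) {s : ℤ}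
    {e : Fin m → MvPolynomial σ K} (he : e ∈ freeGrading K σ deg' s) :
    φ e ∈ freeGrading K σ deg s := by
  rw [← freeComponent_of_mem he, map_freeComponent hφ]
  exact freeComponent_mem _ _ _

lemma single_mem_freeGrading (deg : Fin n → ℤ) (b : Fin n) :
    (Pi.single b 1 : Fin n → MvPolynomial σ K) ∈ freeGrading K σ deg (deg b) := by
  rw [mem_freeGrading]
  intro a
  by_cases h : a = b
  · subst h
    rw [Pi.single_eq_same, sub_self]
    exact isWeightedHomogeneous_one K _
  · rw [Pi.single_eq_of_ne h]
    exact zero_mem _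

end FreeModules

/-! ### Betti numbers as Koszul homology -/

section DimensionShift

variable {σ K : Type*} [Field K] [Fintype σ] [DecidableEq σ] {n : ℕ} {deg : Fin n → ℤ}
variable {A C : Type*} [AddCommGroup A] [Module (MvPolynomial σ K) A]
  [AddCommGroup C] [Module (MvPolynomial σ K) C]
  {𝒜 : ℤ → AddSubgroup A} {𝒞 : ℤ → AddSubgroup C}
  {f : A →ₗ[MvPolynomial σ K] (Fin n → MvPolynomial σ K)}
  {g : (Fin n → MvPolynomial σ K) →ₗ[MvPolynomial σ K] C} {ρ : σ ↪ ℕ} {i : ℕ} {s : ℤ}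

/-- Dimension shifting along a minimal presentation `0 → A → F → C → 0` with `F` free. -/
lemma GradedShortExact.koszulVanishes_succ_iff
    (h : GradedShortExact 𝒜 (freeGrading K σ deg) 𝒞 f g)
    (hmin : ∀ a b, constantCoeff (f a b) = 0) :
    KoszulVanishes K ρ 𝒞 (i + 1) s ↔ KoszulVanishes K ρ 𝒜 i (s + 1) := by
  constructor
  · refine h.vanishes_left (isGradedFamily_freeGrading deg) fun a ha hda => ?_
    obtain ⟨b, hb, hdb⟩ := exists_koszulD_eq_of_freeGrading ρ (h.chain_map_left ha)
      (by rw [← map_koszulD, hda]; funext S; simp) (fun b => hmin _ b)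
    rw [add_sub_cancel_right] at hb
    exact ⟨b, hb, hdb⟩
  · refine fun hA => h.vanishes_right (isGradedFamily_freeGrading deg) hA fun c hc hdc => ?_
    refine exists_koszulD_eq_of_freeGrading ρ hc hdc fun a => ?_
    rw [(hc ∅).2 (by simp)]
    simp

/-- The Koszul homology of `C` in homological degree `0` counts the generators of `F` if
`0 → A → F → C → 0` is a minimal presentation. -/
lemma GradedShortExact.koszulVanishes_zero_iff
    (h : GradedShortExact 𝒜 (freeGrading K σ deg) 𝒞 f g)
    (hmin : ∀ a b, constantCoeff (f a b) = 0) :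
    KoszulVanishes K ρ 𝒞 0 s ↔ ∀ b, deg b ≠ s := by
  constructor
  · rintro hC b rfl
    have hb := single_mem_freeGrading (σ := σ) (K := K) deg b
    obtain ⟨c, hc, hdc⟩ := hC (fun S => if S = ∅ then g (Pi.single b 1) else 0)
      (fun S => ⟨by
        dsimp only
        split_ifs
        exacts [h.map_right _ _ hb, zero_mem _], fun hS => if_neg (by
          rintro rfl
          exact hS rfl)⟩)
      (by
        funext T
        rw [koszulD_apply]
        exact Finset.sum_eq_zero fun v _ => by simp)
    obtain ⟨e, he, rfl⟩ := h.chain_exists_right hc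
    have h1 := congrFun hdc ∅
    rw [← map_koszulD] at h1
    simp only [if_true] at h1
    have hde := koszulD_mem_koszulChains (K := K) ρ (isGradedFamily_freeGrading deg) he
    rw [sub_add_cancel] at hde
    obtain ⟨a, _, ha⟩ := h.exists_left _ _ (sub_mem (hde ∅).1 hb) (by rw [map_sub, h1, sub_self])
    have h2 := hmin a b
    rw [ha, Pi.sub_apply, map_sub, Pi.single_eq_same, map_one, koszulD_apply, Finset.sum_apply,
      map_sum, Finset.sum_eq_zero (fun v _ => by simp [koszulCoeff])] at h2
    simp at h2
  · refine fun hdeg => h.vanishes_right_zero fun c hc hdc => ?_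
    exact exists_koszulD_eq_of_freeGrading ρ hc hdc fun a =>
      constantCoeff_eq_zero_of_mem_stdGrading (sub_ne_zero.mpr (hdeg a).symm)
        (mem_freeGrading.mp (hc ∅).1 a)

end DimensionShift

namespace MinimalGradedFreeResolution

variable {σ K : Type*} [Field K]
  {M : Type*} [AddCommGroup M] [Module (MvPolynomial σ K) M] [Module K M]
  {ℳ : ℤ → Submodule K M} (F : MinimalGradedFreeResolution (σ := σ) ℳ)

lemma d_single_mem (i : ℕ) (b : Fin (F.rank (i + 1))) :
    F.d i (Pi.single b 1) ∈ freeGrading K σ (F.deg i) (F.deg (i + 1) b) :=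
  mem_freeGrading.mpr fun a => F.d_homogeneous i b a

lemma constantCoeff_d (i : ℕ) (e : Fin (F.rank (i + 1)) → MvPolynomial σ K) (a : Fin (F.rank i)) :
    constantCoeff (F.d i e a) = 0 := by
  rw [pi_eq_sum_univ' e, map_sum, Finset.sum_apply, map_sum]
  refine Finset.sum_eq_zero fun b _ => ?_
  rw [map_smul, Pi.smul_apply, smul_eq_mul, map_mul,
    constantCoeff_eq_zero_of_mem_span_X (F.minimal i b a), mul_zero]

/-- The cokernel of the differential `F_{p + 1} → F_p`. -/
abbrev Coker (p : ℕ) : Type _ :=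
  (Fin (F.rank p) → MvPolynomial σ K) ⧸ LinearMap.range (F.d p)

/-- The grading of the cokernel of a differential. -/
noncomputable def cokerGrading (p : ℕ) (s : ℤ) : AddSubgroup (F.Coker p) :=
  (freeGrading K σ (F.deg p) s).map (LinearMap.range (F.d p)).mkQ.toAddMonoidHom

/-- The embedding of the cokernel of `F_{p + 2} → F_{p + 1}` into `F_p`. -/
noncomputable def cokerMap (p : ℕ) :
    F.Coker (p + 1) →ₗ[MvPolynomial σ K] (Fin (F.rank p) → MvPolynomial σ K) :=
  (LinearMap.range (F.d (p + 1))).liftQ (F.d p)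
    (by rw [LinearMap.range_le_ker_iff]; exact (F.exact_d p).linearMap_comp_eq_zero)

lemma constantCoeff_cokerMap (p : ℕ) (a : F.Coker (p + 1)) (b : Fin (F.rank p)) :
    constantCoeff (F.cokerMap p a b) = 0 := by
  obtain ⟨e, rfl⟩ := Submodule.mkQ_surjective _ a
  exact F.constantCoeff_d p e b

/-- The short exact sequence that cuts off a resolution after its `p`-th term. -/
lemma gradedShortExact_of_exact {p : ℕ} {C : Type*} [AddCommGroup C] [Module (MvPolynomial σ K) C]
    {𝒞 : ℤ → AddSubgroup C} {g : (Fin (F.rank p) → MvPolynomial σ K) →ₗ[MvPolynomial σ K] C}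
    (hg : Function.Exact (F.d p) g)
    (hmap : ∀ s, ∀ b ∈ freeGrading K σ (F.deg p) s, g b ∈ 𝒞 s)
    (hlift : ∀ s, ∀ c ∈ 𝒞 s, ∃ b ∈ freeGrading K σ (F.deg p) s, g b = c) :
    GradedShortExact (F.cokerGrading (p + 1)) (freeGrading K σ (F.deg p)) 𝒞 (F.cokerMap p) g where
  injective := by
    rw [← LinearMap.ker_eq_bot, cokerMap, Submodule.ker_liftQ_eq_bot _ _ _ ?_]
    intro e he
    exact (F.exact_d p e).mp he
  comp_eq_zero a := by
    obtain ⟨e, rfl⟩ := Submodule.mkQ_surjective _ a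
    exact (hg _).mpr ⟨e, rfl⟩
  map_left := by
    rintro s _ ⟨e, he, rfl⟩
    exact map_mem_freeGrading (F.d_single_mem p) he
  map_right := hmap
  exists_left := by
    intro s b hb h0
    obtain ⟨e, he⟩ := (hg b).mp h0
    refine ⟨_, ⟨freeComponent (F.deg (p + 1)) s e, freeComponent_mem _ _ _, rfl⟩, ?_⟩
    refine (map_freeComponent (F.d_single_mem p) s e).trans ?_
    rw [he, freeComponent_of_mem hb]
  exists_right := hlift

lemma gradedShortExact_coker (p : ℕ) :
    GradedShortExact (F.cokerGrading (p + 1)) (freeGrading K σ (F.deg p)) (F.cokerGrading p)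
      (F.cokerMap p) (LinearMap.range (F.d p)).mkQ :=
  F.gradedShortExact_of_exact (LinearMap.exact_map_mkQ_range _) (fun _ b hb => ⟨b, hb, rfl⟩)
    (by rintro s _ ⟨b, hb, rfl⟩; exact ⟨b, hb, rfl⟩)

variable [Fintype σ] [DecidableEq σ]

lemma koszulVanishes_coker_iff (ρ : σ ↪ ℕ) (i : ℕ) : ∀ (p : ℕ) (s : ℤ) (q : ℕ), q = p + i →
    (KoszulVanishes K ρ (F.cokerGrading p) i s ↔ ∀ b, F.deg q b ≠ s + i) := by
  induction i with
  | zero =>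
    intro p s q hq
    obtain rfl : q = p := hq
    simpa using (F.gradedShortExact_coker q).koszulVanishes_zero_iff (F.constantCoeff_cokerMap q)
  | succ i ih =>
    intro p s q hq
    rw [(F.gradedShortExact_coker p).koszulVanishes_succ_iff (F.constantCoeff_cokerMap p),
      ih (p + 1) (s + 1) q (by omega)]
    push_cast
    simp only [add_assoc, add_comm (1 : ℤ)]

/-- The degrees of the generators in a minimal resolution are those in which the Koszul homology
does not vanish. -/
theorem koszulVanishes_iff (ρ : σ ↪ ℕ)
    (hmap : ∀ s, ∀ b ∈ freeGrading K σ (F.deg 0) s, F.aug b ∈ ℳ s)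
    (hlift : ∀ s, ∀ c ∈ ℳ s, ∃ b ∈ freeGrading K σ (F.deg 0) s, F.aug b = c) (i : ℕ) (s : ℤ) :
    KoszulVanishes K ρ (fun s => (ℳ s).toAddSubgroup) i s ↔ ∀ b, F.deg i b ≠ s + i := by
  have h := F.gradedShortExact_of_exact (𝒞 := fun s => (ℳ s).toAddSubgroup) F.exact_aug hmap hlift
  cases i with
  | zero => simpa using h.koszulVanishes_zero_iff (F.constantCoeff_cokerMap 0)
  | succ i =>
    rw [h.koszulVanishes_succ_iff (F.constantCoeff_cokerMap 0),
      F.koszulVanishes_coker_iff ρ i 1 (s + 1) (i + 1) (by omega)]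
    push_cast
    simp only [add_assoc, add_comm (1 : ℤ)]

end MinimalGradedFreeResolution

/-! ### Existence of minimal graded free resolutions -/

section Existence

variable {σ K : Type*} [Field K] {n : ℕ}

/-- A graded submodule of a graded free module. -/
def IsGradedSubmodule (deg : Fin n → ℤ)
    (N : Submodule (MvPolynomial σ K) (Fin n → MvPolynomial σ K)) : Prop :=
  ∀ f ∈ N, ∀ s, freeComponent deg s f ∈ N

lemma isGradedSubmodule_ker {m : ℕ} {deg : Fin n → ℤ} {deg' : Fin m → ℤ}
    {φ : (Fin m → MvPolynomial σ K) →ₗ[MvPolynomial σ K] (Fin n → MvPolynomial σ K)}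
    (hφ : ∀ b, φ (Pi.single b 1) ∈ freeGrading K σ deg (deg' b)) :
    IsGradedSubmodule deg' (LinearMap.ker φ) := by
  intro f hf s
  rw [LinearMap.mem_ker] at hf ⊢
  rw [map_freeComponent hφ, hf]
  funext a
  simp [freeComponent]

lemma exists_homogeneous_generators [Finite σ] {deg : Fin n → ℤ}
    {N : Submodule (MvPolynomial σ K) (Fin n → MvPolynomial σ K)}
    (hN : IsGradedSubmodule deg N) :
    ∃ (m : ℕ) (g : Fin m → Fin n → MvPolynomial σ K),
      (∀ b, ∃ t, g b ∈ freeGrading K σ deg t) ∧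
      Submodule.span (MvPolynomial σ K) (Set.range g) = N := by
  have hfg : N.FG := IsNoetherian.noetherian N
  have hspan : Submodule.span (MvPolynomial σ K)
      {f | f ∈ N ∧ ∃ t, f ∈ freeGrading K σ deg t} = N := by
    refine le_antisymm (Submodule.span_le.mpr fun f hf => hf.1) fun f hf => ?_
    obtain ⟨J, hJ⟩ := exists_sum_freeComponent deg f
    rw [hJ]
    exact sum_mem fun s _ => Submodule.subset_span ⟨hN f hf s, s, freeComponent_mem _ _ _⟩
  rw [← hspan] at hfg
  obtain ⟨G, hG, hGspan⟩ := (Submodule.fg_span_iff_fg_span_finset_subset _).mp hfg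
  refine ⟨G.card, fun b => (G.equivFin.symm b : Fin n → MvPolynomial σ K),
    fun b => (hG (G.equivFin.symm b).2).2, ?_⟩
  rw [← hspan, hGspan]
  congr 1
  ext f
  constructor
  · rintro ⟨b, rfl⟩
    exact (G.equivFin.symm b).2
  · intro hf
    exact ⟨G.equivFin ⟨f, hf⟩, by simp⟩

/-- A graded submodule of a graded free module is the image of a graded free module under a
homogeneous map whose kernel has entries without constant terms. -/
lemma exists_minimal_cover [Finite σ] {deg : Fin n → ℤ}
    {N : Submodule (MvPolynomial σ K) (Fin n → MvPolynomial σ K)}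
    (hN : IsGradedSubmodule deg N) :
    ∃ (m : ℕ) (deg' : Fin m → ℤ)
      (φ : (Fin m → MvPolynomial σ K) →ₗ[MvPolynomial σ K] (Fin n → MvPolynomial σ K)),
      (∀ b, φ (Pi.single b 1) ∈ freeGrading K σ deg (deg' b)) ∧ LinearMap.range φ = N ∧
      ∀ e, φ e = 0 → ∀ b, constantCoeff (e b) = 0 := by
  classical
  have hex := exists_homogeneous_generators hN
  obtain ⟨g, hg, hspan⟩ := Nat.find_spec hex
  have hmin := fun k => Nat.find_min (m := k) hex
  generalize Nat.find hex = m at g hmin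
  choose deg' hdeg' using hg
  have hφ : ∀ b, Fintype.linearCombination (MvPolynomial σ K) g (Pi.single b 1) ∈
      freeGrading K σ deg (deg' b) := fun b => by
    rw [Fintype.linearCombination_apply_single, one_smul]
    exact hdeg' b
  refine ⟨m, deg', Fintype.linearCombination (MvPolynomial σ K) g, hφ, ?_, ?_⟩
  · rw [Fintype.range_linearCombination, hspan]
  · intro e he b
    by_contra hne
    -- The relation in the degree of `g b` has a unit as its coefficient at `g b`, so that `g b`
    -- is redundant.
    have he' := isGradedSubmodule_ker hφ e he (deg' b)
    set e' := freeComponent deg' (deg' b) e with he'_def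
    have hb : e' b = C (constantCoeff (e b)) := by
      have h0 : e' b ∈ stdGrading σ K 0 := by
        simpa using mem_freeGrading.mp (freeComponent_mem deg' (deg' b) e) b
      rw [eq_C_of_mem_stdGrading_zero h0]
      congr 1
      rw [constantCoeff_eq, he'_def, freeComponent,
        coeff_weightedHomogeneousComponent]
      simp
    obtain ⟨k, rfl⟩ : ∃ k, m = k + 1 := ⟨m - 1, by have := b.pos; omega⟩
    refine hmin k (Nat.lt_succ_self k) ⟨fun a => g (b.succAbove a), fun a => ⟨_, hdeg' _⟩, ?_⟩
    rw [← hspan]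
    refine le_antisymm (Submodule.span_mono (by rintro _ ⟨a, rfl⟩; exact ⟨_, rfl⟩)) ?_
    rw [Submodule.span_le]
    rintro _ ⟨a, rfl⟩
    rcases Fin.eq_self_or_eq_succAbove b a with rfl | ⟨a, rfl⟩
    · rw [LinearMap.mem_ker, Fintype.linearCombination_apply, Fin.sum_univ_succAbove _ a, hb] at he'
      have hu : g a = (C (-(constantCoeff (e a))⁻¹) : MvPolynomial σ K) •
          ∑ i, e' (a.succAbove i) • g (a.succAbove i) := by
        rw [eq_neg_of_add_eq_zero_right he', smul_neg, smul_smul, ← C_mul, neg_mul,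
          inv_mul_cancel₀ hne]
        simp
      rw [hu]
      exact Submodule.smul_mem _ _ (sum_mem fun i _ =>
        Submodule.smul_mem _ _ (Submodule.subset_span ⟨i, rfl⟩))
    · exact Submodule.subset_span ⟨a, rfl⟩

/-- The data needed to continue a minimal resolution: a graded free module with the submodule of
relations that remains to be covered. -/
structure ResolutionStage (σ K : Type*) [Field K] where
  rank : ℕ
  deg : Fin rank → ℤ
  relations : Submodule (MvPolynomial σ K) (Fin rank → MvPolynomial σ K)
  graded : IsGradedSubmodule deg relations
  minimal : ∀ e ∈ relations, ∀ b, constantCoeff (e b) = 0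

namespace ResolutionStage

variable [Finite σ] (S : ResolutionStage σ K)

/-- The next term of the resolution. -/
noncomputable def next : ResolutionStage σ K where
  rank := (exists_minimal_cover S.graded).choose
  deg := (exists_minimal_cover S.graded).choose_spec.choose
  relations := LinearMap.ker (exists_minimal_cover S.graded).choose_spec.choose_spec.choose
  graded := isGradedSubmodule_ker
    (exists_minimal_cover S.graded).choose_spec.choose_spec.choose_spec.1
  minimal := (exists_minimal_cover S.graded).choose_spec.choose_spec.choose_spec.2.2

/-- The differential from the next term of the resolution. -/
noncomputable def map : (Fin S.next.rank → MvPolynomial σ K) →ₗ[MvPolynomial σ K]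
    (Fin S.rank → MvPolynomial σ K) :=
  (exists_minimal_cover S.graded).choose_spec.choose_spec.choose

lemma map_single_mem (b : Fin S.next.rank) :
    S.map (Pi.single b 1) ∈ freeGrading K σ S.deg (S.next.deg b) :=
  (exists_minimal_cover S.graded).choose_spec.choose_spec.choose_spec.1 b

lemma range_map : LinearMap.range S.map = S.relations :=
  (exists_minimal_cover S.graded).choose_spec.choose_spec.choose_spec.2.1

end ResolutionStage

/-- The projection of the free module of rank one to a quotient ring. -/
noncomputable def idealAug (I : Ideal (MvPolynomial σ K)) :
    (Fin 1 → MvPolynomial σ K) →ₗ[MvPolynomial σ K] (MvPolynomial σ K ⧸ I) :=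
  (Submodule.mkQ I).comp (LinearMap.proj (0 : Fin 1))

lemma mem_ker_idealAug {I : Ideal (MvPolynomial σ K)} {f : Fin 1 → MvPolynomial σ K} :
    f ∈ LinearMap.ker (idealAug I) ↔ f 0 ∈ I := by
  rw [LinearMap.mem_ker, idealAug, LinearMap.comp_apply, Submodule.mkQ_apply,
    Submodule.Quotient.mk_eq_zero]
  rfl

/-- A proper homogeneous ideal, as the relations of the resolution of the quotient ring. -/
noncomputable def ResolutionStage.ofIdeal (I : Ideal (MvPolynomial σ K))
    (hI : ∀ f ∈ I, ∀ s, stdComponent s f ∈ I) (hproper : ∀ f ∈ I, constantCoeff f = 0) :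
    ResolutionStage σ K where
  rank := 1
  deg := 0
  relations := LinearMap.ker (idealAug I)
  graded := fun f hf s => by
    have := hI _ (mem_ker_idealAug.mp hf) s
    rw [mem_ker_idealAug]
    simpa [freeComponent] using this
  minimal := fun e he b => by
    rw [Subsingleton.elim b 0]
    exact hproper _ (mem_ker_idealAug.mp he)

lemma nonempty_minimalGradedFreeResolution [Finite σ] {I : Ideal (MvPolynomial σ K)}
    (hI : ∀ f ∈ I, ∀ s, stdComponent s f ∈ I) (hproper : ∀ f ∈ I, constantCoeff f = 0) :
    Nonempty (MinimalGradedFreeResolution (σ := σ) (quotientGrading I)) := by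
  let S : ℕ → ResolutionStage σ K :=
    fun i => Nat.rec (ResolutionStage.ofIdeal I hI hproper) (fun _ T => T.next) i
  have hexact : ∀ i, Function.Exact (S (i + 1)).map (S i).map := fun i =>
    LinearMap.exact_iff.mpr (by rw [ResolutionStage.range_map]; rfl)
  refine ⟨{
    rank := fun i => (S i).rank
    deg := fun i => (S i).deg
    d := fun i => (S i).map
    aug := idealAug I
    aug_homogeneous := ?_
    d_homogeneous := fun i b a => mem_freeGrading.mp ((S i).map_single_mem b) a
    aug_surjective := ?_
    exact_aug := ?_
    exact_d := hexact
    minimal := fun i b a => mem_span_X_of_constantCoeff_eq_zero ((S i).minimal _ ?_ a) }⟩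
  · intro b
    obtain rfl : b = (0 : Fin 1) := Subsingleton.elim (α := Fin 1) _ _
    exact ⟨1, isWeightedHomogeneous_one K _, by simp; rfl⟩
  · exact (Submodule.mkQ_surjective I).comp fun f => ⟨fun _ => f, rfl⟩
  · refine LinearMap.exact_iff.mpr ?_
    rw [ResolutionStage.range_map]
    rfl
  · rw [← (S i).range_map]
    exact ⟨_, rfl⟩

end Existence

/-! ### Regularity of quotient rings -/

section Quotient

variable {σ K : Type*} [Field K]

/-- The grading of a quotient ring, as a family of additive subgroups. -/
noncomputable def quotGrading (I : Ideal (MvPolynomial σ K)) (s : ℤ) :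
    AddSubgroup (MvPolynomial σ K ⧸ I) :=
  (quotientGrading I s).toAddSubgroup

lemma mem_quotGrading {I : Ideal (MvPolynomial σ K)} {s : ℤ} {m : MvPolynomial σ K ⧸ I} :
    m ∈ quotGrading I s ↔ ∃ f ∈ stdGrading σ K s, Submodule.mkQ I f = m :=
  Iff.rfl

lemma isGradedFamily_quotGrading (I : Ideal (MvPolynomial σ K)) :
    IsGradedFamily σ K (quotGrading I) := by
  intro v s m hm
  obtain ⟨f, hf, rfl⟩ := mem_quotGrading.mp hm
  exact mem_quotGrading.mpr ⟨X v • f, isGradedFamily_stdGrading v s f hf, map_smul _ _ _⟩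

/-- The degrees of the generators in a minimal resolution of a quotient ring are those in which the
Koszul homology does not vanish. -/
theorem gradedBetti_ne_zero_iff [Fintype σ] [DecidableEq σ] (ρ : σ ↪ ℕ)
    {I : Ideal (MvPolynomial σ K)} (hI : ∀ f ∈ I, ∀ s, stdComponent s f ∈ I)
    (hproper : ∀ f ∈ I, constantCoeff f = 0) (i : ℕ) (j : ℤ) :
    gradedBetti (σ := σ) (quotientGrading I) i j ≠ 0 ↔
      ¬ KoszulVanishes K ρ (quotGrading I) i (j - i) := by
  have hne := nonempty_minimalGradedFreeResolution hI hproper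
  rw [gradedBetti, dif_pos hne]
  generalize hne.some = F
  choose h hh hhF using fun b => mem_quotGrading.mp (F.aug_homogeneous b)
  have haug : ∀ f, F.aug f = Submodule.mkQ I (∑ b, f b * h b) := by
    intro f
    conv_lhs => rw [pi_eq_sum_univ' f]
    rw [map_sum, map_sum]
    refine Finset.sum_congr rfl fun b _ => ?_
    rw [map_smul, ← hhF b, ← smul_eq_mul, map_smul]
  have := F.koszulVanishes_iff ρ ?_ ?_ i (j - i)
  · rw [show quotGrading I = fun s => (quotientGrading I s).toAddSubgroup from rfl, this]
    simp [Nat.card_eq_fintype_card, Fintype.card_eq_zero_iff, isEmpty_subtype]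
  · intro s f hf
    refine mem_quotGrading.mpr ⟨_, sum_mem fun b _ => ?_, (haug f).symm⟩
    have := IsWeightedHomogeneous.mul (mem_freeGrading.mp hf b) (hh b)
    rwa [sub_add_cancel] at this
  · intro s c hc
    obtain ⟨f, hf, rfl⟩ := mem_quotGrading.mp hc
    obtain ⟨e, he⟩ := F.aug_surjective (Submodule.mkQ I f)
    refine ⟨freeComponent (F.deg 0) s e, freeComponent_mem _ _ _, ?_⟩
    rw [haug] at he ⊢
    rw [Submodule.mkQ_apply, Submodule.mkQ_apply, Submodule.Quotient.eq] at he ⊢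
    have h2 := hI _ he s
    rw [map_sub, map_sum, (weightedHomogeneousComponent_eq_self hf :)] at h2
    convert h2 using 3 with b
    exact (stdComponent_mul (hh b) s (e b)).symm

/-- The Koszul homology of `R / I` vanishes in the degrees that show `reg (R / I) > r`. Thus this
says that `reg (R / I) ≤ r`. -/
def RegularityLE [Fintype σ] [DecidableEq σ] (ρ : σ ↪ ℕ) (I : Ideal (MvPolynomial σ K)) (r : ℤ) :
    Prop :=
  ∀ i s, r < s → KoszulVanishes K ρ (quotGrading I) i s

theorem hasRegularity_of_koszul [Fintype σ] [DecidableEq σ] (ρ : σ ↪ ℕ)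
    {I : Ideal (MvPolynomial σ K)} (hI : ∀ f ∈ I, ∀ s, stdComponent s f ∈ I)
    (hproper : ∀ f ∈ I, constantCoeff f = 0) {r : ℤ} (hle : RegularityLE ρ I r) {i : ℕ}
    (hi : ¬ KoszulVanishes K ρ (quotGrading I) i r) :
    HasRegularity σ (quotientGrading I) r := by
  constructor
  · refine ⟨i, r + i, ?_, by ring⟩
    rw [gradedBetti_ne_zero_iff ρ hI hproper]
    simpa using hi
  · rintro s ⟨k, j, hkj, rfl⟩
    rw [gradedBetti_ne_zero_iff ρ hI hproper] at hkj
    by_contra! hlt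
    exact hkj (hle _ _ hlt)

end Quotient

/-! ### Square-free monomial ideals -/

section FaceIdeal

variable {σ K : Type*} [Field K]

/-- The ideal generated by the square-free monomials whose support does not belong to `Φ`. -/
noncomputable def faceIdeal (K : Type*) [Field K] (Φ : Set (Finset σ)) :
    Ideal (MvPolynomial σ K) :=
  Ideal.span {p | ∃ F : Finset σ, F ∉ Φ ∧ p = ∏ v ∈ F, X v}

lemma mkQ_ideal_eq_zero {I : Ideal (MvPolynomial σ K)} {f : MvPolynomial σ K} :
    Submodule.mkQ I f = 0 ↔ f ∈ I :=
  Submodule.Quotient.mk_eq_zero _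

/-- The exponent of a square-free monomial. -/
noncomputable def sqfreeExp (F : Finset σ) : σ →₀ ℕ :=
  ∑ v ∈ F, Finsupp.single v 1

lemma sqfreeExp_apply [DecidableEq σ] (F : Finset σ) (v : σ) :
    sqfreeExp F v = if v ∈ F then 1 else 0 := by
  simp [sqfreeExp, Finsupp.finsetSum_apply, Finsupp.single_apply]

lemma support_sqfreeExp (F : Finset σ) : (sqfreeExp F).support = F := by
  classical
  ext v
  simp [sqfreeExp_apply]

lemma weight_sqfreeExp (F : Finset σ) :
    Finsupp.weight (fun _ : σ => (1 : ℤ)) (sqfreeExp F) = F.card := by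
  simp [sqfreeExp, Finsupp.weight_single]

lemma sqfreeExp_le_iff {F : Finset σ} {a : σ →₀ ℕ} : sqfreeExp F ≤ a ↔ F ⊆ a.support := by
  classical
  constructor
  · intro h v hv
    have := h v
    rw [sqfreeExp_apply, if_pos hv] at this
    exact Finsupp.mem_support_iff.mpr (by omega)
  · intro h v
    rw [sqfreeExp_apply]
    split_ifs with hv
    · exact Nat.one_le_iff_ne_zero.mpr (Finsupp.mem_support_iff.mp (h hv))
    · exact Nat.zero_le _

lemma prod_X_eq_monomial (F : Finset σ) :
    (∏ v ∈ F, X v : MvPolynomial σ K) = monomial (sqfreeExp F) 1 := by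
  rw [sqfreeExp, monomial_sum_one]
  rfl

lemma mem_faceIdeal {Φ : Set (Finset σ)} (hΦ : IsLowerSet Φ) {f : MvPolynomial σ K} :
    f ∈ faceIdeal K Φ ↔ ∀ a, coeff a f ≠ 0 → a.support ∉ Φ := by
  have : {p : MvPolynomial σ K | ∃ F : Finset σ, F ∉ Φ ∧ p = ∏ v ∈ F, X v} =
      (fun a => monomial a (1 : K)) '' (sqfreeExp '' Φᶜ) := by
    ext p
    simp only [prod_X_eq_monomial, Set.mem_image, Set.mem_ofPred_eq]
    constructor
    · rintro ⟨F, hF, rfl⟩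
      exact ⟨_, ⟨F, hF, rfl⟩, rfl⟩
    · rintro ⟨_, ⟨F, hF, rfl⟩, rfl⟩
      exact ⟨F, hF, rfl⟩
  rw [faceIdeal, this, mem_ideal_span_monomial_image]
  simp only [mem_support_iff]
  refine forall₂_congr fun a _ => ?_
  constructor
  · rintro ⟨_, ⟨F, hF, rfl⟩, hle⟩ ha
    exact hF (hΦ (sqfreeExp_le_iff.mp hle) ha)
  · intro ha
    exact ⟨_, ⟨_, ha, rfl⟩, sqfreeExp_le_iff.mpr le_rfl⟩

lemma stdComponent_mem_faceIdeal {Φ : Set (Finset σ)} (hΦ : IsLowerSet Φ) :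
    ∀ f ∈ faceIdeal K Φ, ∀ s, stdComponent s f ∈ faceIdeal K Φ := by
  intro f hf s
  rw [mem_faceIdeal hΦ] at hf ⊢
  intro a ha
  rw [coeff_weightedHomogeneousComponent] at ha
  split_ifs at ha with h
  exacts [hf a ha, absurd rfl ha]

lemma constantCoeff_of_mem_faceIdeal {Φ : Set (Finset σ)} (hΦ : IsLowerSet Φ) (h0 : ∅ ∈ Φ) :
    ∀ f ∈ faceIdeal K Φ, constantCoeff f = 0 := by
  intro f hf
  by_contra hne
  exact (mem_faceIdeal hΦ).mp hf 0 hne h0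

/-- The members of `Φ` that do not contain `E`. For a vertex `x` and `E = {x}` this is the
deletion of `x`. -/
def avoidFaces (Φ : Set (Finset σ)) (E : Finset σ) : Set (Finset σ) :=
  {F | F ∈ Φ ∧ ¬ E ⊆ F}

lemma isLowerSet_avoidFaces {Φ : Set (Finset σ)} (hΦ : IsLowerSet Φ) (E : Finset σ) :
    IsLowerSet (avoidFaces Φ E) :=
  fun _ _ hGF hF => ⟨hΦ hGF hF.1, fun h => hF.2 (h.trans hGF)⟩

lemma faceIdeal_le_avoidFaces {Φ : Set (Finset σ)} (hΦ : IsLowerSet Φ) (E : Finset σ) :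
    faceIdeal K Φ ≤ faceIdeal K (avoidFaces Φ E) := by
  intro f hf
  rw [mem_faceIdeal hΦ] at hf
  rw [mem_faceIdeal (isLowerSet_avoidFaces hΦ E)]
  exact fun a ha h => hf a ha h.1

/-- The projection that kills the monomial of `E`, on quotients by face ideals. -/
noncomputable def avoidMap (K : Type*) [Field K] {Φ : Set (Finset σ)} (hΦ : IsLowerSet Φ)
    (E : Finset σ) :
    (MvPolynomial σ K ⧸ faceIdeal K Φ) →ₗ[MvPolynomial σ K]
      (MvPolynomial σ K ⧸ faceIdeal K (avoidFaces Φ E)) :=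
  Submodule.mapQ _ _ LinearMap.id (faceIdeal_le_avoidFaces hΦ E)

lemma avoidMap_mkQ {Φ : Set (Finset σ)} (hΦ : IsLowerSet Φ) (E : Finset σ)
    (f : MvPolynomial σ K) :
    avoidMap K hΦ E (Submodule.mkQ _ f) = Submodule.mkQ _ f := rfl

variable [DecidableEq σ]

/-- The sets whose union with `E` belongs to `Φ`. For a simplicial complex and a face `E`, this is
the join of the link of `E` with the simplex on `E`; the corresponding ideal is the colon ideal by
the monomial of `E`. -/
def colonFaces (Φ : Set (Finset σ)) (E : Finset σ) : Set (Finset σ) :=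
  {F | F ∪ E ∈ Φ}

lemma isLowerSet_colonFaces {Φ : Set (Finset σ)} (hΦ : IsLowerSet Φ) (E : Finset σ) :
    IsLowerSet (colonFaces Φ E) :=
  fun _ _ hGF hF => hΦ (union_subset_union_left hGF) hF

lemma monomial_mul_mem_faceIdeal_iff {Φ : Set (Finset σ)} (hΦ : IsLowerSet Φ) (E : Finset σ)
    (f : MvPolynomial σ K) :
    monomial (sqfreeExp E) 1 * f ∈ faceIdeal K Φ ↔ f ∈ faceIdeal K (colonFaces Φ E) := by
  have hsupp : ∀ a : σ →₀ ℕ, (sqfreeExp E + a).support = a.support ∪ E := fun a => by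
    rw [Finsupp.support_add_eq_union, support_sqfreeExp, union_comm]
  rw [mem_faceIdeal hΦ, mem_faceIdeal (isLowerSet_colonFaces hΦ E)]
  constructor
  · intro h a ha
    have := h (sqfreeExp E + a) (by rwa [coeff_monomial_mul, one_mul])
    rwa [hsupp] at this
  · intro h a ha
    rw [coeff_monomial_mul'] at ha
    split_ifs at ha with hle
    · rw [one_mul] at ha
      obtain ⟨b, rfl⟩ := le_iff_exists_add.mp hle
      rw [add_tsub_cancel_left] at ha
      have := h b ha
      rwa [hsupp]
    · exact absurd rfl ha

/-- Multiplication by the monomial of `E`, on quotients by face ideals. -/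
noncomputable def colonMap (K : Type*) [Field K] {Φ : Set (Finset σ)} (hΦ : IsLowerSet Φ)
    (E : Finset σ) :
    (MvPolynomial σ K ⧸ faceIdeal K (colonFaces Φ E)) →ₗ[MvPolynomial σ K]
      (MvPolynomial σ K ⧸ faceIdeal K Φ) :=
  Submodule.mapQ _ _ (LinearMap.mulLeft (MvPolynomial σ K) (monomial (sqfreeExp E) 1))
    fun f hf => (monomial_mul_mem_faceIdeal_iff hΦ E f).mpr hf

lemma colonMap_mkQ {Φ : Set (Finset σ)} (hΦ : IsLowerSet Φ) (E : Finset σ)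
    (f : MvPolynomial σ K) :
    colonMap K hΦ E (Submodule.mkQ _ f) = Submodule.mkQ _ (monomial (sqfreeExp E) 1 * f) := rfl

lemma gradedShortExact_colon_avoid {Φ : Set (Finset σ)} (hΦ : IsLowerSet Φ) (E : Finset σ) :
    GradedShortExact (fun s => quotGrading (faceIdeal K (colonFaces Φ E)) (s - E.card))
      (quotGrading (faceIdeal K Φ)) (quotGrading (faceIdeal K (avoidFaces Φ E)))
      (colonMap K hΦ E) (avoidMap K hΦ E) where
  injective := by
    rw [← LinearMap.ker_eq_bot, LinearMap.ker_eq_bot']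
    intro m hm
    obtain ⟨f, rfl⟩ := Submodule.mkQ_surjective _ m
    rw [colonMap_mkQ, mkQ_ideal_eq_zero] at hm
    exact mkQ_ideal_eq_zero.mpr <| (monomial_mul_mem_faceIdeal_iff hΦ E f).mp hm
  comp_eq_zero m := by
    obtain ⟨f, rfl⟩ := Submodule.mkQ_surjective _ m
    rw [colonMap_mkQ, avoidMap_mkQ, mkQ_ideal_eq_zero, mem_faceIdeal (isLowerSet_avoidFaces hΦ E)]
    intro a ha hmem
    refine hmem.2 (sqfreeExp_le_iff.mp ?_)
    by_contra hle
    rw [coeff_monomial_mul', if_neg hle] at ha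
    exact ha rfl
  map_left := by
    intro s m hm
    obtain ⟨f, hf, rfl⟩ := mem_quotGrading.mp hm
    refine mem_quotGrading.mpr ⟨monomial (sqfreeExp E) 1 * f, ?_, rfl⟩
    have := (isWeightedHomogeneous_monomial (fun _ : σ => (1 : ℤ)) (sqfreeExp E) (1 : K)
      (weight_sqfreeExp E)).mul hf
    rwa [add_sub_cancel] at this
  map_right := by
    intro s m hm
    obtain ⟨f, hf, rfl⟩ := mem_quotGrading.mp hm
    exact mem_quotGrading.mpr ⟨f, hf, rfl⟩
  exists_left := by
    intro s m hm h0
    obtain ⟨f, hf, rfl⟩ := mem_quotGrading.mp hm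
    rw [avoidMap_mkQ, mkQ_ideal_eq_zero, mem_faceIdeal (isLowerSet_avoidFaces hΦ E)] at h0
    refine ⟨Submodule.mkQ _ (f.divMonomial (sqfreeExp E)), mem_quotGrading.mpr ⟨_, ?_, rfl⟩, ?_⟩
    · rw [mem_stdGrading]
      intro a ha
      rw [coeff_divMonomial] at ha
      have := mem_stdGrading.mp hf _ ha
      rw [map_add, weight_sqfreeExp] at this
      omega
    · rw [colonMap_mkQ, ← sub_eq_zero, ← map_sub, mkQ_ideal_eq_zero]
      have hdm := divMonomial_add_modMonomial f (sqfreeExp E)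
      rw [← neg_sub, neg_mem_iff, sub_eq_iff_eq_add'.mpr hdm.symm, mem_faceIdeal hΦ]
      intro a ha hmem
      by_cases hle : sqfreeExp E ≤ a
      · exact ha (coeff_modMonomial_of_le _ hle)
      · rw [coeff_modMonomial_of_not_le _ hle] at ha
        exact h0 a ha ⟨hmem, fun h => hle (sqfreeExp_le_iff.mpr h)⟩
  exists_right := by
    intro s m hm
    obtain ⟨f, hf, rfl⟩ := mem_quotGrading.mp hm
    exact ⟨Submodule.mkQ _ f, mem_quotGrading.mpr ⟨f, hf, rfl⟩, rfl⟩

end FaceIdeal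

/-! ### Bounds for the regularity of Stanley-Reisner rings -/

section RegularityBounds

variable {σ K : Type*} [Field K] [Fintype σ] [DecidableEq σ] {ρ : σ ↪ ℕ}

lemma koszulVanishes_shift {M : Type*} [AddCommGroup M] [Module (MvPolynomial σ K) M]
    {𝒢 : ℤ → AddSubgroup M} {d s : ℤ} {i : ℕ} (h : KoszulVanishes K ρ 𝒢 i (s - d)) :
    KoszulVanishes K ρ (fun s => 𝒢 (s - d)) i s := by
  intro c hc hdc
  obtain ⟨b, hb, hdb⟩ := h c hc hdc
  refine ⟨b, fun S => ?_, hdb⟩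
  have := hb S
  rwa [sub_right_comm] at this

lemma RegularityLE.mono {I : Ideal (MvPolynomial σ K)} {r r' : ℤ} (h : RegularityLE ρ I r)
    (hr : r ≤ r') : RegularityLE ρ I r' :=
  fun i s hs => h i s (hr.trans_lt hs)

/-- The regularity is bounded through the colon ideal by a monomial and the sum with it. -/
lemma regularityLE_of_colon_of_avoid {Φ : Set (Finset σ)} (hΦ : IsLowerSet Φ) (E : Finset σ)
    {r : ℤ} (hcolon : RegularityLE ρ (faceIdeal K (colonFaces Φ E)) (r - E.card))
    (havoid : RegularityLE ρ (faceIdeal K (avoidFaces Φ E)) r) :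
    RegularityLE ρ (faceIdeal K Φ) r :=
  fun i s hs => (gradedShortExact_colon_avoid hΦ E).vanishes_middle (isGradedFamily_quotGrading _)
    (koszulVanishes_shift (hcolon i _ (by omega))) (havoid i s hs)

/-- The regularity after adding a monomial to the ideal is bounded through the original ideal and
its colon ideal. -/
lemma regularityLE_avoid {Φ : Set (Finset σ)} (hΦ : IsLowerSet Φ) (E : Finset σ)
    {r : ℤ} (h : RegularityLE ρ (faceIdeal K Φ) r)
    (hcolon : RegularityLE ρ (faceIdeal K (colonFaces Φ E)) (r - E.card + 1)) :
    RegularityLE ρ (faceIdeal K (avoidFaces Φ E)) r := by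
  intro i s hs
  cases i with
  | zero => exact (gradedShortExact_colon_avoid hΦ E).vanishes_right_zero (h 0 s hs)
  | succ i =>
    exact (gradedShortExact_colon_avoid hΦ E).vanishes_right (isGradedFamily_quotGrading _)
      (koszulVanishes_shift (hcolon i _ (by omega))) (h (i + 1) s hs)

lemma regularityLE_empty (r : ℤ) : RegularityLE ρ (faceIdeal K (∅ : Set (Finset σ))) r := by
  intro i s _ c _ _
  have h1 : faceIdeal K (∅ : Set (Finset σ)) = ⊤ := by
    rw [Ideal.eq_top_iff_one]
    exact Ideal.subset_span ⟨∅, by simp, by simp⟩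
  have : Subsingleton (MvPolynomial σ K ⧸ faceIdeal K (∅ : Set (Finset σ))) :=
    Ideal.Quotient.subsingleton_iff.mpr h1
  exact ⟨0, zero_mem _, Subsingleton.elim _ _⟩

lemma regularityLE_univ : RegularityLE ρ (faceIdeal K (Set.univ : Set (Finset σ))) 0 := by
  intro i s hs c hc hdc
  have hbot : ∀ f ∈ faceIdeal K (Set.univ : Set (Finset σ)), f = 0 := by
    intro f hf
    rw [mem_faceIdeal isLowerSet_univ] at hf
    ext a
    by_contra ha
    exact hf a ha (Set.mem_univ _)
  have hinj : Function.Injective (Submodule.mkQ (faceIdeal K (Set.univ : Set (Finset σ)))) := by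
    rw [← LinearMap.ker_eq_bot, LinearMap.ker_eq_bot']
    intro f hf
    exact hbot f ((Submodule.Quotient.mk_eq_zero _).mp hf)
  choose f hf hfc using fun S => mem_quotGrading.mp (hc S).1
  obtain rfl : (fun S => Submodule.mkQ (faceIdeal K (Set.univ : Set (Finset σ))) (f S)) = c :=
    funext hfc
  obtain ⟨b, hb, hdb⟩ := exists_koszulD_eq_of_stdGrading ρ (i := i) (c := f)
    (fun S => ⟨hf S, fun h => hinj (by rw [hfc, (hc S).2 h, map_zero])⟩)
    (by
      funext S
      apply hinj
      have := congrFun hdc S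
      rw [← map_koszulD] at this
      simpa using this)
    (constantCoeff_eq_zero_of_mem_stdGrading hs.ne' (hf ∅))
  refine ⟨fun S => Submodule.mkQ _ (b S), fun S => ⟨mem_quotGrading.mpr ⟨_, (hb S).1, rfl⟩,
    fun h => by dsimp only; rw [(hb S).2 h, map_zero]⟩, ?_⟩
  rw [← map_koszulD, hdb]

/-- The complex of all sets disjoint from a given set of variables: its ideal is generated by
variables. -/
lemma regularityLE_disjoint (A : Finset σ) :
    RegularityLE ρ (faceIdeal K {F : Finset σ | Disjoint F A}) 0 := by
  induction A using Finset.induction_on with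
  | empty => simpa using regularityLE_univ
  | insert v A hv ih =>
    have hlow : IsLowerSet {F : Finset σ | Disjoint F A} :=
      fun _ _ hGF hF => Disjoint.mono_left hGF hF
    have := regularityLE_avoid hlow {v} ih (by
      rw [show colonFaces {F : Finset σ | Disjoint F A} {v} = {F : Finset σ | Disjoint F A} by
        ext F
        simp [colonFaces, hv]]
      simpa using ih)
    rwa [show avoidFaces {F : Finset σ | Disjoint F A} {v} =
        {F : Finset σ | Disjoint F (insert v A)} by
      ext F
      simp [avoidFaces, and_comm]] at this

end RegularityBounds

/-! ### The Koszul class of an induced matching -/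

section InducedMatching

variable {σ : Type*} [DecidableEq σ]

/-- `T` contains exactly one element of each member of `M`, and no other elements. -/
def IsTransversal (M : Finset (Finset σ)) (T : Finset σ) : Prop :=
  T ⊆ M.biUnion id ∧ ∀ E ∈ M, ∃ t ∈ T, t ∈ E ∧ ∀ t' ∈ T, t' ∈ E → t' = t

/-- The order given by `ρ` does not interleave the members of `M`. -/
def IsBlockOrder (ρ : σ ↪ ℕ) (M : Finset (Finset σ)) : Prop :=
  ∀ E ∈ M, ∀ E' ∈ M, E ≠ E' → ∀ v ∈ E, ∀ t ∈ E, ∀ x ∈ E', ρ x < ρ v ↔ ρ x < ρ t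

lemma exists_isBlockOrder [Fintype σ] {M : Finset (Finset σ)}
    (hM : (M : Set (Finset σ)).PairwiseDisjoint id) : ∃ ρ : σ ↪ ℕ, IsBlockOrder ρ M := by
  classical
  let N := Fintype.card σ
  let e := Fintype.equivFin σ
  let idx : σ → ℕ := fun v => if h : ∃ E : M, v ∈ E.1 then M.equivFin h.choose else 0
  have hidx : ∀ E : M, ∀ v ∈ E.1, idx v = M.equivFin E := by
    intro E v hv
    have h : ∃ E : M, v ∈ E.1 := ⟨E, hv⟩
    have : h.choose = E := by
      by_contra hne
      exact Finset.disjoint_left.mp (hM h.choose.2 E.2 fun h' => hne (Subtype.ext h'))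
        h.choose_spec hv
    simp only [idx]
    rw [dif_pos h, this]
  have hlt : ∀ v, (e v : ℕ) < N := fun v => (e v).2
  have hcmp : ∀ x v, idx x ≠ idx v → (idx x * N + e x < idx v * N + e v ↔ idx x < idx v) := by
    intro x v hne
    have h1 := hlt x
    have h2 := hlt v
    constructor
    · intro h
      by_contra h3
      have : idx v + 1 ≤ idx x := by omega
      nlinarith
    · intro h
      have : idx x + 1 ≤ idx v := h
      nlinarith
  refine ⟨⟨fun v => idx v * N + e v, fun v w h => ?_⟩, ?_⟩
  · have h' : idx v * N + e v = idx w * N + e w := h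
    have h3 : (e v : ℕ) = e w := by
      have := congrArg (· % N) h'
      simpa [Nat.add_mod, Nat.mod_eq_of_lt (hlt v), Nat.mod_eq_of_lt (hlt w)] using this
    exact e.injective (Fin.ext h3)
  · intro E hE E' hE' hne v hv t ht x hx
    have hv' := hidx ⟨E, hE⟩ v hv
    have ht' := hidx ⟨E, hE⟩ t ht
    have hx' := hidx ⟨E', hE'⟩ x hx
    have hxv : idx x ≠ idx v := by
      rw [hx', hv']
      intro h
      have := M.equivFin.injective (Fin.ext h)
      exact hne (Subtype.ext_iff.mp this).symm
    change idx x * N + e x < idx v * N + e v ↔ idx x * N + e x < idx t * N + e t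
    rw [hcmp x v hxv, hcmp x t (by rwa [ht', ← hv']), hv', ht']

variable {M : Finset (Finset σ)}

lemma eq_of_mem_of_mem_of_pairwiseDisjoint (hM : (M : Set (Finset σ)).PairwiseDisjoint id)
    {E E' : Finset σ} (hE : E ∈ M) (hE' : E' ∈ M) {v : σ} (hv : v ∈ E) (hv' : v ∈ E') : E = E' := by
  by_contra hne
  exact Finset.disjoint_left.mp (hM hE hE' hne) hv hv'

/-- Exchanging an element of a transversal for another element of the same block gives a
transversal. -/
lemma IsTransversal.exchange (hM : (M : Set (Finset σ)).PairwiseDisjoint id) {T : Finset σ}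
    (hT : IsTransversal M T) {E : Finset σ} (hE : E ∈ M) {v t : σ} (hv : v ∈ E) (ht : t ∈ E)
    (htT : t ∈ T) : IsTransversal M (insert v (T.erase t)) := by
  have huniq : ∀ t' ∈ T, t' ∈ E → t' = t := by
    obtain ⟨t0, _, _, h⟩ := hT.2 E hE
    intro t' ht' htE
    rw [h t' ht' htE, h t htT ht]
  refine ⟨?_, fun E' hE' => ?_⟩
  · intro x hx
    rcases mem_insert.mp hx with rfl | hx
    · exact mem_biUnion.mpr ⟨E, hE, hv⟩
    · exact hT.1 (mem_of_mem_erase hx)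
  · by_cases h : E' = E
    · subst h
      refine ⟨v, mem_insert_self _ _, hv, fun t' ht' htE => ?_⟩
      rcases mem_insert.mp ht' with h | h
      · exact h
      · exact absurd (huniq t' (mem_of_mem_erase h) htE) (ne_of_mem_erase h)
    · obtain ⟨u, huT, huE, hu⟩ := hT.2 E' hE'
      refine ⟨u, mem_insert_of_mem (mem_erase.mpr ⟨?_, huT⟩), huE, fun t' ht' htE => ?_⟩
      · rintro rfl
        exact h (eq_of_mem_of_mem_of_pairwiseDisjoint hM hE' hE huE ht)
      · rcases mem_insert.mp ht' with rfl | h'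
        · exact absurd (eq_of_mem_of_mem_of_pairwiseDisjoint hM hE' hE htE hv) h
        · exact hu t' (mem_of_mem_erase h') htE

/-- Exchanging an element of a transversal changes the sign in the Koszul differential. -/
lemma IsTransversal.neg_one_pow_exchange {R : Type*} [CommRing R] {ρ : σ ↪ ℕ}
    (hρ : IsBlockOrder ρ M) {T : Finset σ}
    (hT : IsTransversal M T) {E : Finset σ} (hE : E ∈ M) {v t : σ} (hv : v ∈ E) (ht : t ∈ E)
    (htT : t ∈ T) (hvT : v ∉ T) :
    (-1 : R) ^ #{x ∈ insert v (T.erase t) | ρ x < ρ t} = - (-1) ^ #{x ∈ T | ρ x < ρ v} := by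
  have hiff : ∀ x ∈ T.erase t, (ρ x < ρ t ↔ ρ x < ρ v) := by
    intro x hx
    obtain ⟨E', hE', hxE'⟩ := mem_biUnion.mp (hT.1 (mem_of_mem_erase hx))
    refine hρ E hE E' hE' ?_ t ht v hv x hxE'
    rintro rfl
    obtain ⟨u, _, _, hu⟩ := hT.2 E hE
    exact ne_of_mem_erase hx
      ((hu x (mem_of_mem_erase hx) hxE').trans (hu t htT ht).symm)
  have hne : ρ t ≠ ρ v := fun h => hvT (ρ.injective h ▸ htT)
  have hT' : insert t (T.erase t) = T := insert_erase htT
  have hcard : #{x ∈ T | ρ x < ρ v} = #{x ∈ insert t (T.erase t) | ρ x < ρ v} := by rw [hT']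
  rw [hcard, filter_insert, filter_insert, filter_congr hiff]
  rcases lt_or_gt_of_ne hne with h | h
  · rw [if_pos h, if_neg (not_lt.mpr h.le), card_insert_of_notMem (by simp)]
    ring
  · rw [if_pos h, if_neg (not_lt.mpr h.le), card_insert_of_notMem (by simp [hvT])]
    ring

lemma exists_isTransversal (hM : (M : Set (Finset σ)).PairwiseDisjoint id)
    (hne : ∀ E ∈ M, E.Nonempty) : ∃ T, IsTransversal M T ∧ T.card = M.card := by
  rcases M.eq_empty_or_nonempty with rfl | ⟨E₀, hE₀⟩
  · exact ⟨∅, ⟨by simp, by simp⟩, rfl⟩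
  have : Nonempty σ := ⟨(hne E₀ hE₀).choose⟩
  choose! p hp using hne
  refine ⟨M.image p, ⟨?_, fun E hE => ⟨p E, mem_image_of_mem _ hE, hp E hE, ?_⟩⟩, ?_⟩
  · intro x hx
    obtain ⟨E, hE, rfl⟩ := mem_image.mp hx
    exact mem_biUnion.mpr ⟨E, hE, hp E hE⟩
  · intro t ht htE
    obtain ⟨E', hE', rfl⟩ := mem_image.mp ht
    rw [eq_of_mem_of_mem_of_pairwiseDisjoint hM hE hE' htE (hp E' hE')]
  · refine card_image_of_injOn fun E hE E' hE' h => ?_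
    have h1 := hp E hE
    rw [h] at h1
    exact eq_of_mem_of_mem_of_pairwiseDisjoint hM hE hE' h1 (hp E' hE')

lemma sqfreeExp_sdiff_sub_single {W T : Finset σ} {v : σ} :
    sqfreeExp (W \ T) - Finsupp.single v 1 = sqfreeExp (W \ insert v T) := by
  ext w
  rw [Finsupp.tsub_apply, sqfreeExp_apply, sqfreeExp_apply, Finsupp.single_apply]
  by_cases h : v = w
  · subst h
    simp
    split_ifs <;> rfl
  · simp [h, Ne.symm h]

variable {K : Type*} [Field K] [Fintype σ]

/-- The alternating sum over all transversals vanishes on Koszul boundaries. -/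
lemma sum_coeff_koszulD_transversal {ρ : σ ↪ ℕ} (hρ : IsBlockOrder ρ M)
    (hM : (M : Set (Finset σ)).PairwiseDisjoint id) (p : Finset σ → MvPolynomial σ K) :
    open Classical in
    ∑ T with IsTransversal M T,
      coeff (sqfreeExp (M.biUnion id \ T)) (koszulD (K := K) ρ p T) = 0 := by
  classical
  set W := M.biUnion id with hW
  have h1 : ∀ T : Finset σ, coeff (sqfreeExp (W \ T)) (koszulD (K := K) ρ p T) =
      ∑ v ∈ W \ T, (-1) ^ #{x ∈ T | ρ x < ρ v} *
        coeff (sqfreeExp (W \ insert v T)) (p (insert v T)) := by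
    intro T
    rw [coeff_koszulD]
    symm
    refine Finset.sum_subset_zero_on_sdiff (fun v hv => ?_) (fun v hv => ?_) (fun v hv => ?_)
    · exact mem_compl.mpr (mem_sdiff.mp hv).2
    · rw [if_pos]
      rw [sqfreeExp_apply, if_neg (mem_sdiff.mp hv).2]
    · rw [if_neg, sqfreeExp_sdiff_sub_single]
      rw [sqfreeExp_apply, if_pos hv]
      exact one_ne_zero
  simp only [h1]
  rw [Finset.sum_sigma']
  have hmate : ∀ q : Σ _ : Finset σ, σ, ∃ (E : Finset σ) (t : σ),
      q ∈ ({T | IsTransversal M T} : Finset (Finset σ)).sigma (fun T => W \ T) →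
      E ∈ M ∧ t ∈ q.1 ∧ t ∈ E ∧ q.2 ∈ E ∧ q.2 ∉ q.1 ∧ IsTransversal M q.1 := by
    rintro ⟨T, v⟩
    by_cases hq : ⟨T, v⟩ ∈ ({T | IsTransversal M T} : Finset (Finset σ)).sigma (fun T => W \ T)
    swap
    · exact ⟨∅, v, fun h => absurd h hq⟩
    simp only [mem_sigma, mem_filter, Finset.mem_univ, true_and, mem_sdiff] at hq
    obtain ⟨hT, hvW, hvT⟩ := hq
    obtain ⟨E, hE, hvE⟩ := mem_biUnion.mp hvW
    obtain ⟨t, htT, htE, _⟩ := hT.2 E hE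
    exact ⟨E, t, fun _ => ⟨hE, htT, htE, hvE, hvT, hT⟩⟩
  choose E t hEt using hmate
  choose hE htT htE hvE hvT hTr using hEt
  refine Finset.sum_involution (fun q _ => ⟨insert q.2 (q.1.erase (t q)), t q⟩) ?_ ?_ ?_ ?_
  · intro q hq
    have hset : insert (t q) (insert q.2 (q.1.erase (t q))) = insert q.2 q.1 := by
      rw [Finset.insert_comm, insert_erase (htT q hq)]
    dsimp only
    rw [(hTr q hq).neg_one_pow_exchange hρ (hE q hq) (hvE q hq) (htE q hq) (htT q hq) (hvT q hq),
      hset]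
    ring
  · intro q hq _ h
    exact hvT q hq (congrArg Sigma.snd h ▸ htT q hq)
  · intro q hq
    simp only [mem_sigma, mem_filter, Finset.mem_univ, true_and, mem_sdiff]
    refine ⟨(hTr q hq).exchange hM (hE q hq) (hvE q hq) (htE q hq) (htT q hq),
      mem_biUnion.mpr ⟨_, hE q hq, htE q hq⟩, ?_⟩
    rw [mem_insert, not_or]
    exact ⟨fun h => hvT q hq (h ▸ htT q hq), by simp⟩
  · intro q hq
    set q' : Σ _ : Finset σ, σ := ⟨insert q.2 (q.1.erase (t q)), t q⟩ with hq'
    have hq'mem : q' ∈ ({T | IsTransversal M T} : Finset (Finset σ)).sigma (fun T => W \ T) := by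
      simp only [hq', mem_sigma, mem_filter, Finset.mem_univ, true_and, mem_sdiff]
      refine ⟨(hTr q hq).exchange hM (hE q hq) (hvE q hq) (htE q hq) (htT q hq),
        mem_biUnion.mpr ⟨_, hE q hq, htE q hq⟩, ?_⟩
      rw [mem_insert, not_or]
      exact ⟨fun h => hvT q hq (h ▸ htT q hq), by simp⟩
    have hEE : E q' = E q := eq_of_mem_of_mem_of_pairwiseDisjoint hM (hE q' hq'mem) (hE q hq)
      (hvE q' hq'mem) (htE q hq)
    have ht' : t q' = q.2 := by
      obtain ⟨u, _, _, hu⟩ := (hTr q' hq'mem).2 (E q) (hE q hq)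
      rw [hu (t q') (htT q' hq'mem) (hEE ▸ htE q' hq'mem),
        hu q.2 (mem_insert_self _ _) (hvE q hq)]
    refine Sigma.ext ?_ (heq_of_eq ht')
    change insert (t q) ((insert q.2 (q.1.erase (t q))).erase (t q')) = q.1
    rw [ht', erase_insert (fun h => hvT q hq (mem_of_mem_erase h)), insert_erase (htT q hq)]

/-- If the restriction of `Φ` to the union of a matching `M` consists of the sets that contain no
member of `M`, then `M` gives a non-zero Koszul homology class: this restriction is a join of
boundaries of simplices, hence a sphere. -/
theorem not_koszulVanishes_of_matching {ρ : σ ↪ ℕ} (hρ : IsBlockOrder ρ M)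
    (hM : (M : Set (Finset σ)).PairwiseDisjoint id) (hne : ∀ E ∈ M, E.Nonempty)
    {Φ : Set (Finset σ)} (hΦ : IsLowerSet Φ) (hnon : ∀ E ∈ M, E ∉ Φ)
    (hface : ∀ F ⊆ M.biUnion id, (∀ E ∈ M, ¬ E ⊆ F) → F ∈ Φ) :
    ¬ KoszulVanishes K ρ (quotGrading (faceIdeal K Φ)) M.card
      ((M.biUnion id).card - M.card) := by
  classical
  intro hvan
  obtain ⟨T₀, hT₀, hcard⟩ := exists_isTransversal hM hne
  set W := M.biUnion id with hW
  let c : Finset σ → MvPolynomial σ K := fun S => if S = T₀ then monomial (sqfreeExp (W \ T₀)) 1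
    else 0
  have hc : (fun S => Submodule.mkQ (faceIdeal K Φ) (c S)) ∈ koszulChains σ
      (quotGrading (faceIdeal K Φ)) M.card (W.card - M.card) := by
    refine fun S => ⟨?_, fun hS => ?_⟩
    · refine mem_quotGrading.mpr ⟨c S, ?_, rfl⟩
      simp only [c]
      split_ifs
      · refine isWeightedHomogeneous_monomial _ _ _ ?_
        rw [weight_sqfreeExp, card_sdiff_of_subset hT₀.1, hcard,
          Nat.cast_sub (hcard ▸ card_le_card hT₀.1)]
      · exact zero_mem _
    · simp only [c]
      rw [if_neg (show S ≠ T₀ by rintro rfl; exact hS hcard), map_zero]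
  have hdc : koszulD (K := K) ρ (fun S => Submodule.mkQ (faceIdeal K Φ) (c S)) = 0 := by
    rw [← map_koszulD]
    funext T
    rw [Pi.zero_apply, mkQ_ideal_eq_zero, koszulD_apply]
    refine sum_mem fun v hv => ?_
    simp only [c]
    split_ifs with h
    · have hvT₀ : v ∈ T₀ := h ▸ mem_insert_self _ _
      obtain ⟨E, hE, hvE⟩ := mem_biUnion.mp (hT₀.1 hvT₀)
      rw [koszulCoeff, smul_eq_mul, mul_assoc]
      refine Ideal.mul_mem_left _ _ ?_
      rw [X, monomial_mul, mem_faceIdeal hΦ]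
      intro a ha hmem
      rw [coeff_monomial] at ha
      split_ifs at ha with h'
      · subst h'
        refine hnon E hE (hΦ ?_ hmem)
        intro x hx
        rw [Finsupp.mem_support_iff, Finsupp.add_apply, sqfreeExp_apply]
        by_cases hxv : v = x
        · subst hxv; simp
        · rw [if_pos]
          · simp
          · refine mem_sdiff.mpr ⟨mem_biUnion.mpr ⟨E, hE, hx⟩, fun hxT => ?_⟩
            obtain ⟨u, _, _, hu⟩ := hT₀.2 E hE
            exact hxv ((hu v hvT₀ hvE).trans (hu x hxT hx).symm)
      · exact ha rfl
    · rw [smul_zero]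
      exact zero_mem _
  obtain ⟨b, hb, hdb⟩ := hvan _ hc hdc
  choose p _ hp using fun S => mem_quotGrading.mp (hb S).1
  obtain rfl : (fun S => Submodule.mkQ _ (p S)) = b := funext hp
  rw [← map_koszulD] at hdb
  have hcoeff : ∀ T, IsTransversal M T → coeff (sqfreeExp (W \ T)) (koszulD (K := K) ρ p T) =
      if T = T₀ then 1 else 0 := by
    intro T hT
    have hmem : koszulD (K := K) ρ p T - c T ∈ faceIdeal K Φ := by
      rw [← mkQ_ideal_eq_zero, map_sub, sub_eq_zero]
      exact congrFun hdb T
    have hzero : coeff (sqfreeExp (W \ T)) (koszulD (K := K) ρ p T - c T) = 0 := by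
      by_contra h
      refine (mem_faceIdeal hΦ).mp hmem _ h ?_
      rw [support_sqfreeExp]
      refine hface _ sdiff_subset fun E hE hsub => ?_
      obtain ⟨t, htT, htE, _⟩ := hT.2 E hE
      exact (mem_sdiff.mp (hsub htE)).2 htT
    rw [coeff_sub, sub_eq_zero] at hzero
    rw [hzero]
    simp only [c]
    split_ifs with h
    · rw [h, coeff_monomial, if_pos rfl]
    · rw [coeff_zero]
  have hsum := sum_coeff_koszulD_transversal hρ hM p
  rw [Finset.sum_congr rfl fun T hT => hcoeff T (mem_filter.mp hT).2, Finset.sum_ite_eq',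
    if_pos (by simpa using hT₀)] at hsum
  exact one_ne_zero hsum

end InducedMatching

/-! ### Families of finite sets -/

section Families

variable {σ : Type*} [DecidableEq σ]

/-- In a `d`-uniform family whose members meet in `d - 1` elements or not at all, some matching
contributes at least as much as the whole family: a set that meets a previous one adds at most one
new element. -/
lemma exists_matching_of_uniform {d : ℕ} (M : Finset (Finset σ)) (hcard : ∀ E ∈ M, E.card = d)
    (hint : ∀ E ∈ M, ∀ F ∈ M, E ≠ F → (E ∩ F).Nonempty → (E ∩ F).card + 1 = d) :
    ∃ N ⊆ M, (N : Set (Finset σ)).PairwiseDisjoint id ∧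
      (M.biUnion id).card + N.card ≤ (N.biUnion id).card + M.card := by
  induction M using Finset.induction_on with
  | empty => exact ⟨∅, by simp⟩
  | insert E M hE ih =>
    obtain ⟨N, hNM, hdisj, hle⟩ := ih (fun F hF => hcard F (mem_insert_of_mem hF))
      (fun F hF G hG => hint F (mem_insert_of_mem hF) G (mem_insert_of_mem hG))
    rw [biUnion_insert, id, card_insert_of_notMem hE]
    by_cases hmeet : ∃ F ∈ M, (E ∩ F).Nonempty
    · obtain ⟨F, hF, hEF⟩ := hmeet
      refine ⟨N, hNM.trans (subset_insert _ _), hdisj, ?_⟩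
      have h1 := hint E (mem_insert_self _ _) F (mem_insert_of_mem hF)
        (fun h => hE (h ▸ hF)) hEF
      have h2 := hcard E (mem_insert_self _ _)
      have h3 : (E ∩ F).card ≤ (E ∩ M.biUnion id).card :=
        card_le_card (inter_subset_inter_left (subset_biUnion_of_mem id hF))
      have h4 := card_union_add_card_inter E (M.biUnion id)
      omega
    · push Not at hmeet
      have hEN : ∀ F ∈ N, Disjoint E F := fun F hF =>
        disjoint_iff_inter_eq_empty.mpr (hmeet F (hNM hF))
      have hENu : Disjoint E (N.biUnion id) := (disjoint_biUnion_right _ _ _).mpr hEN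
      refine ⟨insert E N, insert_subset_insert _ hNM, ?_, ?_⟩
      · rw [coe_insert]
        exact hdisj.insert fun F hF _ => hEN F hF
      · rw [biUnion_insert, id, card_insert_of_notMem fun h => hE (hNM h),
          card_union_of_disjoint hENu]
        have := card_union_le E (M.biUnion id)
        omega

/-- Removing one element from each member of a family leaves a set that contains no member. -/
lemma exists_independent_of_family (M : Finset (Finset σ)) (hne : ∀ E ∈ M, E.Nonempty) :
    ∃ F ⊆ M.biUnion id, (∀ E ∈ M, ¬ E ⊆ F) ∧ (M.biUnion id).card ≤ F.card + M.card := by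
  rcases M.eq_empty_or_nonempty with rfl | ⟨E₀, hE₀⟩
  · exact ⟨∅, by simp⟩
  have : Nonempty σ := ⟨(hne E₀ hE₀).choose⟩
  choose! p hp using hne
  refine ⟨M.biUnion id \ M.image p, sdiff_subset, fun E hE h => ?_, ?_⟩
  · exact (mem_sdiff.mp (h (hp E hE))).2 (mem_image_of_mem p hE)
  · have h1 := le_card_sdiff (M.image p) (M.biUnion id)
    have h2 := card_image_le (s := M) (f := p)
    omega

/-- A graph with edge set `M` and without isolated vertices has at least as many components as its
number of vertices minus its number of edges. The labelling `ℓ` separates the components, and `N`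
contains at most one edge from each of them. -/
lemma exists_labelling_of_graph (M : Finset (Finset σ)) (hcard : ∀ E ∈ M, E.card = 2) :
    ∃ (ℓ : σ → σ) (N : Finset (Finset σ)), N ⊆ M ∧ (M.biUnion id).card ≤ M.card + N.card ∧
      (∀ E ∈ M, ∀ a ∈ E, ∀ b ∈ E, ℓ a = ℓ b) ∧
      (∀ v ∉ M.biUnion id, ∀ w, ℓ w = ℓ v → w = v) ∧
      (∀ E ∈ N, ∀ F ∈ N, ∀ a ∈ E, ∀ b ∈ F, ℓ a = ℓ b → E = F) := by
  induction M using Finset.induction_on with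
  | empty => exact ⟨id, ∅, by simp⟩
  | insert E M hE ih =>
    obtain ⟨ℓ, N, hNM, hle, hconst, hsingle, hsep⟩ :=
      ih fun F hF => hcard F (mem_insert_of_mem hF)
    obtain ⟨a, b, hab, rfl⟩ := card_eq_two.mp (hcard E (mem_insert_self _ _))
    -- Adding the edge `{a, b}` merges the classes of `a` and `b`.
    set ℓ' : σ → σ := fun w => if ℓ w = ℓ b then ℓ a else ℓ w with hℓ'
    have hmono : ∀ v w, ℓ v = ℓ w → ℓ' v = ℓ' w := fun v w h => by simp only [hℓ', h]
    have hcases : ∀ v w, ℓ' v = ℓ' w → ℓ v = ℓ w ∨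
        ((ℓ v = ℓ a ∨ ℓ v = ℓ b) ∧ (ℓ w = ℓ a ∨ ℓ w = ℓ b)) := by
      intro v w h
      simp only [hℓ'] at h
      split_ifs at h with h1 h2 h2
      exacts [Or.inl (h1.trans h2.symm), Or.inr ⟨Or.inr h1, Or.inl h.symm⟩,
        Or.inr ⟨Or.inl h, Or.inr h2⟩, Or.inl h]
    have hpair : ∀ v ∈ ({a, b} : Finset σ), ℓ' v = ℓ a := by
      intro v hv
      rcases mem_insert.mp hv with h | h
      · simp [hℓ', h]
      · simp [hℓ', mem_singleton.mp h]
    have hconst' : ∀ F ∈ insert {a, b} M, ∀ v ∈ F, ∀ w ∈ F, ℓ' v = ℓ' w := by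
      intro F hF v hv w hw
      rcases mem_insert.mp hF with rfl | hF
      · exact (hpair v hv).trans (hpair w hw).symm
      · exact hmono _ _ (hconst F hF v hv w hw)
    have hsingle' : ∀ v ∉ (insert {a, b} M).biUnion id, ∀ w, ℓ' w = ℓ' v → w = v := by
      intro v hv w hw
      rw [biUnion_insert, id, mem_union, not_or, mem_insert, mem_singleton, not_or] at hv
      rcases hcases w v hw with h | ⟨_, h | h⟩
      · exact hsingle v hv.2 w h
      · exact absurd (hsingle v hv.2 a h.symm).symm hv.1.1
      · exact absurd (hsingle v hv.2 b h.symm).symm hv.1.2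
    -- No edge of `N` has a vertex whose class was a singleton outside the edges of `M`.
    have hnew : ∀ v ∉ M.biUnion id, ∀ F ∈ N, ∀ w ∈ F, ℓ w ≠ ℓ v := by
      intro v hv F hF w hw h
      rw [← hsingle v hv w h] at hv
      exact hv (mem_biUnion.mpr ⟨F, hNM hF, hw⟩)
    have hsep_of_new : (∀ F ∈ N, ∀ w ∈ F, ℓ w ≠ ℓ a) ∨ (∀ F ∈ N, ∀ w ∈ F, ℓ w ≠ ℓ b) →
        ∀ F ∈ N, ∀ G ∈ N, ∀ v ∈ F, ∀ w ∈ G, ℓ' v = ℓ' w → F = G := by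
      intro h F hF G hG v hv w hw hvw
      rcases hcases v w hvw with h1 | ⟨h1, h2⟩
      · exact hsep F hF G hG v hv w hw h1
      · refine hsep F hF G hG v hv w hw ?_
        rcases h with h | h
        · rw [h1.resolve_left (h F hF v hv), h2.resolve_left (h G hG w hw)]
        · rw [h1.resolve_right (h F hF v hv), h2.resolve_right (h G hG w hw)]
    have hcardM := card_insert_of_notMem hE
    by_cases ha : a ∈ M.biUnion id <;> by_cases hb : b ∈ M.biUnion id
    · -- Both vertices are old: drop the edge of `N` in the class of `b`.
      refine ⟨ℓ', {F ∈ N | ∀ w ∈ F, ℓ w ≠ ℓ b}, (filter_subset _ _).trans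
        (hNM.trans (subset_insert _ _)), ?_, hconst', hsingle', ?_⟩
      · have h1 : ({F ∈ N | ¬ ∀ w ∈ F, ℓ w ≠ ℓ b} : Finset _).card ≤ 1 := by
          refine card_le_one.mpr fun F hF G hG => ?_
          simp only [mem_filter, not_forall, not_not] at hF hG
          obtain ⟨hF, v, hv, hvb⟩ := hF
          obtain ⟨hG, w, hw, hwb⟩ := hG
          exact hsep F hF G hG v hv w hw (hvb.trans hwb.symm)
        have h2 := card_filter_add_card_filter_not (s := N) (fun F => ∀ w ∈ F, ℓ w ≠ ℓ b)
        have h3 : (insert {a, b} M).biUnion id = M.biUnion id := by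
          rw [biUnion_insert, id]
          refine union_eq_right.mpr fun v hv => ?_
          rcases mem_insert.mp hv with rfl | hv
          · exact ha
          · rwa [mem_singleton.mp hv]
        rw [h3]
        omega
      · intro F hF G hG v hv w hw hvw
        simp only [mem_filter] at hF hG
        rcases hcases v w hvw with h1 | ⟨h1, h2⟩
        · exact hsep F hF.1 G hG.1 v hv w hw h1
        · refine hsep F hF.1 G hG.1 v hv w hw ?_
          rw [h1.resolve_right (hF.2 v hv), h2.resolve_right (hG.2 w hw)]
    · refine ⟨ℓ', N, hNM.trans (subset_insert _ _), ?_, hconst', hsingle',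
        hsep_of_new (Or.inr (hnew b hb))⟩
      have h3 : (insert {a, b} M).biUnion id ⊆ insert b (M.biUnion id) := by
        rw [biUnion_insert, id]
        intro v hv
        simp only [mem_union, mem_insert, mem_singleton] at hv ⊢
        rcases hv with (rfl | rfl) | h
        exacts [Or.inr ha, Or.inl rfl, Or.inr h]
      have := (card_le_card h3).trans (card_insert_le _ _)
      omega
    · refine ⟨ℓ', N, hNM.trans (subset_insert _ _), ?_, hconst', hsingle',
        hsep_of_new (Or.inl (hnew a ha))⟩
      have h3 : (insert {a, b} M).biUnion id ⊆ insert a (M.biUnion id) := by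
        rw [biUnion_insert, id]
        intro v hv
        simp only [mem_union, mem_insert, mem_singleton] at hv ⊢
        rcases hv with (rfl | rfl) | h
        exacts [Or.inl rfl, Or.inr hb, Or.inr h]
      have := (card_le_card h3).trans (card_insert_le _ _)
      omega
    · -- Both vertices are new: the edge is a component of its own.
      refine ⟨ℓ', insert {a, b} N, insert_subset_insert _ hNM, ?_, hconst', hsingle', ?_⟩
      · have h1 := card_union_le {a, b} (M.biUnion id)
        have h2 := card_le_two (a := a) (b := b)
        rw [biUnion_insert, id, card_insert_of_notMem fun h => hE (hNM h)]
        omega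
      · have hout : ∀ F ∈ N, ∀ v ∈ F, ∀ w ∈ ({a, b} : Finset σ), ℓ' v ≠ ℓ' w := by
          intro F hF v hv w hw hvw
          have h0 : ℓ w = ℓ a ∨ ℓ w = ℓ b := by
            rcases mem_insert.mp hw with rfl | hw
            exacts [Or.inl rfl, Or.inr (by rw [mem_singleton.mp hw])]
          have h1 : ℓ v = ℓ a ∨ ℓ v = ℓ b := by
            rcases hcases v w hvw with h | h
            · rwa [h]
            · exact h.1
          rcases h1 with h1 | h1
          exacts [hnew a ha F hF v hv h1, hnew b hb F hF v hv h1]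
        intro F hF G hG v hv w hw hvw
        rcases mem_insert.mp hF with rfl | hF <;> rcases mem_insert.mp hG with rfl | hG
        · rfl
        · exact absurd hvw.symm (hout G hG w hw v hv)
        · exact absurd hvw (hout F hF v hv w hw)
        · exact hsep_of_new (Or.inl (hnew a ha)) F hF G hG v hv w hw hvw

/-- The bound of the regularity by matchings, for uniform families whose members meet in all but
one of their elements or not at all. The induction removes one edge `E`. The colon ideal by `E` is
generated by some variables, collected in `A`, and the edges disjoint from `E`. -/
theorem regularityLE_of_uniform {K : Type*} [Field K] [Fintype σ] {ρ : σ ↪ ℕ} {d : ℕ}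
    (𝓔 : Finset (Finset σ)) (hne : ∀ E ∈ 𝓔, E.Nonempty) (hcard : ∀ E ∈ 𝓔, E.card = d)
    (hint : ∀ E ∈ 𝓔, ∀ F ∈ 𝓔, E ≠ F → (E ∩ F).Nonempty → (E ∩ F).card + 1 = d) (A : Finset σ)
    {r : ℤ} (hr : ∀ N ⊆ 𝓔, (N : Set (Finset σ)).PairwiseDisjoint id →
      ((N.biUnion id).card : ℤ) - N.card ≤ r) :
    RegularityLE ρ (faceIdeal K {F | Disjoint F A ∧ ∀ E ∈ 𝓔, ¬ E ⊆ F}) r := by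
  induction h𝓔 : 𝓔.card using Nat.strong_induction_on generalizing 𝓔 A r with
  | _ n ih =>
    subst h𝓔
    rcases 𝓔.eq_empty_or_nonempty with rfl | ⟨E, hE⟩
    · have h0 : (0 : ℤ) ≤ r := by simpa using hr ∅ (by simp) (by simp)
      simpa using (regularityLE_disjoint (K := K) (ρ := ρ) A).mono h0
    set J := 𝓔.erase E with hJ
    have hJsub : J ⊆ 𝓔 := erase_subset _ _
    have hlow : ∀ (𝓕 : Finset (Finset σ)) (B : Finset σ),
        IsLowerSet {F : Finset σ | Disjoint F B ∧ ∀ E ∈ 𝓕, ¬ E ⊆ F} :=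
      fun 𝓕 B F G hGF hF => ⟨Disjoint.mono_left hGF hF.1, fun E hE h => hF.2 E hE (h.trans hGF)⟩
    have hΦ : {F : Finset σ | Disjoint F A ∧ ∀ E ∈ 𝓔, ¬ E ⊆ F} =
        avoidFaces {F : Finset σ | Disjoint F A ∧ ∀ E ∈ J, ¬ E ⊆ F} E := by
      ext F
      constructor
      · intro hF
        exact ⟨⟨hF.1, fun E' hE' => hF.2 E' (hJsub hE')⟩, hF.2 E hE⟩
      · rintro ⟨hF, hEF⟩
        refine ⟨hF.1, fun E' hE' => ?_⟩
        by_cases h : E' = E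
        · rwa [h]
        · exact hF.2 E' (mem_erase.mpr ⟨h, hE'⟩)
    rw [hΦ]
    refine regularityLE_avoid (hlow J A) E ?_ ?_
    · exact ih J.card (card_erase_lt_of_mem hE) J (fun F hF => hne F (hJsub hF))
        (fun F hF => hcard F (hJsub hF))
        (fun F hF G hG => hint F (hJsub hF) G (hJsub hG)) A
        (fun N hN => hr N (hN.trans hJsub)) rfl
    · by_cases hEA : Disjoint E A
      swap
      · have hempty : colonFaces {F : Finset σ | Disjoint F A ∧ ∀ E ∈ J, ¬ E ⊆ F} E = ∅ :=
          Set.eq_empty_of_forall_notMem fun F h =>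
            hEA (Disjoint.mono_left subset_union_right h.1)
        rw [hempty]
        exact regularityLE_empty _
      set J' := {E' ∈ J | Disjoint E' E} with hJ'
      set B := {E' ∈ J | ¬ Disjoint E' E}.biUnion (· \ E) with hB
      have hsdiff : ∀ E' ∈ J, ¬ Disjoint E' E → (E' \ E).card = 1 := by
        intro E' hE' hdis
        have h1 := hint E' (hJsub hE') E hE (ne_of_mem_erase hE')
          (not_disjoint_iff_nonempty_inter.mp hdis)
        have h2 := card_sdiff_add_card_inter E' E
        have h3 := hcard E' (hJsub hE')
        omega
      have hcolon : colonFaces {F : Finset σ | Disjoint F A ∧ ∀ E ∈ J, ¬ E ⊆ F} E =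
          {F : Finset σ | Disjoint F (A ∪ B) ∧ ∀ E ∈ J', ¬ E ⊆ F} := by
        ext F
        constructor
        · rintro ⟨hFA, hF⟩
          refine ⟨disjoint_union_right.mpr ⟨Disjoint.mono_left subset_union_left hFA, ?_⟩,
            fun E' hE' h => hF E' (mem_filter.mp hE').1 (h.trans subset_union_left)⟩
          rw [Finset.disjoint_left]
          intro x hxF hxB
          obtain ⟨E', hE', hx⟩ := mem_biUnion.mp hxB
          rw [mem_filter] at hE'
          refine hF E' hE'.1 ?_
          intro z hz
          by_cases hzE : z ∈ E
          · exact mem_union_right _ hzE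
          · rw [card_le_one.mp (hsdiff E' hE'.1 hE'.2).le z (mem_sdiff.mpr ⟨hz, hzE⟩) x hx]
            exact mem_union_left _ hxF
        · rintro ⟨hFAB, hF⟩
          rw [disjoint_union_right] at hFAB
          refine ⟨disjoint_union_left.mpr ⟨hFAB.1, hEA⟩, fun E' hE' h => ?_⟩
          by_cases hdis : Disjoint E' E
          · exact hF E' (mem_filter.mpr ⟨hE', hdis⟩) fun x hx =>
              (mem_union.mp (h hx)).resolve_right (Finset.disjoint_left.mp hdis hx)
          · obtain ⟨x, hx⟩ : (E' \ E).Nonempty :=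
              Finset.card_pos.mp (by rw [hsdiff E' hE' hdis]; exact one_pos)
            exact Finset.disjoint_left.mp hFAB.2
              ((mem_union.mp (h (mem_sdiff.mp hx).1)).resolve_right (mem_sdiff.mp hx).2)
              (mem_biUnion.mpr ⟨E', mem_filter.mpr ⟨hE', hdis⟩, hx⟩)
      have hJ'sub : J' ⊆ 𝓔 := (filter_subset _ _).trans hJsub
      rw [hcolon]
      refine ih J'.card ((card_le_card (filter_subset _ _)).trans_lt (card_erase_lt_of_mem hE)) J'
        (fun F hF => hne F (hJ'sub hF)) (fun F hF => hcard F (hJ'sub hF))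
        (fun F hF G hG => hint F (hJ'sub hF) G (hJ'sub hG)) (A ∪ B) (fun N hN hdis => ?_) rfl
      have hEN : ∀ F ∈ N, Disjoint E F := fun F hF => (mem_filter.mp (hN hF)).2.symm
      have hEnot : E ∉ N := fun h => by
        have := hne E hE
        rw [disjoint_self.mp (hEN E h)] at this
        simp at this
      have := hr (insert E N) (insert_subset hE (hN.trans hJ'sub)) (by
        rw [coe_insert]
        exact hdis.insert fun F hF _ => hEN F hF)
      have hENu : Disjoint E (N.biUnion id) := (disjoint_biUnion_right _ _ _).mpr hEN
      rw [biUnion_insert, id, card_union_of_disjoint hENu, hcard E hE,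
        card_insert_of_notMem hEnot] at this
      rw [hcard E hE]
      push_cast at this
      omega

end Families

/-! ### Regularity of simplicial complexes by deletion and link -/

namespace VertexedComplex

variable {α : Type*}

section Faces

variable (D : VertexedComplex α) (V A : Set α)

open Classical in
/-- The complex on `V` whose faces are the sets disjoint from `A` that meet the vertex set of `D` in
a face of `D`. Outside of the vertices of `D`, the elements of `A` are non-faces, and the other
elements of `V` are cone points. -/
def extendedFaces : Set (Finset V) :=
  {F | {y ∈ F.map (Function.Embedding.subtype _) | y ∈ D.vertices} ∈ D.faces ∧
    ∀ v ∈ F, (v : α) ∉ A}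

lemma isLowerSet_extendedFaces : IsLowerSet (D.extendedFaces V A) := by
  classical
  exact fun _ _ hGF hF => ⟨D.down_closed (filter_subset_filter _ (map_subset_map.mpr hGF)) hF.1,
    fun v hv => hF.2 v (hGF hv)⟩

end Faces

lemma mem_faces_link [DecidableEq α] {D : VertexedComplex α} {x : α} {F : Finset α} :
    F ∈ (D.link x).faces ↔ x ∉ F ∧ insert x F ∈ D.faces := by
  constructor
  · rintro ⟨h, hF⟩
    exact ⟨h, by rwa [cons_eq_insert] at hF⟩
  · rintro ⟨h, hF⟩
    exact ⟨h, by rwa [cons_eq_insert]⟩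

section Regularity

variable {V : Set α} [Fintype V] [DecidableEq V]

/-- The regularity of `D` is at most `r`. This holds in all polynomial rings that have further
variables, each of which may be adjoined freely or put to zero. -/
def RegularityBound (K : Type*) [Field K] (ρ : V ↪ ℕ) (D : VertexedComplex α) (r : ℤ) : Prop :=
  ∀ A : Set α, Disjoint A D.vertices → RegularityLE ρ (faceIdeal K (D.extendedFaces V A)) r

variable {K : Type*} [Field K] {ρ : V ↪ ℕ} {D : VertexedComplex α} {r : ℤ}

lemma RegularityBound.of_faces_eq_empty (h : D.faces = ∅) : RegularityBound K ρ D r := by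
  intro A _
  rw [show D.extendedFaces V A = ∅ from Set.eq_empty_of_forall_notMem fun F hF => by
    have := hF.1
    rw [h] at this
    exact this]
  exact regularityLE_empty r

lemma RegularityBound.of_forall_mem_faces
    (h : ∀ F : Finset α, (F : Set α) ⊆ D.vertices → F ∈ D.faces) (hr : 0 ≤ r) :
    RegularityBound K ρ D r := by
  classical
  intro A _
  have hfaces : D.extendedFaces V A =
      {F : Finset V | Disjoint F (Finset.univ.filter fun v : V => (v : α) ∈ A)} := by
    ext F
    simp only [extendedFaces, Set.mem_ofPred_eq, Finset.disjoint_left, mem_filter,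
      Finset.mem_univ, true_and]
    refine and_iff_right (h _ fun y hy => ?_)
    exact (mem_filter.mp (mem_coe.mp hy)).2
  rw [hfaces]
  exact (regularityLE_disjoint _).mono hr

lemma RegularityBound.of_link_of_deletion (hV : D.vertices ⊆ V) {x : α} (hx : x ∈ D.vertices)
    (hlink : RegularityBound K ρ (D.link x) (r - 1))
    (hdel : RegularityBound K ρ (D.deletion x) r) : RegularityBound K ρ D r := by
  classical
  intro A hA
  have hxA : x ∉ A := fun h => Set.disjoint_left.mp hA h hx
  have hcoe : ∀ v : V, v = ⟨x, hV hx⟩ ↔ (v : α) = x := fun v => Subtype.ext_iff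
  refine regularityLE_of_colon_of_avoid (D.isLowerSet_extendedFaces V A) {⟨x, hV hx⟩} ?_ ?_
  · have hcolon : colonFaces (D.extendedFaces V A) {⟨x, hV hx⟩} =
        (D.link x).extendedFaces V A := by
      ext F
      have hset : ({y ∈ (F ∪ {⟨x, hV hx⟩}).map (Function.Embedding.subtype _) | y ∈ D.vertices} :
          Finset α) = insert x {y ∈ F.map (Function.Embedding.subtype _) |
            y ∈ (D.link x).vertices} := by
        ext y
        simp only [link, Set.mem_sdiff, Set.mem_singleton_iff, mem_filter, mem_insert, mem_map,
          mem_union, mem_singleton, Function.Embedding.coe_subtype]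
        constructor
        · rintro ⟨⟨v, hv | rfl, rfl⟩, hy⟩
          · by_cases h : (v : α) = x
            · exact Or.inl h
            · exact Or.inr ⟨⟨v, hv, rfl⟩, hy, h⟩
          · exact Or.inl rfl
        · rintro (rfl | ⟨⟨v, hv, rfl⟩, hy, -⟩)
          · exact ⟨⟨_, Or.inr rfl, rfl⟩, hx⟩
          · exact ⟨⟨v, Or.inl hv, rfl⟩, hy⟩
      simp only [colonFaces, extendedFaces, Set.mem_ofPred_eq]
      rw [hset, mem_faces_link]
      constructor
      · rintro ⟨h1, h2⟩
        exact ⟨⟨fun h => (mem_filter.mp h).2.2 rfl, h1⟩, fun v hv => h2 v (mem_union_left _ hv)⟩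
      · rintro ⟨⟨_, h1⟩, h2⟩
        refine ⟨h1, fun v hv => ?_⟩
        rcases mem_union.mp hv with hv | hv
        · exact h2 v hv
        · rw [mem_singleton, hcoe] at hv
          rwa [hv]
    rw [hcolon, card_singleton]
    exact hlink A (hA.mono_right Set.sdiff_subset)
  · have havoid : avoidFaces (D.extendedFaces V A) {⟨x, hV hx⟩} =
        (D.deletion x).extendedFaces V (insert x A) := by
      ext F
      simp only [avoidFaces, extendedFaces, Set.mem_ofPred_eq, singleton_subset_iff, deletion,
        Set.mem_sdiff, Set.mem_singleton_iff, Set.mem_insert_iff, not_or]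
      have hset : (∀ v ∈ F, (v : α) ≠ x) →
          ({y ∈ F.map (Function.Embedding.subtype _) | y ∈ D.vertices ∧ ¬ y = x} : Finset α) =
            {y ∈ F.map (Function.Embedding.subtype _) | y ∈ D.vertices} := by
        intro h
        refine filter_congr fun y hy => and_iff_left ?_
        obtain ⟨v, hv, rfl⟩ := mem_map.mp hy
        exact h v hv
      constructor
      · rintro ⟨⟨h1, h2⟩, h3⟩
        have h4 : ∀ v ∈ F, (v : α) ≠ x := fun v hv h => h3 ((hcoe v).mpr h ▸ hv)
        rw [hset h4]
        refine ⟨⟨h1, fun h => ?_⟩, fun v hv => ⟨h4 v hv, h2 v hv⟩⟩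
        obtain ⟨v, hv, hvx⟩ := mem_map.mp (mem_filter.mp h).1
        exact h4 v hv hvx
      · rintro ⟨⟨h1, _⟩, h2⟩
        rw [hset fun v hv => (h2 v hv).1] at h1
        exact ⟨⟨h1, fun v hv => (h2 v hv).2⟩, fun h => (h2 _ h).1 rfl⟩
    rw [havoid]
    refine hdel _ (Set.disjoint_left.mpr fun y hy hyD => ?_)
    rcases hy with rfl | hy
    · exact hyD.2 rfl
    · exact Set.disjoint_left.mp hA hy hyD.1

/-- The regularity is at most the maximal cardinality of a face. -/
theorem RegularityBound.of_card_le (hV : D.vertices ⊆ V) (h : ∀ F ∈ D.faces, (F.card : ℤ) ≤ r) :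
    RegularityBound K ρ D r := by
  classical
  have hfin : D.vertices.Finite := V.toFinite.subset hV
  induction hn : D.vertices.ncard generalizing D r with
  | zero =>
    rw [Set.ncard_eq_zero hfin] at hn
    rcases D.faces.eq_empty_or_nonempty with h0 | ⟨F, hF⟩
    · exact of_faces_eq_empty h0
    · refine of_forall_mem_faces (fun G hG => D.down_closed (fun x hx => ?_) hF)
        ((Nat.cast_nonneg _).trans (h F hF))
      have := hG hx
      rw [hn] at this
      exact absurd this (Set.notMem_empty x)
  | succ n ih =>
    obtain ⟨x, hx⟩ := (Set.ncard_pos hfin).mp (by omega)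
    have hcard : (D.vertices \ {x}).ncard = n := by
      rw [Set.ncard_sdiff_singleton_of_mem hx, hn, Nat.add_sub_cancel]
    refine of_link_of_deletion hV hx
      (ih (D := D.link x) (Set.sdiff_subset.trans hV) (fun F hF => ?_)
        (hfin.subset Set.sdiff_subset) hcard)
      (ih (D := D.deletion x) (Set.sdiff_subset.trans hV) (fun F hF => h F hF.1)
        (hfin.subset Set.sdiff_subset) hcard)
    obtain ⟨hxF, hF⟩ := mem_faces_link.mp hF
    have := h _ hF
    rw [card_insert_of_notMem hxF] at this
    push_cast at this
    omega

end Regularity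

/-! ### Minimal non-faces and shedding vertices -/

/-- The minimal non-faces, which are the edges of the hypergraph with independence complex `D`. -/
def minimalNonfaces (D : VertexedComplex α) : Set (Finset α) :=
  {E | (E : Set α) ⊆ D.vertices ∧ E ∉ D.faces ∧ ∀ F ⊂ E, F ∈ D.faces}

/-- There is no `n`-cycle of minimal non-faces. -/
def CycleFree (D : VertexedComplex α) (n : ℕ) : Prop :=
  ∀ (x : Fin n → α) (E : Fin n → Finset α), Function.Injective x → Function.Injective E →
    ¬ ∀ i, E i ∈ D.minimalNonfaces ∧ x i ∈ E i ∧ x (finRotate n i) ∈ E i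

variable {D : VertexedComplex α} {x : α}

lemma exists_minimalNonface_subset {G : Finset α} (hG : (G : Set α) ⊆ D.vertices)
    (hGD : G ∉ D.faces) : ∃ E ∈ D.minimalNonfaces, E ⊆ G := by
  induction G using Finset.strongInduction with
  | H G ih =>
    by_cases h : ∀ F ⊂ G, F ∈ D.faces
    · exact ⟨G, ⟨hG, hGD, h⟩, Subset.refl G⟩
    · push Not at h
      obtain ⟨F, hFG, hF⟩ := h
      obtain ⟨E, hE, hEF⟩ := ih F hFG ((coe_subset.mpr hFG.1).trans hG) hF
      exact ⟨E, hE, hEF.trans hFG.1⟩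

lemma mem_minimalNonfaces_deletion {E : Finset α} :
    E ∈ (D.deletion x).minimalNonfaces ↔ E ∈ D.minimalNonfaces ∧ x ∉ E := by
  constructor
  · rintro ⟨h1, h2, h3⟩
    have hx : x ∉ E := fun h => (h1 h).2 rfl
    exact ⟨⟨h1.trans Set.sdiff_subset, fun h => h2 ⟨h, hx⟩, fun F hF => (h3 F hF).1⟩, hx⟩
  · rintro ⟨⟨h1, h2, h3⟩, hx⟩
    exact ⟨fun y hy => ⟨h1 hy, fun h => hx (by rwa [← Set.mem_singleton_iff.mp h])⟩,
      fun h => h2 h.1, fun F hF => ⟨h3 F hF, fun h => hx (hF.1 h)⟩⟩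

lemma notMem_of_mem_minimalNonfaces_link {E : Finset α} (hE : E ∈ (D.link x).minimalNonfaces) :
    x ∉ E :=
  fun h => (hE.1 h).2 rfl

lemma CycleFree.deletion {n : ℕ} (h : D.CycleFree n) : (D.deletion x).CycleFree n :=
  fun y E hy hE hyE => h y E hy hE fun i =>
    ⟨(mem_minimalNonfaces_deletion.mp (hyE i).1).1, (hyE i).2⟩

/-- In a `C₂`-free complex, a minimal non-face is determined by any two of its elements. -/
lemma CycleFree.eq_of_two (h : D.CycleFree 2) {E F : Finset α} (hE : E ∈ D.minimalNonfaces)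
    (hF : F ∈ D.minimalNonfaces) {a b : α} (hab : a ≠ b) (haE : a ∈ E) (hbE : b ∈ E) (haF : a ∈ F)
    (hbF : b ∈ F) : E = F := by
  by_contra hne
  refine h ![a, b] ![E, F] ?_ ?_ ?_
  · intro i j hij
    fin_cases i <;> fin_cases j <;> simp_all
  · intro i j hij
    fin_cases i <;> fin_cases j <;> simp_all
  · intro i
    fin_cases i
    · exact ⟨hE, haE, hbE⟩
    · exact ⟨hF, hbF, haF⟩

lemma CycleFree.false_of_five (h : D.CycleFree 5) {a b c d e : α} {E₁ E₂ E₃ E₄ E₅ : Finset α}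
    (hnodup : [a, b, c, d, e].Nodup) (hnodup' : [E₁, E₂, E₃, E₄, E₅].Nodup)
    (h₁ : E₁ ∈ D.minimalNonfaces) (h₂ : E₂ ∈ D.minimalNonfaces) (h₃ : E₃ ∈ D.minimalNonfaces)
    (h₄ : E₄ ∈ D.minimalNonfaces) (h₅ : E₅ ∈ D.minimalNonfaces)
    (ha₁ : a ∈ E₁) (hb₁ : b ∈ E₁) (hb₂ : b ∈ E₂) (hc₂ : c ∈ E₂) (hc₃ : c ∈ E₃) (hd₃ : d ∈ E₃)
    (hd₄ : d ∈ E₄) (he₄ : e ∈ E₄) (he₅ : e ∈ E₅) (ha₅ : a ∈ E₅) : False := by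
  refine h [a, b, c, d, e].get [E₁, E₂, E₃, E₄, E₅].get (List.nodup_iff_injective_get.mp hnodup)
    (List.nodup_iff_injective_get.mp hnodup') fun i => ?_
  fin_cases i
  exacts [⟨h₁, ha₁, hb₁⟩, ⟨h₂, hb₂, hc₂⟩, ⟨h₃, hc₃, hd₃⟩, ⟨h₄, hd₄, he₄⟩, ⟨h₅, he₅, ha₅⟩]

variable [DecidableEq α]

lemma erase_notMem_faces_link {E : Finset α} (hE : E ∈ D.minimalNonfaces) :
    E.erase x ∉ (D.link x).faces := by
  intro h
  refine hE.2.1 (D.down_closed ?_ (mem_faces_link.mp h).2)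
  exact (insert_erase_subset x E)

lemma erase_subset_vertices_link {E : Finset α} (hE : E ∈ D.minimalNonfaces) :
    ((E.erase x : Finset α) : Set α) ⊆ (D.link x).vertices := by
  rw [coe_erase]
  exact Set.sdiff_subset_sdiff_left hE.1

lemma exists_erase_eq_of_mem_minimalNonfaces_link (hx : x ∈ D.vertices) {E : Finset α}
    (hE : E ∈ (D.link x).minimalNonfaces) : ∃ F ∈ D.minimalNonfaces, F.erase x = E := by
  have hxE := notMem_of_mem_minimalNonfaces_link hE
  obtain ⟨F, hF, hFE⟩ := exists_minimalNonface_subset (D := D) (G := insert x E) (by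
    rw [coe_insert]
    exact Set.insert_subset hx (hE.1.trans Set.sdiff_subset))
    (fun h => hE.2.1 (mem_faces_link.mpr ⟨hxE, h⟩))
  refine ⟨F, hF, ?_⟩
  by_contra hne
  have hsub : F.erase x ⊆ E := by
    rw [← erase_insert hxE]
    exact erase_subset_erase x hFE
  exact erase_notMem_faces_link hF (hE.2.2 _ (hsub.ssubset_of_ne hne))

lemma CycleFree.link {n : ℕ} (hx : x ∈ D.vertices) (h : D.CycleFree n) :
    (D.link x).CycleFree n := by
  intro y E hy hE hyE
  choose F hF hFE using fun i => exists_erase_eq_of_mem_minimalNonfaces_link hx (hyE i).1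
  have hsub : ∀ i, E i ⊆ F i := fun i => hFE i ▸ erase_subset _ _
  refine h y F hy (fun i j hij => hE ?_) fun i => ⟨hF i, hsub i (hyE i).2.1, hsub i (hyE i).2.2⟩
  rw [← hFE i, ← hFE j, hij]

/-- Every semi induced matching of minimal non-faces contributes at most `r`. -/
def SemiInducedBound (D : VertexedComplex α) (r : ℤ) : Prop :=
  ∀ M : Finset (Finset α), (∀ E ∈ M, E ∈ D.minimalNonfaces) →
    (∀ E ∈ D.minimalNonfaces, E ⊆ M.biUnion id → E ∈ M) →
      ((M.biUnion id).card : ℤ) - M.card ≤ r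

lemma SemiInducedBound.deletion {r : ℤ} (h : D.SemiInducedBound r) :
    (D.deletion x).SemiInducedBound r := by
  intro M hM hsemi
  have hM' := fun E hE => mem_minimalNonfaces_deletion.mp (hM E hE)
  refine h M (fun E hE => (hM' E hE).1) fun E hE hsub =>
    hsemi E (mem_minimalNonfaces_deletion.mpr ⟨hE, fun hx => ?_⟩) hsub
  obtain ⟨F, hF, hxF⟩ := mem_biUnion.mp (hsub hx)
  exact (hM' F hF).2 hxF

/-- The central step for shedding vertices. Let `M` be a semi induced matching of the minimal
non-faces of `D` with union avoiding the shedding vertex `x`, such that no minimal non-face in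
`⋃ M ∪ {x}` other than those of `M` exists. Then adding to `M` some minimal non-face through `x`
gives a semi induced matching again. Otherwise, each minimal non-face `F` through `x` meets some
`G F` with all vertices but one in `⋃ M`; the vertices of the sets `G F` in `⋃ M` form a face since
there are no 5-cycles, and a facet of the deletion that contains this face can be extended
by `x`. -/
lemma exists_mem_extension (hfin : D.vertices.Finite) (hx : x ∈ D.vertices)
    (hshed : ∀ F, (D.deletion x).IsFacet F → D.IsFacet F)
    (h2 : D.CycleFree 2) (h5 : D.CycleFree 5) {M : Finset (Finset α)}
    (hM : ∀ E ∈ M, E ∈ D.minimalNonfaces) (hcard : ∀ E ∈ M, 1 < E.card)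
    (hxM : x ∉ M.biUnion id)
    (hsemi : ∀ E ∈ D.minimalNonfaces, E ⊆ insert x (M.biUnion id) → E ∈ M) :
    ∃ F ∈ D.minimalNonfaces, x ∈ F ∧
      ∀ G ∈ D.minimalNonfaces, G ⊆ M.biUnion id ∪ F → G ∈ M ∨ G = F := by
  classical
  by_contra! hcon
  set W := M.biUnion id with hW
  have hWx : W ⊆ insert x W := subset_insert _ _
  have hMW : ∀ E ∈ M, E ⊆ W := fun E hE => subset_biUnion_of_mem id hE
  have hWD : (W : Set α) ⊆ D.vertices := by
    intro z hz
    obtain ⟨E, hE, hzE⟩ := mem_biUnion.mp (mem_coe.mp hz)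
    exact (hM E hE).1 hzE
  have key : ∀ F ∈ D.minimalNonfaces, x ∈ F → ∃ (G : Finset α) (y : α), G ∈ D.minimalNonfaces ∧
      x ∉ G ∧ y ∈ F ∧ y ≠ x ∧ y ∉ W ∧ y ∈ G ∧ G ⊆ insert y W := by
    intro F hF hxF
    obtain ⟨G, hG, hGsub, hGM, hGF⟩ := hcon F hF hxF
    have hxG : x ∉ G := by
      intro hxG
      refine hGM (hsemi G hG fun z hz => ?_)
      by_contra hzW
      rw [mem_insert, not_or] at hzW
      exact hGF (h2.eq_of_two hG hF hzW.1 hz hxG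
        ((mem_union.mp (hGsub hz)).resolve_left hzW.2) hxF)
    obtain ⟨y, hyG, hyW⟩ : ∃ y ∈ G, y ∉ W := by
      by_contra! h
      exact hGM (hsemi G hG (Subset.trans h hWx))
    have hyF := (mem_union.mp (hGsub hyG)).resolve_left hyW
    refine ⟨G, y, hG, hxG, hyF, fun h => hxG (h ▸ hyG), hyW, hyG, fun z hz => ?_⟩
    by_contra hzW
    rw [mem_insert, not_or] at hzW
    exact hGF (h2.eq_of_two hG hF hzW.1 hz hyG
      ((mem_union.mp (hGsub hz)).resolve_left hzW.2) hyF)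
  have : Nonempty α := ⟨x⟩
  choose! G y hG hxG hyF hyx hyW hyG hGsub using key
  let S : Finset α := {z ∈ W | ∃ F ∈ D.minimalNonfaces, x ∈ F ∧ z ∈ G F}
  have hSW : S ⊆ W := filter_subset _ _
  have hS : S ∈ D.faces := by
    by_contra hSD
    obtain ⟨E, hE, hES⟩ := exists_minimalNonface_subset ((coe_subset.mpr hSW).trans hWD) hSD
    have hEW := hES.trans hSW
    have hEM := hsemi E hE (hEW.trans hWx)
    obtain ⟨z₁, hz₁, z₂, hz₂, hz⟩ := one_lt_card.mp (hcard E hEM)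
    obtain ⟨hz₁W, F₁, hF₁, hxF₁, hzG₁⟩ := mem_filter.mp (hES hz₁)
    obtain ⟨hz₂W, F₂, hF₂, hxF₂, hzG₂⟩ := mem_filter.mp (hES hz₂)
    have hGE : ∀ F ∈ D.minimalNonfaces, x ∈ F → G F ≠ E := fun F hF hxF h =>
      hyW F hF hxF (hEW (h ▸ hyG F hF hxF))
    have hGG : G F₁ ≠ G F₂ := fun h => hGE F₁ hF₁ hxF₁
      (h2.eq_of_two (hG F₁ hF₁ hxF₁) hE hz hzG₁ (h ▸ hzG₂) hz₁ hz₂)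
    have hFF : F₁ ≠ F₂ := fun h => hGG (by rw [h])
    have hyy : y F₁ ≠ y F₂ := fun h => hFF (h2.eq_of_two hF₁ hF₂ (hyx F₁ hF₁ hxF₁)
      (hyF F₁ hF₁ hxF₁) hxF₁ (h ▸ hyF F₂ hF₂ hxF₂) hxF₂)
    have hxE : x ∉ E := fun h => hxM (hEW h)
    have ne_of_W : ∀ {p q : α}, p ∉ W → q ∈ W → p ≠ q := fun hp hq h => hp (h ▸ hq)
    have ne_of_x : ∀ {P Q : Finset α}, x ∈ P → x ∉ Q → P ≠ Q := fun hP hQ h => hQ (h ▸ hP)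
    refine h5.false_of_five (a := x) (b := y F₁) (c := z₁) (d := z₂) (e := y F₂) (E₁ := F₁)
      (E₂ := G F₁) (E₃ := E) (E₄ := G F₂) (E₅ := F₂) ?_ ?_ hF₁ (hG F₁ hF₁ hxF₁) hE
      (hG F₂ hF₂ hxF₂) hF₂ hxF₁ (hyF F₁ hF₁ hxF₁) (hyG F₁ hF₁ hxF₁) hzG₁ hz₁ hz₂ hzG₂
      (hyG F₂ hF₂ hxF₂) (hyF F₂ hF₂ hxF₂) hxF₂
    · simp only [List.nodup_cons, List.mem_cons, List.not_mem_nil, or_false, not_or,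
        not_false_eq_true, List.nodup_nil, and_true]
      exact ⟨⟨(hyx F₁ hF₁ hxF₁).symm, ne_of_W hxM hz₁W, ne_of_W hxM hz₂W, (hyx F₂ hF₂ hxF₂).symm⟩,
        ⟨ne_of_W (hyW F₁ hF₁ hxF₁) hz₁W, ne_of_W (hyW F₁ hF₁ hxF₁) hz₂W, hyy⟩,
        ⟨hz, (ne_of_W (hyW F₂ hF₂ hxF₂) hz₁W).symm⟩, (ne_of_W (hyW F₂ hF₂ hxF₂) hz₂W).symm⟩
    · simp only [List.nodup_cons, List.mem_cons, List.not_mem_nil, or_false, not_or,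
        not_false_eq_true, List.nodup_nil, and_true]
      exact ⟨⟨ne_of_x hxF₁ (hxG F₁ hF₁ hxF₁), ne_of_x hxF₁ hxE, ne_of_x hxF₁ (hxG F₂ hF₂ hxF₂),
          hFF⟩,
        ⟨hGE F₁ hF₁ hxF₁, hGG, (ne_of_x hxF₂ (hxG F₁ hF₁ hxF₁)).symm⟩,
        ⟨(hGE F₂ hF₂ hxF₂).symm, (ne_of_x hxF₂ hxE).symm⟩,
        (ne_of_x hxF₂ (hxG F₂ hF₂ hxF₂)).symm⟩
  have hfaces : (D.deletion x).faces.Finite := by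
    refine (Set.Finite.preimage (f := fun F : Finset α => (F : Set α)) coe_injective.injOn
      hfin.powerset).subset fun F hF => ?_
    exact (D.subset_vertices F hF.1)
  obtain ⟨T, hST, hT⟩ := hfaces.exists_le_maximal (a := S) ⟨hS, fun h => hxM (hSW h)⟩
  have hTD : T ∈ D.faces := hT.prop.1
  refine hT.prop.2 ((hshed T hT).le_of_ge (y := insert x T) ?_ (subset_insert x T)
    (mem_insert_self x T))
  by_contra hxT
  obtain ⟨F, hF, hFT⟩ := exists_minimalNonface_subset (D := D) (G := insert x T) (by
    rw [coe_insert]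
    exact Set.insert_subset hx (D.subset_vertices T hTD)) hxT
  have hxF : x ∈ F := by
    by_contra hxF
    exact hF.2.1 (D.down_closed ((subset_insert_iff_of_notMem hxF).mp hFT) hTD)
  refine (hG F hF hxF).2.1 (D.down_closed (fun z hz => ?_) hTD)
  by_cases hzy : z = y F
  · rw [hzy]
    exact (mem_insert.mp (hFT (hyF F hF hxF))).resolve_left (hyx F hF hxF)
  · have hzW := (mem_insert.mp (hGsub F hF hxF hz)).resolve_left hzy
    exact hST (mem_filter.mpr ⟨hzW, F, hF, hxF, hz⟩)

/-- Semi induced matchings of the link of a shedding vertex extend to the complex, with a larger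
value. -/
lemma SemiInducedBound.link (hfin : D.vertices.Finite) (hx : x ∈ D.vertices)
    (hshed : ∀ F, (D.deletion x).IsFacet F → D.IsFacet F)
    (h2 : D.CycleFree 2) (h5 : D.CycleFree 5) (hne : ∅ ∈ (D.link x).faces) {r : ℤ}
    (h : D.SemiInducedBound r) : (D.link x).SemiInducedBound (r - 1) := by
  classical
  intro M' hM' hsemi'
  -- The minimal non-faces of the link with one element contribute nothing.
  set M := {E ∈ M' | 1 < E.card} with hMdef
  set W := M.biUnion id with hW
  have hMM' : M ⊆ M' := filter_subset _ _
  have hcardpos : ∀ E ∈ M', E.Nonempty := fun E hE => by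
    by_contra hE0
    rw [not_nonempty_iff_eq_empty] at hE0
    exact (hM' E hE).2.1 (hE0 ▸ hne)
  have hval : ((M'.biUnion id).card : ℤ) - M'.card ≤ (W.card : ℤ) - M.card := by
    have h1 : M'.biUnion id = W ∪ {E ∈ M' | ¬ 1 < E.card}.biUnion id := by
      rw [hW, hMdef, ← union_biUnion, filter_union_filter_not_eq]
    have h2 : ({E ∈ M' | ¬ 1 < E.card}.biUnion id).card ≤ #{E ∈ M' | ¬ 1 < E.card} * 1 :=
      card_biUnion_le_card_mul _ _ _ fun E hE => not_lt.mp (mem_filter.mp hE).2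
    have h3 := card_filter_add_card_filter_not (s := M') (fun E => 1 < E.card)
    have h4 := card_union_le W ({E ∈ M' | ¬ 1 < E.card}.biUnion id)
    rw [← h1] at h4
    rw [← hMdef] at h3
    omega
  have hxW : x ∉ W := by
    intro hxW
    obtain ⟨E, hE, hxE⟩ := mem_biUnion.mp hxW
    exact notMem_of_mem_minimalNonfaces_link (hM' E (hMM' hE)) hxE
  have huniq : ∀ E ∈ D.minimalNonfaces, ∀ F ∈ D.minimalNonfaces, ∀ E' ∈ M, E' ⊆ E → E' ⊆ F →
      E = F := by
    intro E hE F hF E' hE' hEE hEF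
    obtain ⟨a, ha, b, hb, hab⟩ := one_lt_card.mp (mem_filter.mp hE').2
    exact h2.eq_of_two hE hF hab (hEE ha) (hEE hb) (hEF ha) (hEF hb)
  have hlift : ∀ E ∈ M, ∃ F ∈ D.minimalNonfaces, F.erase x = E := fun E hE =>
    exists_erase_eq_of_mem_minimalNonfaces_link hx (hM' E (hMM' hE))
  choose! L hL hLE using hlift
  have hsubL : ∀ E ∈ M, E ⊆ L E := fun E hE => by
    conv_lhs => rw [← hLE E hE]
    exact erase_subset _ _
  have hsemi : ∀ E ∈ D.minimalNonfaces, E ⊆ insert x W → E ∈ M.image L := by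
    intro E hE hsub
    obtain ⟨E', hE', hE'E⟩ := exists_minimalNonface_subset (erase_subset_vertices_link (x := x) hE)
      (erase_notMem_faces_link hE)
    have hE'W : E' ⊆ W := by
      intro z hz
      have hzE := mem_erase.mp (hE'E hz)
      exact (mem_insert.mp (hsub hzE.2)).resolve_left hzE.1
    have hE'M' : E' ∈ M' := hsemi' E' hE'
      (hE'W.trans (biUnion_subset_biUnion_of_subset_left _ hMM'))
    have hE'M : E' ∈ M := by
      refine mem_filter.mpr ⟨hE'M', ?_⟩
      by_contra hle
      obtain ⟨z, hz⟩ := hcardpos E' hE'M'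
      obtain ⟨E'', hE'', hzE''⟩ := mem_biUnion.mp (hE'W hz)
      have hsub : E' ⊆ E'' := fun w hw => by
        rwa [card_le_one.mp (not_lt.mp hle) w hw z hz]
      refine hE'.2.1 ((hM' E'' (hMM' hE'')).2.2 E' (hsub.ssubset_of_ne ?_))
      rintro rfl
      exact hle (mem_filter.mp hE'').2
    rw [huniq E hE (L E') (hL E' hE'M) E' hE'M (hE'E.trans (erase_subset _ _)) (hsubL E' hE'M)]
    exact mem_image_of_mem L hE'M
  have hLcard : (M.image L).card = M.card := card_image_of_injOn fun E hE F hF hEF => by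
    rw [← hLE E hE, ← hLE F hF, hEF]
  have hLM : ∀ E ∈ M.image L, E ∈ D.minimalNonfaces := by
    intro E hE
    obtain ⟨E', hE', rfl⟩ := mem_image.mp hE
    exact hL E' hE'
  by_cases hxL : ∃ E ∈ M, x ∈ L E
  · -- The lifted edges cover `x`.
    obtain ⟨E, hE, hxE⟩ := hxL
    have hunion : (M.image L).biUnion id = insert x W := by
      ext z
      constructor
      · intro hz
        obtain ⟨F, hF, hzF⟩ := mem_biUnion.mp hz
        obtain ⟨F', hF', rfl⟩ := mem_image.mp hF
        by_cases hzx : z = x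
        · rw [hzx]; exact mem_insert_self _ _
        · refine mem_insert_of_mem (mem_biUnion.mpr ⟨F', hF', ?_⟩)
          rw [id, ← hLE F' hF']
          exact mem_erase.mpr ⟨hzx, hzF⟩
      · intro hz
        rcases mem_insert.mp hz with rfl | hz
        · exact mem_biUnion.mpr ⟨L E, mem_image_of_mem L hE, hxE⟩
        · obtain ⟨F, hF, hzF⟩ := mem_biUnion.mp hz
          exact mem_biUnion.mpr ⟨L F, mem_image_of_mem L hF, hsubL F hF hzF⟩
    have := h (M.image L) hLM (by rwa [hunion])
    rw [hunion, card_insert_of_notMem hxW, hLcard] at this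
    push_cast at this
    omega
  · push Not at hxL
    have hLid : M.image L = M := by
      conv_rhs => rw [← image_id (s := M)]
      refine image_congr fun E hE => ?_
      exact (erase_eq_of_notMem (hxL E hE)).symm.trans (hLE E hE)
    rw [hLid] at hsemi hLM
    obtain ⟨F, hF, hxF, hFG⟩ := exists_mem_extension hfin hx hshed h2 h5 hLM
      (fun E hE => (mem_filter.mp hE).2) hxW hsemi
    have hFM : F ∉ M := fun hFM => hxW (mem_biUnion.mpr ⟨F, hFM, hxF⟩)
    have hunion : (insert F M).biUnion id = W ∪ F := by
      rw [biUnion_insert, id, union_comm]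
    have hlt : 1 < (F \ W).card := by
      by_contra hle
      refine hFM (hsemi F hF fun z hz => ?_)
      by_cases hzW : z ∈ W
      · exact mem_insert_of_mem hzW
      · rw [card_le_one.mp (not_lt.mp hle) z (mem_sdiff.mpr ⟨hz, hzW⟩) x
          (mem_sdiff.mpr ⟨hxF, hxW⟩)]
        exact mem_insert_self _ _
    have := h (insert F M) (fun E hE => by
      rcases mem_insert.mp hE with rfl | hE
      exacts [hF, hLM E hE]) (fun E hE hsub => by
      rw [hunion] at hsub
      rcases hFG E hE hsub with h | h
      exacts [mem_insert_of_mem h, h ▸ mem_insert_self _ _])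
    have hcard := card_sdiff_add_card F W
    rw [union_comm] at hcard
    rw [hunion, card_insert_of_notMem hFM] at this
    push_cast at this
    omega

/-- A vertex decomposable complex without 2-cycles and 5-cycles of minimal non-faces has regularity
at most the semi induced matching number. -/
theorem IsVertexDecomposable.regularityBound {V : Set α} [Fintype V] [DecidableEq V] {K : Type*}
    [Field K] {ρ : V ↪ ℕ} (hD : D.IsVertexDecomposable) (hV : D.vertices ⊆ V)
    (h2 : D.CycleFree 2) (h5 : D.CycleFree 5) {r : ℤ} (h : D.SemiInducedBound r) :
    RegularityBound K ρ D r := by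
  induction hD generalizing r with
  | simplex D W hW hfacet =>
    have hr : (0 : ℤ) ≤ r := by
      by_cases h0 : ∅ ∈ D.minimalNonfaces
      · exact absurd (D.down_closed (Finset.empty_subset W) ((hfacet W).mpr rfl).prop) h0.2.1
      · simpa using h ∅ (by simp) (fun E hE hsub => by
          simp only [biUnion_empty, subset_empty] at hsub
          exact absurd (hsub ▸ hE) h0)
    exact RegularityBound.of_forall_mem_faces (fun F hF => D.down_closed
      (coe_subset.mp (hF.trans_eq hW.symm)) ((hfacet W).mpr rfl).prop) hr
  | void D hD => exact RegularityBound.of_faces_eq_empty hD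
  | shed D x hx _ _ hshed ihdel ihlink =>
    refine RegularityBound.of_link_of_deletion hV hx ?_
      (ihdel (Set.sdiff_subset.trans hV) h2.deletion h5.deletion h.deletion)
    rcases (D.link x).faces.eq_empty_or_nonempty with h0 | ⟨F, hF⟩
    · exact RegularityBound.of_faces_eq_empty h0
    · exact ihlink (Set.sdiff_subset.trans hV) (h2.link hx) (h5.link hx)
        (h.link (V.toFinite.subset hV) hx hshed h2 h5
          ((D.link x).down_closed (Finset.empty_subset F) hF))

end VertexedComplex

/-! ### Matching numbers of hypergraphs -/

section ImageFamily

variable {α β : Type*} {f : β → α}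

/-- A finite family of finite sets, as a set of sets in a larger type. -/
def imageFamily (f : β → α) (N : Finset (Finset β)) : Set (Set α) :=
  (fun E : Finset β => f '' (E : Set β)) '' (N : Set (Finset β))

lemma image_coe_injective (hf : Function.Injective f) :
    Function.Injective fun E : Finset β => f '' (E : Set β) :=
  fun _ _ h => coe_injective (hf.image_injective h)

lemma image_coe_subset_image_coe_iff (hf : Function.Injective f) {E F : Finset β} :
    f '' (E : Set β) ⊆ f '' (F : Set β) ↔ E ⊆ F := by
  rw [Set.image_subset_image_iff hf, coe_subset]

lemma mem_imageFamily (hf : Function.Injective f) {N : Finset (Finset β)} {E : Finset β} :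
    f '' (E : Set β) ∈ imageFamily f N ↔ E ∈ N :=
  (image_coe_injective hf).mem_set_image.trans mem_coe

lemma sUnion_imageFamily [DecidableEq β] (f : β → α) (N : Finset (Finset β)) :
    ⋃₀ imageFamily f N = f '' (N.biUnion id : Finset β) := by
  rw [imageFamily, Set.sUnion_image, coe_biUnion, Set.image_iUnion₂]
  rfl

lemma matchingValue_imageFamily [DecidableEq β] (hf : Function.Injective f)
    (N : Finset (Finset β)) :
    Hypergraph.matchingValue (imageFamily f N) = ((N.biUnion id).card : ℤ) - N.card := by
  rw [Hypergraph.matchingValue, sUnion_imageFamily, Set.ncard_image_of_injective _ hf,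
    Set.ncard_coe_finset, imageFamily, Set.ncard_image_of_injective _ (image_coe_injective hf),
    Set.ncard_coe_finset]

lemma pairwiseDisjoint_imageFamily (hf : Function.Injective f) {N : Finset (Finset β)} :
    (imageFamily f N).PairwiseDisjoint id ↔ (N : Set (Finset β)).PairwiseDisjoint id := by
  rw [imageFamily, (image_coe_injective hf).injOn.pairwiseDisjoint_image]
  refine forall₅_congr fun E _ F _ _ => ?_
  simp only [Function.onFun, Function.comp, id]
  rw [Set.disjoint_image_iff hf, disjoint_coe]

end ImageFamily

namespace Hypergraph

variable {α : Type*} {H : Hypergraph α}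

lemma matchingValue_le_sSup (hfin : H.vertexSet.Finite) {P : Set (Set α) → Prop}
    (hP : ∀ M, P M → M ⊆ H.edgeSet) {M : Set (Set α)} (hM : P M) :
    matchingValue M ≤ sSup {z | ∃ M, P M ∧ z = matchingValue M} := by
  refine le_csSup ⟨H.vertexSet.ncard, ?_⟩ ⟨M, hM, rfl⟩
  rintro _ ⟨N, hN, rfl⟩
  have : (⋃₀ N).ncard ≤ H.vertexSet.ncard := Set.ncard_le_ncard
    (Set.sUnion_subset fun e he => H.subset_vertexSet_of_mem_edgeSet' (hP N hN he)) hfin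
  rw [matchingValue]
  omega

lemma exists_matchingValue_eq_sSup (hfin : H.vertexSet.Finite) {P : Set (Set α) → Prop}
    (hP : ∀ M, P M → M ⊆ H.edgeSet) (h0 : P ∅) :
    ∃ M, P M ∧ matchingValue M = sSup {z | ∃ M, P M ∧ z = matchingValue M} := by
  have hbdd : BddAbove {z | ∃ M, P M ∧ z = matchingValue M} := by
    refine ⟨sSup {z | ∃ M, P M ∧ z = matchingValue M}, ?_⟩
    rintro _ ⟨N, hN, rfl⟩
    exact matchingValue_le_sSup hfin hP hN
  have hne : {z | ∃ M, P M ∧ z = matchingValue M}.Nonempty := ⟨_, ∅, h0, rfl⟩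
  obtain ⟨M, hM, hval⟩ := Int.csSup_mem hne hbdd
  exact ⟨M, hM, hval.symm⟩

lemma IsInducedEdgeMatching.matchingValue_le (hfin : H.vertexSet.Finite) {M : Set (Set α)}
    (hM : H.IsInducedEdgeMatching M) : matchingValue M ≤ H.inducedMatchingNumber :=
  matchingValue_le_sSup hfin (fun _ h => h.1.1) hM

lemma IsSemiInducedMatching.matchingValue_le (hfin : H.vertexSet.Finite) {M : Set (Set α)}
    (hM : H.IsSemiInducedMatching M) : matchingValue M ≤ H.semiInducedMatchingNumber :=
  matchingValue_le_sSup hfin (fun _ h => h.1) hM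

lemma IsEdgeMatching.matchingValue_le (hfin : H.vertexSet.Finite) {M : Set (Set α)}
    (hM : H.IsEdgeMatching M) : matchingValue M ≤ H.weightedMatchingNumber :=
  matchingValue_le_sSup hfin (fun _ h => h.1) hM

lemma isSemiInducedMatching_empty (hs : H.IsSimple) : H.IsSemiInducedMatching ∅ := by
  refine ⟨Set.empty_subset _, fun e he hsub => ?_⟩
  rw [Set.sUnion_empty, Set.subset_empty_iff] at hsub
  exact absurd (hs.1 e he) (by simp [hsub])

lemma exists_inducedMatching (hfin : H.vertexSet.Finite) (hs : H.IsSimple) :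
    ∃ M, H.IsInducedEdgeMatching M ∧ matchingValue M = H.inducedMatchingNumber :=
  exists_matchingValue_eq_sSup hfin (fun _ h => h.1.1)
    ⟨isSemiInducedMatching_empty hs, Set.pairwiseDisjoint_empty⟩

lemma exists_semiInducedMatching (hfin : H.vertexSet.Finite) (hs : H.IsSimple) :
    ∃ M, H.IsSemiInducedMatching M ∧ matchingValue M = H.semiInducedMatchingNumber :=
  exists_matchingValue_eq_sSup hfin (fun _ h => h.1) (isSemiInducedMatching_empty hs)

lemma inducedMatchingNumber_le_semiInducedMatchingNumber (hfin : H.vertexSet.Finite)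
    (hs : H.IsSimple) : H.inducedMatchingNumber ≤ H.semiInducedMatchingNumber := by
  obtain ⟨M, hM, hval⟩ := exists_inducedMatching hfin hs
  rw [← hval]
  exact hM.1.matchingValue_le hfin

lemma exists_finset_image_eq (hfin : H.vertexSet.Finite) {e : Set α} (he : e ∈ H.edgeSet) :
    ∃ E : Finset H.vertexSet, (↑) '' (E : Set H.vertexSet) = e := by
  have hsub := H.subset_vertexSet_of_mem_edgeSet' he
  have : Finite H.vertexSet := hfin
  refine ⟨(Set.toFinite ((↑) ⁻¹' e : Set H.vertexSet)).toFinset, ?_⟩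
  rw [Set.Finite.coe_toFinset, Subtype.image_preimage_coe, Set.inter_eq_right.mpr hsub]

lemma exists_eq_imageFamily (hfin : H.vertexSet.Finite) {M : Set (Set α)} (hM : M ⊆ H.edgeSet) :
    ∃ N : Finset (Finset H.vertexSet), M = imageFamily (↑) N := by
  have : Finite H.vertexSet := hfin
  refine ⟨(Set.toFinite {E : Finset H.vertexSet | (↑) '' (E : Set H.vertexSet) ∈ M}).toFinset, ?_⟩
  ext e
  simp only [imageFamily, Set.Finite.coe_toFinset, Set.mem_image, Set.mem_ofPred_eq]
  constructor
  · intro he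
    obtain ⟨E, rfl⟩ := exists_finset_image_eq hfin (hM he)
    exact ⟨E, he, rfl⟩
  · rintro ⟨E, hE, rfl⟩
    exact hE

/-- The vertices of the independence complex are those of the hypergraph, and a face is a set
without edges. -/
lemma map_mem_faces_independenceComplex {F : Finset H.vertexSet} :
    F.map (Function.Embedding.subtype _) ∈ H.independenceComplex.faces ↔
      ∀ E : Finset H.vertexSet, (↑) '' (E : Set H.vertexSet) ∈ H.edgeSet → ¬ E ⊆ F := by
  have hcoe : ((F.map (Function.Embedding.subtype _) : Finset α) : Set α) =
      (↑) '' (F : Set H.vertexSet) := by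
    rw [coe_map]
    rfl
  simp only [independenceComplex, Set.mem_ofPred_eq, hcoe]
  constructor
  · rintro ⟨_, h⟩ E hE hEF
    exact h _ hE (Set.image_mono (coe_subset.mpr hEF))
  · refine fun h => ⟨Subtype.coe_image_subset _ _, fun e he hsub => ?_⟩
    have hfinE : (Subtype.val ⁻¹' e : Set H.vertexSet).Finite :=
      F.finite_toSet.subset fun v hv => by
        obtain ⟨w, hw, hwv⟩ := hsub hv
        rwa [← Subtype.ext hwv]
    refine h hfinE.toFinset ?_ fun v hv => ?_
    · rwa [Set.Finite.coe_toFinset, Subtype.image_preimage_coe,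
        Set.inter_eq_right.mpr (H.subset_vertexSet_of_mem_edgeSet' he)]
    · obtain ⟨w, hw, hwv⟩ := hsub (hfinE.mem_toFinset.mp hv)
      rwa [← Subtype.ext hwv]

/-- The faces of the independence complex, as sets of elements of the vertex type. -/
def faceSets (H : Hypergraph α) : Set (Finset H.vertexSet) :=
  {F | F.map (Function.Embedding.subtype _) ∈ H.independenceComplex.faces}

lemma isLowerSet_faceSets : IsLowerSet H.faceSets :=
  fun _ _ hGF hF => H.independenceComplex.down_closed (map_subset_map.mpr hGF) hF

/-- An upper bound for the regularity by the induced matching number is sharp. -/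
theorem hasRegularity_of_regularityLE (hfin : H.vertexSet.Finite) (hs : H.IsSimple)
    {K : Type*} [Field K] [Fintype H.vertexSet] [DecidableEq H.vertexSet]
    (h : ∀ ρ : H.vertexSet ↪ ℕ,
      RegularityLE ρ (faceIdeal K H.faceSets) H.inducedMatchingNumber) :
    H.HasRegularity K H.inducedMatchingNumber := by
  obtain ⟨M, hM, hval⟩ := exists_inducedMatching hfin hs
  obtain ⟨N, rfl⟩ := exists_eq_imageFamily hfin hM.1.1
  have hinj : Function.Injective (Subtype.val : H.vertexSet → α) := Subtype.val_injective
  have hdisj := (pairwiseDisjoint_imageFamily hinj).mp hM.2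
  rw [matchingValue_imageFamily hinj] at hval
  have hedge : ∀ E ∈ N, (↑) '' (E : Set H.vertexSet) ∈ H.edgeSet := fun E hE =>
    hM.1.1 ((mem_imageFamily hinj).mpr hE)
  obtain ⟨ρ, hρ⟩ := exists_isBlockOrder hdisj
  have hnot : ¬ KoszulVanishes K ρ (quotGrading (faceIdeal K H.faceSets)) N.card
      H.inducedMatchingNumber := by
    rw [← hval]
    refine not_koszulVanishes_of_matching hρ hdisj (fun E hE => ?_) isLowerSet_faceSets
      (fun E hE hEf => ?_) (fun F hF hFE => ?_)
    · have := hs.1 _ (hedge E hE)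
      rwa [Set.image_nonempty, coe_nonempty] at this
    · exact map_mem_faces_independenceComplex.mp hEf E (hedge E hE) (Subset.refl E)
    · refine map_mem_faces_independenceComplex.mpr fun E hE hEF => hFE E ?_ hEF
      refine (mem_imageFamily hinj).mp (hM.1.2 _ hE ?_)
      rw [sUnion_imageFamily, image_coe_subset_image_coe_iff hinj]
      exact hEF.trans hF
  have hempty : (∅ : Finset H.vertexSet) ∈ H.faceSets := by
    refine map_mem_faces_independenceComplex.mpr fun E hE hE0 => ?_
    have := hs.1 _ hE
    rw [Set.image_nonempty, coe_nonempty] at this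
    exact this.ne_empty (subset_empty.mp hE0)
  exact hasRegularity_of_koszul ρ (stdComponent_mem_faceIdeal isLowerSet_faceSets)
    (constantCoeff_of_mem_faceIdeal isLowerSet_faceSets hempty) (h ρ) hnot

lemma regularityLE_of_regularityBound {K : Type*} [Field K] [Fintype H.vertexSet]
    [DecidableEq H.vertexSet] {ρ : H.vertexSet ↪ ℕ} {r : ℤ}
    (h : VertexedComplex.RegularityBound K ρ H.independenceComplex r) :
    RegularityLE ρ (faceIdeal K H.faceSets) r := by
  classical
  have := h ∅ (Set.empty_disjoint _)
  rwa [show H.independenceComplex.extendedFaces H.vertexSet ∅ = H.faceSets by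
    ext F
    simp only [VertexedComplex.extendedFaces, faceSets, Set.mem_ofPred_eq,
      Set.mem_empty_iff_false, not_false_eq_true, implies_true, and_true]
    rw [filter_true_of_mem]
    intro y hy
    obtain ⟨v, _, rfl⟩ := mem_map.mp hy
    exact v.2] at this

/-! ### The dimension as an upper bound -/

lemma card_le_dim_add_one (hfin : H.vertexSet.Finite) {F : Finset α}
    (hF : F ∈ H.independenceComplex.faces) : (F.card : ℤ) ≤ H.independenceComplex.dim + 1 := by
  rw [← sub_le_iff_le_add]
  refine le_csSup ⟨H.vertexSet.ncard, ?_⟩ ⟨F, hF, rfl⟩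
  rintro _ ⟨G, hG, rfl⟩
  have := Set.ncard_le_ncard hG.1 hfin
  rw [Set.ncard_coe_finset] at this
  omega

lemma semiInducedMatchingNumber_le_dim_add_one (hfin : H.vertexSet.Finite) (hs : H.IsSimple) :
    H.semiInducedMatchingNumber ≤ H.independenceComplex.dim + 1 := by
  classical
  obtain ⟨M, hM, hval⟩ := exists_semiInducedMatching hfin hs
  obtain ⟨N, rfl⟩ := exists_eq_imageFamily hfin hM.1
  have hinj : Function.Injective (Subtype.val : H.vertexSet → α) := Subtype.val_injective
  obtain ⟨F, hF, hind, hcard⟩ := exists_independent_of_family N fun E hE => by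
    have := hs.1 _ (hM.1 ((mem_imageFamily hinj).mpr hE))
    rwa [Set.image_nonempty, coe_nonempty] at this
  rw [matchingValue_imageFamily hinj] at hval
  have hface : F.map (Function.Embedding.subtype _) ∈ H.independenceComplex.faces := by
    refine map_mem_faces_independenceComplex.mpr fun E hE hEF => hind E ?_ hEF
    refine (mem_imageFamily hinj).mp (hM.2 _ hE ?_)
    rw [sUnion_imageFamily, image_coe_subset_image_coe_iff hinj]
    exact hEF.trans hF
  have := card_le_dim_add_one hfin hface
  rw [card_map] at this
  omega

theorem hasRegularity_of_eq_dim_add_one (K : Type*) [Field K] (hfin : H.vertexSet.Finite)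
    (hs : H.IsSimple) (h : H.inducedMatchingNumber = H.independenceComplex.dim + 1) :
    H.HasRegularity K H.inducedMatchingNumber := by
  classical
  have := hfin.fintype
  refine hasRegularity_of_regularityLE hfin hs fun ρ => regularityLE_of_regularityBound ?_
  rw [h]
  exact VertexedComplex.RegularityBound.of_card_le (Set.Subset.refl _)
    fun F hF => card_le_dim_add_one hfin hF

/-! ### Vertex decomposable hypergraphs -/

lemma mem_minimalNonfaces_independenceComplex (hs : H.IsSimple) {E : Finset α} :
    E ∈ H.independenceComplex.minimalNonfaces ↔ (E : Set α) ∈ H.edgeSet := by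
  constructor
  · rintro ⟨hEV, hE, hmin⟩
    have hEV' : (E : Set α) ⊆ H.vertexSet := hEV
    obtain ⟨e, he, heE⟩ : ∃ e ∈ H.edgeSet, e ⊆ (E : Set α) := by
      by_contra! h
      exact hE ⟨hEV', h⟩
    obtain ⟨F, rfl⟩ := (E.finite_toSet.subset heE).exists_finset_coe
    rw [coe_subset] at heE
    by_cases hFE : F = E
    · rwa [← hFE]
    · exact absurd (Set.Subset.refl _) ((hmin F (heE.ssubset_of_ne hFE)).2 _ he)
  · intro hE
    refine ⟨H.subset_vertexSet_of_mem_edgeSet' hE, fun h => h.2 _ hE (Set.Subset.refl _),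
      fun F hF => ⟨(coe_subset.mpr hF.1).trans (H.subset_vertexSet_of_mem_edgeSet' hE),
        fun e he heF => ?_⟩⟩
    have heE := heF.trans (coe_subset.mpr hF.1)
    rw [hs.2.eq he hE heE] at heF
    exact hF.2 (coe_subset.mp heF)

lemma CycleFree.independenceComplex (hs : H.IsSimple) {n : ℕ} (h : H.CycleFree n) :
    H.independenceComplex.CycleFree n :=
  fun x E hx hE hcyc => h ⟨x, fun i => E i, hx, coe_injective.comp hE, fun i =>
    ⟨(mem_minimalNonfaces_independenceComplex hs).mp (hcyc i).1, (hcyc i).2⟩⟩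

lemma semiInducedBound_independenceComplex [DecidableEq α] (hfin : H.vertexSet.Finite)
    (hs : H.IsSimple) :
    H.independenceComplex.SemiInducedBound H.semiInducedMatchingNumber := by
  intro M hM hsemi
  have hinj : Function.Injective (id : α → α) := Function.injective_id
  rw [← matchingValue_imageFamily hinj]
  refine IsSemiInducedMatching.matchingValue_le hfin ⟨?_, fun e he hsub => ?_⟩
  · rintro _ ⟨E, hE, rfl⟩
    simpa using (mem_minimalNonfaces_independenceComplex hs).mp (hM E hE)
  · rw [sUnion_imageFamily, Set.image_id] at hsub
    obtain ⟨E, rfl⟩ := ((M.biUnion id).finite_toSet.subset hsub).exists_finset_coe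
    rw [coe_subset] at hsub
    rw [← Set.image_id (E : Set α), mem_imageFamily hinj]
    exact hsemi E ((mem_minimalNonfaces_independenceComplex hs).mpr he) hsub

theorem hasRegularity_of_isVertexDecomposable (K : Type*) [Field K] (hfin : H.vertexSet.Finite)
    (hs : H.IsSimple) (h2 : H.CycleFree 2) (h5 : H.CycleFree 5) (hvd : H.IsVertexDecomposable)
    (h : H.inducedMatchingNumber = H.semiInducedMatchingNumber) :
    H.HasRegularity K H.inducedMatchingNumber := by
  classical
  have := hfin.fintype
  refine hasRegularity_of_regularityLE hfin hs fun ρ => regularityLE_of_regularityBound ?_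
  rw [h]
  exact VertexedComplex.IsVertexDecomposable.regularityBound (V := H.vertexSet) hvd
    (Set.Subset.refl _) (h2.independenceComplex hs) (h5.independenceComplex hs)
    (semiInducedBound_independenceComplex hfin hs)

/-! ### Uniform hypergraphs -/

lemma UniformOfCard.card_eq {d : ℕ} (hd : H.UniformOfCard d) {E : Finset H.vertexSet}
    (hE : (↑) '' (E : Set H.vertexSet) ∈ H.edgeSet) : E.card = d := by
  have := hd _ hE
  rw [Subtype.val_injective.encard_image, Set.encard_coe_eq_coe_finsetCard] at this
  exact_mod_cast this

lemma card_inter_add_one_eq [DecidableEq H.vertexSet] {d : ℕ} (hd : H.UniformOfCard d)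
    (hint : ∀ e ∈ H.edgeSet, ∀ f ∈ H.edgeSet, e ≠ f → (e ∩ f).Nonempty →
      (e ∩ f).ncard = d - 1) {E F : Finset H.vertexSet}
    (hE : (↑) '' (E : Set H.vertexSet) ∈ H.edgeSet) (hF : (↑) '' (F : Set H.vertexSet) ∈ H.edgeSet)
    (hEF : E ≠ F) (hne : (E ∩ F).Nonempty) : (E ∩ F).card + 1 = d := by
  have hinj : Function.Injective (Subtype.val : H.vertexSet → α) := Subtype.val_injective
  have himage : (((↑) '' (E : Set H.vertexSet)) ∩ ((↑) '' (F : Set H.vertexSet)) : Set α) =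
      (↑) '' ((E ∩ F : Finset H.vertexSet) : Set H.vertexSet) := by
    rw [coe_inter, Set.image_inter hinj]
  have := hint _ hE _ hF (fun h => hEF (image_coe_injective hinj h))
    (by rw [himage, Set.image_nonempty, coe_nonempty]; exact hne)
  rw [himage, Set.ncard_image_of_injective _ hinj, Set.ncard_coe_finset] at this
  have h1 := card_pos.mpr hne
  have h2 := card_le_card (inter_subset_left : E ∩ F ⊆ E)
  rw [hd.card_eq hE] at h2
  omega

lemma isEdgeMatching_imageFamily {N : Finset (Finset H.vertexSet)}
    (hN : ∀ E ∈ N, (↑) '' (E : Set H.vertexSet) ∈ H.edgeSet)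
    (hdisj : (N : Set (Finset H.vertexSet)).PairwiseDisjoint id) :
    H.IsEdgeMatching (imageFamily (↑) N) := by
  refine ⟨?_, (pairwiseDisjoint_imageFamily Subtype.val_injective).mpr hdisj⟩
  rintro _ ⟨E, hE, rfl⟩
  exact hN E hE

lemma semiInducedMatchingNumber_le_weightedMatchingNumber (hfin : H.vertexSet.Finite)
    (hs : H.IsSimple) {d : ℕ} (hd : H.UniformOfCard d)
    (hint : ∀ e ∈ H.edgeSet, ∀ f ∈ H.edgeSet, e ≠ f → (e ∩ f).Nonempty →
      (e ∩ f).ncard = d - 1) :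
    H.semiInducedMatchingNumber ≤ H.weightedMatchingNumber := by
  classical
  obtain ⟨M, hM, hval⟩ := exists_semiInducedMatching hfin hs
  obtain ⟨N, rfl⟩ := exists_eq_imageFamily hfin hM.1
  have hinj : Function.Injective (Subtype.val : H.vertexSet → α) := Subtype.val_injective
  have hedge : ∀ E ∈ N, (↑) '' (E : Set H.vertexSet) ∈ H.edgeSet := fun E hE =>
    hM.1 ((mem_imageFamily hinj).mpr hE)
  obtain ⟨N', hN'N, hdisj, hle⟩ := exists_matching_of_uniform N
    (fun E hE => hd.card_eq (hedge E hE)) fun E hE F hF hEF hne =>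
      card_inter_add_one_eq hd hint (hedge E hE) (hedge F hF) hEF hne
  have := (isEdgeMatching_imageFamily (fun E hE => hedge E (hN'N hE)) hdisj).matchingValue_le hfin
  rw [matchingValue_imageFamily hinj] at this hval
  omega

theorem hasRegularity_of_uniform (K : Type*) [Field K] (hfin : H.vertexSet.Finite)
    (hs : H.IsSimple) {d : ℕ} (hd : H.UniformOfCard d)
    (hint : ∀ e ∈ H.edgeSet, ∀ f ∈ H.edgeSet, e ≠ f → (e ∩ f).Nonempty →
      (e ∩ f).ncard = d - 1)
    (h : H.inducedMatchingNumber = H.weightedMatchingNumber) :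
    H.HasRegularity K H.inducedMatchingNumber := by
  classical
  have := hfin.fintype
  refine hasRegularity_of_regularityLE hfin hs fun ρ => ?_
  rw [h]
  have hinj : Function.Injective (Subtype.val : H.vertexSet → α) := Subtype.val_injective
  let 𝓔 : Finset (Finset H.vertexSet) :=
    Finset.univ.filter fun E => (↑) '' (E : Set H.vertexSet) ∈ H.edgeSet
  have h𝓔 : ∀ E, E ∈ 𝓔 ↔ (↑) '' (E : Set H.vertexSet) ∈ H.edgeSet := by simp [𝓔]
  have hfaces : H.faceSets = {F | Disjoint F ∅ ∧ ∀ E ∈ 𝓔, ¬ E ⊆ F} := by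
    ext F
    simp only [h𝓔, Set.mem_ofPred_eq, disjoint_empty_right, true_and]
    exact map_mem_faces_independenceComplex
  rw [hfaces]
  refine regularityLE_of_uniform 𝓔 (fun E hE => ?_) (fun E hE => hd.card_eq ((h𝓔 E).mp hE))
    (fun E hE F hF => card_inter_add_one_eq hd hint ((h𝓔 E).mp hE) ((h𝓔 F).mp hF)) ∅
    fun N hN hdisj => ?_
  · have := hs.1 _ ((h𝓔 E).mp hE)
    rwa [Set.image_nonempty, coe_nonempty] at this
  · rw [← matchingValue_imageFamily hinj]
    exact (isEdgeMatching_imageFamily (fun E hE => (h𝓔 E).mp (hN hE)) hdisj).matchingValue_le hfin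

end Hypergraph

/-! ### Graphs -/

namespace SimpleGraph

variable {α : Type*} {G : SimpleGraph α}

lemma ncard_of_mem_edgeSet_asHypergraph {e : Set α} (he : e ∈ G.asHypergraph.edgeSet) :
    e.ncard = 2 := by
  obtain ⟨a, b, hab, rfl⟩ := he
  exact Set.ncard_pair hab.ne

lemma finite_of_mem_edgeSet_asHypergraph {e : Set α} (he : e ∈ G.asHypergraph.edgeSet) :
    e.Finite :=
  Set.finite_of_ncard_ne_zero (by rw [ncard_of_mem_edgeSet_asHypergraph he]; exact two_ne_zero)

lemma asHypergraph_isSimple : G.asHypergraph.IsSimple := by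
  refine ⟨fun e he => ?_, fun e he f hf hne hsub => hne ?_⟩
  · obtain ⟨a, b, _, rfl⟩ := he
    exact Set.insert_nonempty _ _
  · refine Set.eq_of_subset_of_ncard_le hsub ?_ (finite_of_mem_edgeSet_asHypergraph hf)
    rw [ncard_of_mem_edgeSet_asHypergraph he, ncard_of_mem_edgeSet_asHypergraph hf]

lemma asHypergraph_cycleFree_two : G.asHypergraph.CycleFree 2 := by
  rintro ⟨x, E, hx, hE, h⟩
  have hne : x 0 ≠ x 1 := fun h => zero_ne_one (hx h)
  have hpair : ∀ i, {x 0, x 1} = E i := by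
    intro i
    have hsub : {x 0, x 1} ⊆ E i := by
      have h1 := (h i).2
      fin_cases i
      · exact Set.pair_subset h1.1 h1.2
      · exact Set.pair_subset h1.2 h1.1
    refine Set.eq_of_subset_of_ncard_le hsub ?_ (finite_of_mem_edgeSet_asHypergraph (h i).1)
    rw [Set.ncard_pair hne, ncard_of_mem_edgeSet_asHypergraph (h i).1]
  exact zero_ne_one (hE ((hpair 0).symm.trans (hpair 1)))

lemma semiInducedMatchingNumber_le_inducedMatchingNumber [Finite α] :
    G.asHypergraph.semiInducedMatchingNumber ≤ G.asHypergraph.inducedMatchingNumber := by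
  classical
  have hfin : G.asHypergraph.vertexSet.Finite := Set.toFinite _
  obtain ⟨M, hM, hval⟩ := Hypergraph.exists_semiInducedMatching hfin asHypergraph_isSimple
  obtain ⟨N, rfl⟩ := Hypergraph.exists_eq_imageFamily hfin hM.1
  have hinj : Function.Injective (Subtype.val : G.asHypergraph.vertexSet → α) :=
    Subtype.val_injective
  have hcard : ∀ E ∈ N, E.card = 2 := fun E hE => by
    have := ncard_of_mem_edgeSet_asHypergraph (hM.1 ((mem_imageFamily hinj).mpr hE))
    rwa [Set.ncard_image_of_injective _ hinj, Set.ncard_coe_finset] at this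
  obtain ⟨ℓ, N', hN'N, hle, hconst, -, hsep⟩ := exists_labelling_of_graph N hcard
  have hdisj : (N' : Set (Finset G.asHypergraph.vertexSet)).PairwiseDisjoint id := by
    intro E hE F hF hne
    refine Finset.disjoint_left.mpr fun v hvE hvF => hne (hsep E hE F hF v hvE v hvF rfl)
  have hN'sub : imageFamily Subtype.val N' ⊆ imageFamily Subtype.val N :=
    Set.image_mono (coe_subset.mpr hN'N)
  have hind : G.asHypergraph.IsInducedEdgeMatching (imageFamily Subtype.val N') := by
    refine ⟨⟨hN'sub.trans hM.1, fun e he hsub => ?_⟩, (pairwiseDisjoint_imageFamily hinj).mpr hdisj⟩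
    obtain ⟨E, rfl⟩ := Hypergraph.exists_finset_image_eq hfin he
    have hEN := (mem_imageFamily hinj).mp (hM.2 _ he (hsub.trans (Set.sUnion_mono hN'sub)))
    rw [mem_imageFamily hinj]
    rw [sUnion_imageFamily, image_coe_subset_image_coe_iff hinj] at hsub
    obtain ⟨a, b, hab, rfl⟩ := card_eq_two.mp (hcard E hEN)
    obtain ⟨F, hF, haF⟩ := mem_biUnion.mp (hsub (mem_insert_self a _))
    obtain ⟨F', hF', hbF'⟩ := mem_biUnion.mp (hsub (mem_insert_of_mem (mem_singleton_self b)))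
    have hFF' := hsep F hF F' hF' a haF b hbF'
      (hconst _ hEN a (mem_insert_self a _) b (mem_insert_of_mem (mem_singleton_self b)))
    subst hFF'
    have : {a, b} = F := by
      refine eq_of_subset_of_card_le ?_ ?_
      · intro v hv
        rcases mem_insert.mp hv with rfl | hv
        · exact haF
        · rwa [mem_singleton.mp hv]
      · rw [hcard F (hN'N hF), hcard _ hEN]
    rwa [this]
  have hval' := hind.matchingValue_le hfin
  have hcard' : (N'.biUnion id).card = N'.card * 2 := by
    rw [card_biUnion hdisj]
    exact Finset.sum_const_nat fun E hE => hcard E (hN'N hE)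
  rw [matchingValue_imageFamily hinj] at hval hval'
  rw [hcard'] at hval'
  push_cast at hval'
  omega

end SimpleGraph
theorem mainTheorem6 (K : Type*) [Field K] (α : Type*) :
    -- (i)
    (∀ H : Hypergraph α, H.vertexSet.Finite → H.IsSimple → H.CycleFree 2 → H.CycleFree 5 →
      H.IsVertexDecomposable →
      H.inducedMatchingNumber = H.independenceComplex.dim + 1 →
        H.HasRegularity K H.inducedMatchingNumber ∧
        H.inducedMatchingNumber = H.semiInducedMatchingNumber ∧
        H.semiInducedMatchingNumber = H.independenceComplex.dim + 1) ∧
    -- (ii)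
    (∀ H : Hypergraph α, H.vertexSet.Finite → H.IsSimple → H.CycleFree 2 → H.CycleFree 5 →
      H.IsVertexDecomposable →
      H.inducedMatchingNumber = H.semiInducedMatchingNumber →
        H.HasRegularity K H.inducedMatchingNumber) ∧
    -- (iii)
    (∀ G : SimpleGraph α, Finite α → G.asHypergraph.CycleFree 5 →
      G.asHypergraph.IsVertexDecomposable →
        G.asHypergraph.HasRegularity K G.asHypergraph.inducedMatchingNumber) ∧
    -- (iv)
    (∀ (H : Hypergraph α) (d : ℕ), H.vertexSet.Finite → H.IsSimple → H.UniformOfCard d →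
      (∀ e ∈ H.edgeSet, ∀ f ∈ H.edgeSet, e ≠ f → (e ∩ f).Nonempty → (e ∩ f).ncard = d - 1) →
      H.inducedMatchingNumber = H.weightedMatchingNumber →
        H.HasRegularity K H.inducedMatchingNumber ∧
        H.inducedMatchingNumber = H.semiInducedMatchingNumber ∧
        H.semiInducedMatchingNumber = H.weightedMatchingNumber) := by
  refine ⟨fun H hfin hs _ _ _ h => ?_, fun H hfin hs h2 h5 hvd h => ?_, fun G _ h5 hvd => ?_,
    fun H d hfin hs hd hint h => ?_⟩
  · have h1 := Hypergraph.inducedMatchingNumber_le_semiInducedMatchingNumber hfin hs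
    have h2 := Hypergraph.semiInducedMatchingNumber_le_dim_add_one hfin hs
    exact ⟨Hypergraph.hasRegularity_of_eq_dim_add_one K hfin hs h, by omega, by omega⟩
  · exact Hypergraph.hasRegularity_of_isVertexDecomposable K hfin hs h2 h5 hvd h
  · have hfin : G.asHypergraph.vertexSet.Finite := Set.toFinite _
    have hs := SimpleGraph.asHypergraph_isSimple (G := G)
    exact Hypergraph.hasRegularity_of_isVertexDecomposable K hfin hs
      SimpleGraph.asHypergraph_cycleFree_two h5 hvd
      (le_antisymm (Hypergraph.inducedMatchingNumber_le_semiInducedMatchingNumber hfin hs)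
        SimpleGraph.semiInducedMatchingNumber_le_inducedMatchingNumber)
  · have h1 := Hypergraph.inducedMatchingNumber_le_semiInducedMatchingNumber hfin hs
    have h2 := Hypergraph.semiInducedMatchingNumber_le_weightedMatchingNumber hfin hs hd hint
    exact ⟨Hypergraph.hasRegularity_of_uniform K hfin hs hd hint h, by omega, by omega⟩
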